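/- \textbf{Setting.} For $n\ge 2$ let $E_n$ be the edge set of the complete graph $K_n$ and $\mathcal T_n$ the set of its spanning trees. A \emph{strategy} is a map $\sigma:2^{E_n}\times\mathcal T_n\to E_n$ with $\sigma(F,T)\in E(T)$ for all $F,T$; let $\mathcal S_n$ be the set of strategies. Let $T_1,T_2,\dots$ be independent uniformly random elements of $\mathcal T_n$. Starting from the graph $G_{\sigma,0}$ on the vertices of $K_n$ with no edges, in round $i\ge 1$ the edge $\sigma(E(G_{\sigma,i-1}),T_i)$ is added to $G_{\sigma,i-1}$ (if it is not already present), which gives $G_{\sigma,i}$. A graph is \emph{$k$-connected} if it has more than $k$ vertices and remains connected after the deletion of any fewer than $k$ vertices. Let $\mathcal P_{\mathrm{con},k}$ be the set of $k$-connected graphs on the vertex set of $K_n$, and let $\tau(\sigma,\mathcal P_{\mathrm{con},k})=\min\{i\ge 0: G_{\sigma,i}\in\mathcal P_{\mathrm{con},k}\}$ (with $\min\emptyset=\infty$). An event depending on $n$ holds \emph{whp} if its probability tends to $1$ as $n\to\infty$. \textbf{Theorem.} Let $k=k(n)$ be integers with $k(n)\ge 2$ for all large $n$ and $k=o(n)$,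 and let $\omega=\omega(n)\to\infty$ be any real function. Then there are strategies $\sigma=\sigma_n\in\mathcal S_n$ ($n\ge 2$) such that whp $$\tau(\sigma,\mathcal P_{\mathrm{con},k})\le \frac{nk}{2}+\omega k\max\{k,n^{3/4}\}.$$ Moreover, if $k=o\!\left(\frac{n^{1/2}}{(\log n)^2}\right)$, then for the same strategies, whp $\tau=\tau(\sigma,\mathcal P_{\mathrm{con},k})$ is finite and $G_{\sigma,\tau}$ has a spanning $k$-connected subgraph all of whose vertices have degree $k$ or $k+1$. -/

import Mathlib

open Filter Topology Asymptotics MeasureTheory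

namespace USTSR

/-- The set `𝒯ₙ` of spanning trees of the complete graph on the `n` vertices `Fin n`. -/
def SpanningTree (n : ℕ) : Type := {T : SimpleGraph (Fin n) // T.IsTree}

/-- `𝒯ₙ` is finite; every subset is an event. -/
instance (n : ℕ) : MeasurableSpace (SpanningTree n) := ⊤

/-- A strategy: given the graph `F` built so far (a subset of the edges of `Kₙ`) and the offered
spanning tree `T`, it selects an edge of `T`. There is none for `n = 1`. -/
structure Strategy (n : ℕ) where
  pick : SimpleGraph (Fin n) → SpanningTree n → Sym2 (Fin n)
  pick_mem : ∀ (F : SimpleGraph (Fin n)) (T : SpanningTree n), pick F T ∈ T.1.edgeSet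

/-- The graph `G_{σ,i}` built after `i` rounds, when `T j` is the tree offered in
round `j + 1`. -/
def graphAfter {n : ℕ} (σ : Strategy n) (T : ℕ → SpanningTree n) : ℕ → SimpleGraph (Fin n)
  | 0 => ⊥
  | i + 1 => graphAfter σ T i ⊔
      SimpleGraph.fromEdgeSet {σ.pick (graphAfter σ T i) (T i)}

/-- The law of the sequence of offered trees: independent and uniform on `𝒯ₙ`
(a probability measure for every `n ≥ 1`). -/
noncomputable def treesLaw (n : ℕ) : Measure (ℕ → SpanningTree n) :=
  Measure.infinitePi fun _ : ℕ => ProbabilityTheory.uniformOn (Set.univ : Set (SpanningTree n))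

/-- The hitting time `τ(σ, 𝒫) = min {i ≥ 0 : G_{σ,i} ∈ 𝒫}`, which is `⊤` if there is no
such `i`. -/
noncomputable def hittingTime {n : ℕ} (σ : Strategy n) (P : Set (SimpleGraph (Fin n)))
    (T : ℕ → SpanningTree n) : ℕ∞ :=
  ⨅ (i : ℕ) (_ : graphAfter σ T i ∈ P), (i : ℕ∞)

/-- `G` is `k`-connected: it has more than `k` vertices and it stays connected after the deletion
of any fewer than `k` vertices. -/
def IsKConnected {V : Type*} [Fintype V] (k : ℕ) (G : SimpleGraph V) : Prop :=
  k < Fintype.card V ∧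
    ∀ X : Finset V, X.card < k → (G.induce {v : V | v ∉ X}).Connected

/-- The property `𝒫_{con,k}` of being a `k`-connected graph on `n` vertices. -/
def kConnectedGraphs (n k : ℕ) : Set (SimpleGraph (Fin n)) := {G | IsKConnected k G}

open Classical in
/-- All degrees of `H` are `k` or `k + 1`. -/
def DegreesKOrSucc {V : Type*} [Fintype V] (k : ℕ) (H : SimpleGraph V) : Prop :=
  ∀ v : V, H.degree v = k ∨ H.degree v = k + 1

/-- The events `A n` about the offered trees hold with high probability. -/
def Whp (A : (n : ℕ) → Set (ℕ → SpanningTree n)) : Prop :=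
  Tendsto (fun n => treesLaw n (A n)) atTop (𝓝 1)

end USTSR

/-! A uniform spanning tree is hard to avoid. A set `S` of ordered pairs of distinct vertices
contains no edge of the tree with probability at most `n * exp (-|S| / n)` (`treeProb_not_hits_le`).
This follows by dividing a count of parent functions that avoid `S` by a lower bound of Cayley type
for the number of trees. Hence, when at least `n * r` pairs are useful, with `r` a small power of
`n`, a useful edge is almost surely on offer. When no useful edge is offered, the strategy repeats
an old edge if the tree has one; this costs a round but does no damage.
`exists_strategy_of_potential` turns such one-round estimates into a bound on the failure
probability of a whole strategy. One potential pays for the risk that a round offers neither a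
useful nor an old edge, and the other for the expected number of wasted rounds.

Let `r` be the integer part of the 80th root of `n`, so that `r ^ 60` is at most `n ^ (3/4)`.

If `k > r ^ 22`, the target is fixed in advance: the circulant graph of degree at most `2 * ((k + 1)
/ 2)`, which is `k` or `k + 1`. Collecting its last edges is a coupon collector problem that wastes
about `n * r * log n` rounds, far fewer than `k * r ^ 60`; rounding the degree up costs at most a
further `n / 2` (`exists_strategy_fixed_target`, `exists_strategy_of_pow_lt`).

For bounded `k` a fixed target is too slow, since waiting for a single prescribed edge takes about
`n / 2` rounds. If `k ≤ r ^ 22` the target therefore stays flexible, so that until the last few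
edges there are many useful pairs. The vertices are first covered by paths on at most `M` vertices.
Then `K` of the full paths are joined to each other, which gives a core of pairwise adjacent paths.
The other paths are attached one after another, each by edges to `k` different paths that are
attached already. Finally the remaining vertices of degree less than `k` are supplied with edges.
Throughout, a vertex has at most one neighbour on each other path, and degrees stay at most `k + 1`.

The result is `k`-connected by `PathCover.Fits.isKConnected`. Fewer than `k` deletions cannot
separate the paths they leave intact (`PathCover.Robust`). A piece that lies entirely on damaged
paths is excluded by counting degrees: its vertices could reach degree `k` only if every deleted
vertex were on a path of its own, and then one can walk along a path away from its deleted vertex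
forever.

In both regimes the graph that reaches `k`-connectivity has all degrees `k` or `k + 1`, so it is
itself the required spanning subgraph. The time is at most `n * k / 2 + 2 * k * n ^ (3/4)`, and `ω`
absorbs the constant. -/

namespace USTSR

/-! ### Counting spanning trees by parent functions. -/

section RootedForests

set_option linter.unusedSectionVars false

variable {V : Type*} [Fintype V] [DecidableEq V]

/-- A partial parent function is a rooted forest if it decreases some height function. -/
def IsRootedForest (p : V → Option V) : Prop :=
  ∃ h : V → ℕ, ∀ v w, p v = some w → h w < h v

open Classical in
/-- The rooted forests with `j` edges. -/
noncomputable def rootedForests (V : Type*) [Fintype V] [DecidableEq V] (j : ℕ) :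
    Finset (V → Option V) :=
  Finset.univ.filter fun p => IsRootedForest p ∧ (Finset.univ.filter fun v => p v ≠ none).card = j

theorem IsRootedForest.exists_root {p : V → Option V} (hp : IsRootedForest p) :
    ∃ ρ : V → V, (∀ v, p (ρ v) = none) ∧ (∀ v, p v = none → ρ v = v) ∧
      ∀ v w, p v = some w → ρ v = ρ w := by
  obtain ⟨h, hh⟩ := hp
  have key : ∀ m v, h v ≤ m → ∃ r, p r = none ∧
      (fun x => (p x).getD x)^[m] v = r := by
    intro m
    induction m with
    | zero =>
      intro v hv
      refine ⟨v, ?_, rfl⟩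
      cases hpv : p v with
      | none => rfl
      | some w => have := hh v w hpv; omega
    | succ m ih =>
      intro v hv
      rw [Function.iterate_succ_apply]
      cases hpv : p v with
      | none =>
        refine ⟨v, hpv, ?_⟩
        simp only [Option.getD_none]
        exact Function.iterate_fixed (by simp [hpv]) m
      | some w =>
        have := hh v w hpv
        simpa using ih w (by omega)
  -- Roots are fixed points of `g`, so iterating it as often as the largest height takes every
  -- vertex to its root.
  set g : V → V := fun x => (p x).getD x with hg
  set H := Finset.univ.sup h
  have hH : ∀ v, h v ≤ H := fun v => Finset.le_sup (Finset.mem_univ v)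
  refine ⟨g^[H], fun v => ?_, fun v hv => Function.iterate_fixed (by simp [hg, hv]) H,
    fun v w hvw => ?_⟩
  · obtain ⟨r, hr, e⟩ := key H v (hH v)
    rw [e]; exact hr
  · obtain ⟨r, hr, e⟩ := key H v (hH v)
    have h1 : g^[H] (g v) = g (g^[H] v) := by
      rw [← Function.iterate_succ_apply, Function.iterate_succ_apply']
    have h2 : g v = w := by simp [hg, hvw]
    rw [h2] at h1
    rw [h1]
    change _ = r at e
    rw [e]; simp [hg, hr]

/-- Hanging the tree of the root `r` below a vertex of another tree creates no cycle: lifting that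
whole tree above all old heights restores a decreasing height. -/
theorem IsRootedForest.update {p : V → Option V} (hp : IsRootedForest p) {ρ : V → V}
    (hρ : ∀ v w, p v = some w → ρ v = ρ w) {r v : V} (hv : ρ v ≠ r) (hr : ρ r = r) :
    IsRootedForest (Function.update p r (some v)) := by
  classical
  obtain ⟨h, hh⟩ := hp
  refine ⟨fun x => h x + if ρ x = r then Finset.univ.sup h + 1 else 0, fun x w hxw => ?_⟩
  by_cases hx : x = r
  · subst hx
    simp only [Function.update_self, Option.some.injEq] at hxw
    subst hxw
    have : h v ≤ Finset.univ.sup h := Finset.le_sup (Finset.mem_univ v)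
    simp only [hv, hr, if_true, if_false]
    omega
  · rw [Function.update_of_ne hx] at hxw
    have := hh x w hxw
    simp only [hρ x w hxw]
    omega

/-- Pitman's double counting. A forest with `j` edges can be extended by choosing any vertex `v` and
any of the `|V| - j - 1` roots of the other trees, and hanging that root below `v`. The new forest
together with the marked vertex that stopped being a root determines all choices. -/
theorem card_rootedForests_succ (j : ℕ) :
    (rootedForests V j).card * (Fintype.card V * (Fintype.card V - j - 1)) ≤
      (rootedForests V (j + 1)).card * (j + 1) := by
  classical
  have hroot : ∀ p : rootedForests V j, ∃ ρ : V → V, (∀ v, p.1 (ρ v) = none) ∧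
      (∀ v, p.1 v = none → ρ v = v) ∧ ∀ v w, p.1 v = some w → ρ v = ρ w := by
    rintro ⟨p, hp⟩
    exact (Finset.mem_filter.1 hp).2.1.exists_root
  choose ρ hρ1 hρ2 hρ3 using hroot
  let A : Finset (Σ _ : rootedForests V j, V × V) :=
    Finset.univ.sigma fun p => Finset.univ.filter fun x : V × V => p.1 x.2 = none ∧ ρ p x.1 ≠ x.2
  let B : Finset (Σ _ : V → Option V, V) :=
    (rootedForests V (j + 1)).sigma fun p => Finset.univ.filter fun r => p r ≠ none
  have hA : A.card = (rootedForests V j).card *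
      (Fintype.card V * (Fintype.card V - j - 1)) := by
    rw [Finset.card_sigma]
    rw [Finset.sum_const_nat (m := Fintype.card V * (Fintype.card V - j - 1))]
    · simp
    · rintro p -
      have hc : (Finset.univ.filter fun r => p.1 r = none).card = Fintype.card V - j := by
        have := (Finset.mem_filter.1 p.2).2.2
        have h2 := Finset.card_filter_add_card_filter_not (s := (Finset.univ : Finset V))
          (fun v => p.1 v ≠ none)
        simp only [ne_eq, not_not, Finset.card_univ] at h2 this
        omega
      have : (Finset.univ.filter fun x : V × V => p.1 x.2 = none ∧ ρ p x.1 ≠ x.2) =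
          Finset.univ.biUnion fun v => ((Finset.univ.filter fun r => p.1 r = none).erase
            (ρ p v)).image fun r => (v, r) := by
        ext ⟨a, b⟩
        simp only [Finset.mem_filter, Finset.mem_univ, true_and, Finset.mem_biUnion,
          Finset.mem_image, Finset.mem_erase, Prod.mk.injEq]
        constructor
        · rintro ⟨h1, h2⟩
          exact ⟨a, b, ⟨Ne.symm h2, h1⟩, rfl, rfl⟩
        · rintro ⟨a', b', ⟨h1, h2⟩, rfl, rfl⟩
          exact ⟨h2, Ne.symm h1⟩
      rw [this, Finset.card_biUnion]
      · rw [Finset.sum_const_nat (m := Fintype.card V - j - 1)]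
        · simp
        · intro v _
          rw [Finset.card_image_of_injective _ (fun a b hab => by simpa using hab),
            Finset.card_erase_of_mem (by simp [hρ1]), hc]
      · intro v _ w _ hvw
        rw [Function.onFun, Finset.disjoint_left]
        intro x hx hx'
        simp only [Finset.mem_image] at hx hx'
        obtain ⟨a, _, rfl⟩ := hx
        obtain ⟨b, _, hb⟩ := hx'
        simp only [Prod.mk.injEq] at hb
        exact hvw hb.1.symm
  have hB : B.card = (rootedForests V (j + 1)).card * (j + 1) := by
    rw [Finset.card_sigma, Finset.sum_const_nat (m := j + 1)]
    intro p hp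
    exact (Finset.mem_filter.1 hp).2.2
  rw [← hA, ← hB]
  refine Finset.card_le_card_of_injOn
    (fun x => ⟨Function.update x.1.1 x.2.2 (some x.2.1), x.2.2⟩) ?_ ?_
  · rintro ⟨p, v, r⟩ hx
    simp only [A, Finset.mem_coe, Finset.mem_sigma, Finset.mem_univ, Finset.mem_filter, true_and]
      at hx
    have hp := (Finset.mem_filter.1 p.2).2
    simp only [B, Finset.mem_coe, Finset.mem_sigma, Finset.mem_filter, Finset.mem_univ, true_and,
      rootedForests, Function.update_self, ne_eq, reduceCtorEq, not_false_eq_true, and_true]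
    refine ⟨hp.1.update (hρ3 p) hx.2 (hρ2 p r hx.1), ?_⟩
    have : (Finset.univ.filter fun x => ¬ Function.update p.1 r (some v) x = none) =
        insert r (Finset.univ.filter fun x => p.1 x ≠ none) := by
      ext x
      by_cases hxr : x = r
      · subst hxr; simp
      · simp [hxr]
    rw [this, Finset.card_insert_of_notMem (by simp [hx.1]), hp.2]
  · rintro ⟨p, v, r⟩ hx ⟨p', v', r'⟩ hx' heq
    simp only [A, Finset.mem_coe, Finset.mem_sigma, Finset.mem_univ, Finset.mem_filter, true_and]
      at hx hx'
    simp only [Sigma.mk.injEq, heq_eq_eq] at heq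
    obtain ⟨h1, rfl⟩ := heq
    have hv : v = v' := by simpa using congrFun h1 r
    subst hv
    have hp : p = p' := by
      apply Subtype.ext
      funext x
      by_cases hxr : x = r
      · subst hxr; rw [hx.1, hx'.1]
      · simpa [hxr] using congrFun h1 x
    subst hp
    rfl

theorem pow_mul_descFactorial_le_card_rootedForests (j : ℕ) :
    Fintype.card V ^ j * (Fintype.card V - 1).descFactorial j ≤
      (rootedForests V j).card * j.factorial := by
  induction j with
  | zero =>
    simp only [pow_zero, Nat.descFactorial_zero, mul_one, Nat.factorial_zero, Nat.one_le_iff_ne_zero]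
    refine Finset.card_ne_zero.2 ⟨fun _ => none, ?_⟩
    simp only [rootedForests, Finset.mem_filter, Finset.mem_univ, true_and]
    exact ⟨⟨fun _ => 0, by simp⟩, by simp⟩
  | succ j ih =>
    have h := card_rootedForests_succ (V := V) j
    rw [Nat.descFactorial_succ, Nat.factorial_succ]
    calc Fintype.card V ^ (j + 1) * ((Fintype.card V - 1 - j) * (Fintype.card V - 1).descFactorial j)
        = (Fintype.card V ^ j * (Fintype.card V - 1).descFactorial j) *
            (Fintype.card V * (Fintype.card V - j - 1)) := by
          rw [show Fintype.card V - 1 - j = Fintype.card V - j - 1 by omega]; ring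
      _ ≤ ((rootedForests V j).card * j.factorial) *
            (Fintype.card V * (Fintype.card V - j - 1)) := Nat.mul_le_mul_right _ ih
      _ = ((rootedForests V j).card * (Fintype.card V * (Fintype.card V - j - 1))) *
            j.factorial := by ring
      _ ≤ ((rootedForests V (j + 1)).card * (j + 1)) * j.factorial := Nat.mul_le_mul_right _ h
      _ = _ := by ring

/-- The graph of a parent function. -/
def parentGraph (p : V → Option V) : SimpleGraph V :=
  SimpleGraph.fromRel fun x y => p x = some y

theorem parentGraph_adj {p : V → Option V} (hp : IsRootedForest p) {x y : V} :
    (parentGraph p).Adj x y ↔ p x = some y ∨ p y = some x := by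
  obtain ⟨h, hh⟩ := hp
  rw [parentGraph, SimpleGraph.fromRel_adj]
  refine ⟨fun H => H.2, fun H => ⟨?_, H⟩⟩
  rintro rfl
  rcases H with H | H <;> exact absurd (hh _ _ H) (lt_irrefl _)

/-- Every vertex descends to `r`, and each edge joins some `v ≠ r` to its parent, so there are at
most `|V| - 1` edges. -/
theorem isTree_parentGraph {p : V → Option V} (hp : IsRootedForest p) {r : V}
    (hr : ∀ v, p v = none ↔ v = r) : (parentGraph p).IsTree := by
  classical
  have hreach : ∀ v, (parentGraph p).Reachable v r := by
    obtain ⟨h, hh⟩ := id hp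
    intro v
    induction hv : h v using Nat.strong_induction_on generalizing v with
    | _ m ih =>
      cases hpv : p v with
      | none => rw [(hr v).1 hpv]
      | some w =>
        have hadj : (parentGraph p).Adj v w := (parentGraph_adj hp).2 (Or.inl hpv)
        exact hadj.reachable.trans (ih (h w) (by have := hh v w hpv; omega) w rfl)
  have hconn : (parentGraph p).Connected :=
    { preconnected := fun u v => (hreach u).trans (hreach v).symm, nonempty := ⟨r⟩ }
  rw [SimpleGraph.isTree_iff_connected_and_card]
  refine ⟨hconn, le_antisymm ?_ hconn.card_vert_le_card_edgeSet_add_one⟩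
  have hsub : (parentGraph p).edgeSet ⊆
      ((Finset.univ.erase r).image fun v => s(v, (p v).getD v) : Finset (Sym2 V)) := by
    intro e
    induction e using Sym2.ind with
    | _ x y =>
      intro he
      rw [SimpleGraph.mem_edgeSet, parentGraph_adj hp] at he
      simp only [Finset.coe_image, Set.mem_image, Finset.mem_coe, Finset.mem_erase, Finset.mem_univ,
        and_true]
      rcases he with he | he
      · refine ⟨x, fun hx => ?_, by simp [he]⟩
        rw [(hr x).2 hx] at he; cases he
      · refine ⟨y, fun hx => ?_, by simp [he, Sym2.eq_swap]⟩
        rw [(hr y).2 hx] at he; cases he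
  have h1 := Set.ncard_le_ncard hsub (Finset.finite_toSet _)
  rw [Set.ncard_coe_finset] at h1
  have h2 : ((Finset.univ.erase r).image fun v => s(v, (p v).getD v)).card ≤
      Fintype.card V - 1 := by
    refine Finset.card_image_le.trans ?_
    rw [Finset.card_erase_of_mem (Finset.mem_univ r), Finset.card_univ]
  have h3 : 0 < Fintype.card V := Fintype.card_pos_iff.2 ⟨r⟩
  rw [Nat.card_coe_set_eq, Nat.card_eq_fintype_card]
  omega

/-- The orientation of the edges is recovered from the roots upwards: if `p'` reversed the edge from
`x` to its parent, then by induction on height so would `p`. -/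
theorem parentGraph_injective {p p' : V → Option V} (hp : IsRootedForest p)
    (hp' : IsRootedForest p') (h0 : ∀ v, p v = none ↔ p' v = none)
    (h : parentGraph p = parentGraph p') : p = p' := by
  obtain ⟨f, hf⟩ := id hp
  funext x
  induction hx : f x using Nat.strong_induction_on generalizing x with
  | _ m ih =>
    cases hpx : p x with
    | none => exact ((h0 x).1 hpx).symm
    | some w =>
      have hadj : (parentGraph p').Adj x w := h ▸ (parentGraph_adj hp).2 (Or.inl hpx)
      rcases (parentGraph_adj hp').1 hadj with h1 | h1
      · exact h1.symm
      · have hlt := hf x w hpx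
        have := ih (f w) (by omega) w rfl
        rw [h1] at this
        have := hf w x this
        omega

/-- The lower bound in Cayley's formula. A rooted forest with `|V| - 1` edges has one root, and it
is recovered from that root and its tree. -/
theorem pow_card_le_card_mul_card_isTree [Nonempty V] :
    Fintype.card V ^ (Fintype.card V - 1) ≤
      Fintype.card V * Nat.card {T : SimpleGraph V // T.IsTree} := by
  classical
  have h := pow_mul_descFactorial_le_card_rootedForests (V := V) (Fintype.card V - 1)
  rw [Nat.descFactorial_self] at h
  refine (Nat.le_of_mul_le_mul_right h (Nat.factorial_pos _)).trans ?_
  have hn : 0 < Fintype.card V := Fintype.card_pos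
  have hr : ∀ p : rootedForests V (Fintype.card V - 1), ∃ r, ∀ v, p.1 v = none ↔ v = r := by
    rintro ⟨p, hp⟩
    have hp := (Finset.mem_filter.1 hp).2.2
    have h2 := Finset.card_filter_add_card_filter_not (s := (Finset.univ : Finset V))
      (fun v => p v ≠ none)
    rw [hp, Finset.card_univ] at h2
    obtain ⟨r, hr⟩ := Finset.card_eq_one.1 (show (Finset.univ.filter fun v => ¬ p v ≠ none).card = 1
      by omega)
    refine ⟨r, fun v => ?_⟩
    have := Finset.ext_iff.1 hr v
    simpa using this
  choose r hr using hr
  rw [Nat.card_eq_fintype_card, ← Fintype.card_prod, ← Fintype.card_coe]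
  have hF : ∀ p : rootedForests V (Fintype.card V - 1), IsRootedForest p.1 :=
    fun p => (Finset.mem_filter.1 p.2).2.1
  refine Fintype.card_le_of_injective
    (fun p => ((r p, ⟨parentGraph p.1, isTree_parentGraph (hF p) (hr p)⟩) :
      V × {T : SimpleGraph V // T.IsTree})) ?_
  intro p p' hpp
  simp only [Prod.mk.injEq, Subtype.mk.injEq] at hpp
  exact Subtype.ext (parentGraph_injective (hF p) (hF p')
    (fun v => by rw [hr p, hr p', hpp.1]) hpp.2)

theorem exists_adj_dist_lt {T : SimpleGraph V} (hT : T.Connected) {r v : V} (hv : v ≠ r) :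
    ∃ w, T.Adj v w ∧ T.dist w r < T.dist v r := by
  obtain ⟨p, hp⟩ := hT.exists_walk_length_eq_dist v r
  cases p with
  | nil => exact absurd rfl hv
  | cons h q =>
    refine ⟨_, h, ?_⟩
    rw [← hp, SimpleGraph.Walk.length_cons]
    exact Nat.lt_succ_of_le (SimpleGraph.dist_le q)

/-- Bounding the spanning trees that avoid a set of ordered pairs by counting parent functions. -/
theorem card_isTree_avoiding_le (S : Finset (V × V)) (r : V) :
    Nat.card {T : SimpleGraph V // T.IsTree ∧ ∀ x ∈ S, ¬ T.Adj x.1 x.2} ≤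
      ∏ v ∈ Finset.univ.erase r,
        (Finset.univ.filter fun w => w ≠ v ∧ (v, w) ∉ S).card := by
  classical
  -- Each vertex other than `r` points to a neighbour closer to `r`. The tree is determined by these
  -- pointers, and none of them is a pair of `S`.
  have hex : ∀ T : {T : SimpleGraph V // T.IsTree ∧ ∀ x ∈ S, ¬ T.Adj x.1 x.2},
      ∃ f : V → V, f r = r ∧ ∀ v, v ≠ r → T.1.Adj v (f v) ∧ T.1.dist (f v) r < T.1.dist v r := by
    rintro ⟨T, hT, -⟩
    choose g hg using fun v : {v // v ≠ r} => exists_adj_dist_lt hT.connected v.2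
    refine ⟨fun v => if h : v = r then r else g ⟨v, h⟩, by simp, fun v hv => ?_⟩
    simpa [hv] using hg ⟨v, hv⟩
  choose f hfr hf using hex
  have hgraph : ∀ T x y, T.1.Adj x y ↔
      ((x ≠ r ∧ f T x = y) ∨ (y ≠ r ∧ f T y = x)) := by
    intro T
    have hsub : (((Finset.univ.erase r).image fun v => s(v, f T v) : Finset (Sym2 V)) :
        Set (Sym2 V)) ⊆ T.1.edgeSet := by
      intro e he
      simp only [Finset.coe_image, Set.mem_image, Finset.mem_coe, Finset.mem_erase,
        Finset.mem_univ, and_true] at he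
      obtain ⟨v, hv, rfl⟩ := he
      exact (hf T v hv).1
    have hcard : ((Finset.univ.erase r).image fun v => s(v, f T v)).card =
        Fintype.card V - 1 := by
      rw [Finset.card_image_of_injOn, Finset.card_erase_of_mem (Finset.mem_univ r),
        Finset.card_univ]
      intro v hv w hw hvw
      simp only [Finset.coe_erase, Finset.coe_univ, Set.mem_sdiff, Set.mem_univ,
        Set.mem_singleton_iff, true_and] at hv hw
      rcases Sym2.eq_iff.1 hvw with h | h
      · exact h.1
      -- If two vertices produced the same edge crosswise, each would be closer to `r` than the
      -- other.
      · have h1 := (hf T v hv).2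
        have h2 := (hf T w hw).2
        rw [h.2] at h1
        rw [← h.1] at h2
        omega
    have hT := (SimpleGraph.isTree_iff_connected_and_card.1 T.2.1).2
    have heq := Set.eq_of_subset_of_ncard_le hsub (by
      rw [Set.ncard_coe_finset, hcard]
      rw [Nat.card_coe_set_eq, Nat.card_eq_fintype_card] at hT
      omega)
    intro x y
    rw [← SimpleGraph.mem_edgeSet, ← heq]
    simp only [Finset.coe_image, Set.mem_image, Finset.mem_coe, Finset.mem_erase,
      Finset.mem_univ, and_true, Sym2.eq_iff]
    constructor
    · rintro ⟨v, hv, ⟨rfl, h⟩ | ⟨rfl, h⟩⟩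
      · exact Or.inl ⟨hv, h⟩
      · exact Or.inr ⟨hv, h⟩
    · rintro (⟨hv, h⟩ | ⟨hv, h⟩)
      · exact ⟨x, hv, Or.inl ⟨rfl, h⟩⟩
      · exact ⟨y, hv, Or.inr ⟨rfl, h⟩⟩
  have hinj : Function.Injective f := by
    intro T T' hTT
    apply Subtype.ext
    ext x y
    rw [hgraph, hgraph, hTT]
  let t : V → Finset V := fun v =>
    if v = r then {r} else Finset.univ.filter fun w => w ≠ v ∧ (v, w) ∉ S
  have hmem : ∀ T, f T ∈ Fintype.piFinset t := by
    intro T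
    rw [Fintype.mem_piFinset]
    intro v
    by_cases hv : v = r
    · simp [t, hv, hfr]
    · have hadj := (hf T v hv).1
      simp only [t, hv, if_false, Finset.mem_filter, Finset.mem_univ, true_and]
      exact ⟨hadj.ne', fun hS => T.2.2 _ hS hadj⟩
  rw [Nat.card_eq_fintype_card]
  refine (Fintype.card_le_of_injective
    (fun T => (⟨f T, hmem T⟩ : Fintype.piFinset t)) fun T T' h => hinj (by simpa using h)).trans ?_
  rw [Fintype.card_coe, Fintype.card_piFinset, ← Finset.mul_prod_erase _ _ (Finset.mem_univ r)]
  simp only [t, if_true, Finset.card_singleton, one_mul]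
  refine le_of_eq (Finset.prod_congr rfl fun v hv => ?_)
  rw [if_neg (Finset.ne_of_mem_erase hv)]

/-- If `s v` pairs of `S` start at `v`, then `v` has `n - 1 - s v ≤ n * exp (-(s v + 1) / n)`
possible parents. The product over `v ≠ r` is compared with the lower bound for the number of trees.
-/
theorem card_isTree_avoiding_le_exp (S : Finset (V × V)) (hS : ∀ x ∈ S, x.1 ≠ x.2)
    [Nonempty V] :
    (Nat.card {T : SimpleGraph V // T.IsTree ∧ ∀ x ∈ S, ¬ T.Adj x.1 x.2} : ℝ) ≤
      Nat.card {T : SimpleGraph V // T.IsTree} *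
        (Fintype.card V * Real.exp (-(S.card / Fintype.card V : ℝ))) := by
  classical
  obtain ⟨r⟩ := ‹Nonempty V›
  set n := Fintype.card V with hn
  have hn0 : 0 < n := Fintype.card_pos_iff.2 ⟨r⟩
  have hnR : (0 : ℝ) < n := by exact_mod_cast hn0
  let s : V → ℕ := fun v => (Finset.univ.filter fun w => (v, w) ∈ S).card
  have hsum : S.card = ∑ v, s v := by
    rw [Finset.card_eq_sum_card_fiberwise (f := Prod.fst) (t := Finset.univ) (by simp)]
    refine Finset.sum_congr rfl fun v _ => ?_
    refine Finset.card_nbij' Prod.snd (fun w => (v, w)) ?_ ?_ ?_ ?_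
    · rintro ⟨a, b⟩ h
      simp only [Finset.coe_filter, Set.mem_ofPred_eq] at h
      simp [← h.2, h.1]
    · intro w h
      simpa using h
    · rintro ⟨a, b⟩ h
      simp only [Finset.coe_filter, Set.mem_ofPred_eq] at h
      simp [← h.2]
    · intro w _; rfl
  have hc : ∀ v, (Finset.univ.filter fun w => w ≠ v ∧ (v, w) ∉ S).card + (s v + 1) = n := by
    intro v
    have : (Finset.univ.filter fun w => w ≠ v ∧ (v, w) ∉ S) =
        (insert v (Finset.univ.filter fun w => (v, w) ∈ S))ᶜ := by
      ext w
      simp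
    rw [this, Finset.card_compl, Finset.card_insert_of_notMem
      (by simpa using fun h => hS _ h rfl)]
    have h1 : (insert v (Finset.univ.filter fun w => (v, w) ∈ S)).card ≤ n := Finset.card_le_univ _
    rw [Finset.card_insert_of_notMem (by simpa using fun h => hS _ h rfl)] at h1
    have h2 : (Finset.univ.filter fun w => (v, w) ∈ S).card = s v := rfl
    omega
  have h1 : (Nat.card {T : SimpleGraph V // T.IsTree ∧ ∀ x ∈ S, ¬ T.Adj x.1 x.2} : ℝ) ≤
      ∏ v ∈ Finset.univ.erase r, ((n : ℝ) * Real.exp (-((s v + 1 : ℝ) / n))) := by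
    refine (Nat.cast_le.2 (card_isTree_avoiding_le S r)).trans ?_
    rw [Nat.cast_prod]
    refine Finset.prod_le_prod (fun _ _ => Nat.cast_nonneg _) fun v _ => ?_
    have h2 : ((Finset.univ.filter fun w => w ≠ v ∧ (v, w) ∉ S).card : ℝ) =
        n * (-((s v + 1 : ℝ) / n) + 1) := by
      rw [mul_add, mul_neg, mul_div_cancel₀ _ hnR.ne']
      have := hc v
      have : ((Finset.univ.filter fun w => w ≠ v ∧ (v, w) ∉ S).card : ℝ) + (s v + 1) = n := by
        exact_mod_cast this
      linarith
    rw [h2]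
    exact mul_le_mul_of_nonneg_left (Real.add_one_le_exp _) hnR.le
  have h3 : ∏ v ∈ Finset.univ.erase r, ((n : ℝ) * Real.exp (-((s v + 1 : ℝ) / n))) ≤
      (n : ℝ) ^ (n - 1) * Real.exp (-(S.card / n : ℝ)) := by
    rw [Finset.prod_mul_distrib, Finset.prod_const, Finset.card_erase_of_mem (Finset.mem_univ r),
      Finset.card_univ, ← Real.exp_sum]
    refine mul_le_mul_of_nonneg_left (Real.exp_le_exp.2 ?_) (by positivity)
    rw [Finset.sum_neg_distrib, neg_le_neg_iff, ← Finset.sum_div]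
    refine div_le_div_of_nonneg_right ?_ hnR.le
    rw [Finset.sum_add_distrib, Finset.sum_const, Finset.card_erase_of_mem (Finset.mem_univ r),
      Finset.card_univ, hsum]
    have h4 := Finset.add_sum_erase Finset.univ s (Finset.mem_univ r)
    have h5 := hc r
    rw [← h4]
    push_cast
    -- The product has no factor for `r`. The summands `1` in the other `n - 1` exponents make up
    -- for the missing `s r`.
    have h6 : (s r : ℝ) ≤ ((n - 1 : ℕ) : ℝ) := by
      exact_mod_cast (by omega : s r ≤ n - 1)
    simp only [nsmul_eq_mul, mul_one]
    linarith
  have h7 : (n : ℝ) ^ (n - 1) ≤ n * Nat.card {T : SimpleGraph V // T.IsTree} := by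
    have : Nonempty V := ⟨r⟩
    exact_mod_cast pow_card_le_card_mul_card_isTree (V := V)
  calc _ ≤ _ := h1.trans h3
    _ ≤ (n * Nat.card {T : SimpleGraph V // T.IsTree}) * Real.exp (-(S.card / n : ℝ)) :=
        mul_le_mul_of_nonneg_right h7 (Real.exp_nonneg _)
    _ = _ := by ring

end RootedForests

/-! ### Probabilities that a random spanning tree hits a set of pairs. -/

section TreeProbability

variable {n : ℕ}

instance : Finite (SpanningTree n) := Subtype.finite

theorem nonempty_spanningTree (hn : 0 < n) : Nonempty (SpanningTree n) := by
  have : Nonempty (Fin n) := ⟨⟨0, hn⟩⟩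
  obtain ⟨T, -, hT⟩ := (SimpleGraph.connected_top (V := Fin n)).exists_isTree_le
  exact ⟨⟨T, hT⟩⟩

/-- The probability that a uniformly random spanning tree satisfies `p`. -/
noncomputable def treeProb (p : SpanningTree n → Prop) : ℝ :=
  (Nat.card {T // p T} : ℝ) / Nat.card (SpanningTree n)

/-- The tree `T` has an edge among the pairs in `S`. -/
def Hits (T : SpanningTree n) (S : Finset (Fin n × Fin n)) : Prop :=
  ∃ x ∈ S, T.1.Adj x.1 x.2

theorem treeProb_nonneg (p : SpanningTree n → Prop) : 0 ≤ treeProb p := by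
  unfold treeProb; positivity

theorem treeProb_mono {p p' : SpanningTree n → Prop} (h : ∀ T, p T → p' T) :
    treeProb p ≤ treeProb p' := by
  unfold treeProb
  refine div_le_div_of_nonneg_right (Nat.cast_le.2 ?_) (Nat.cast_nonneg _)
  exact Nat.card_le_card_of_injective (fun T : {T // p T} => (⟨T.1, h _ T.2⟩ : {T // p' T}))
    fun a b hab => Subtype.ext (by simpa using hab)

theorem treeProb_or_le (p p' : SpanningTree n → Prop) :
    treeProb (fun T => p T ∨ p' T) ≤ treeProb p + treeProb p' := by
  unfold treeProb
  rw [← add_div]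
  refine div_le_div_of_nonneg_right ?_ (Nat.cast_nonneg _)
  rw [← Nat.cast_add]
  refine Nat.cast_le.2 ?_
  have h : ∀ p : SpanningTree n → Prop, Nat.card {T // p T} = Set.ncard {T | p T} :=
    fun p => rfl
  rw [h, h, h]
  exact Set.ncard_union_le {T | p T} {T | p' T}

theorem treeProb_not (hn : 0 < n) (p : SpanningTree n → Prop) :
    treeProb (fun T => ¬ p T) = 1 - treeProb p := by
  have := nonempty_spanningTree hn
  unfold treeProb
  rw [eq_sub_iff_add_eq, ← add_div, div_eq_one_iff_eq (by exact_mod_cast Nat.card_pos.ne')]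
  have h : ∀ p : SpanningTree n → Prop, Nat.card {T // p T} = Set.ncard {T | p T} :=
    fun p => rfl
  rw [h, h, ← Nat.cast_add, add_comm]
  exact congrArg Nat.cast (Set.ncard_add_ncard_compl {T | p T})

theorem treeProb_not_hits_le (hn : 0 < n) (S : Finset (Fin n × Fin n))
    (hS : ∀ x ∈ S, x.1 ≠ x.2) :
    treeProb (fun T => ¬ Hits T S) ≤ n * Real.exp (-(S.card / n : ℝ)) := by
  have := nonempty_spanningTree hn
  have : Nonempty (Fin n) := ⟨⟨0, hn⟩⟩
  have h := card_isTree_avoiding_le_exp S hS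
  unfold treeProb
  rw [div_le_iff₀ (by exact_mod_cast Nat.card_pos)]
  rw [Fintype.card_fin, mul_comm] at h
  refine le_trans (Nat.cast_le.2 ?_) h
  refine Nat.card_le_card_of_injective (fun T : {T : SpanningTree n // ¬ Hits T S} =>
    (⟨T.1.1, T.1.2, fun x hx hadj => T.2 ⟨x, hx, hadj⟩⟩ :
      {T : SimpleGraph (Fin n) // T.IsTree ∧ ∀ x ∈ S, ¬ T.Adj x.1 x.2})) fun a b hab =>
        Subtype.ext (Subtype.ext (by simpa using hab))

/-- Relabelling spanning trees by a permutation of the vertices. -/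
def relabelTree (π : Equiv.Perm (Fin n)) : SpanningTree n ≃ SpanningTree n where
  toFun T := ⟨T.1.comap π, (SimpleGraph.Iso.comap π T.1).isTree_iff.2 T.2⟩
  invFun T := ⟨T.1.comap π.symm, (SimpleGraph.Iso.comap π.symm T.1).isTree_iff.2 T.2⟩
  left_inv T := by
    apply Subtype.ext
    ext a b
    simp
  right_inv T := by
    apply Subtype.ext
    ext a b
    simp

theorem relabelTree_adj (π : Equiv.Perm (Fin n)) (T : SpanningTree n) (a b : Fin n) :
    (relabelTree π T).1.Adj a b ↔ T.1.Adj (π a) (π b) := Iff.rfl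

theorem treeProb_relabel (π : Equiv.Perm (Fin n)) (p : SpanningTree n → Prop) :
    treeProb (fun T => p (relabelTree π T)) = treeProb p := by
  unfold treeProb
  rw [Nat.card_congr ((relabelTree π).subtypeEquiv fun _ => Iff.rfl)]

theorem exists_perm_pair {a b c d : Fin n} (hab : a ≠ b) (hcd : c ≠ d) :
    ∃ π : Equiv.Perm (Fin n), π a = c ∧ π b = d := by
  refine ⟨Equiv.swap (Equiv.swap a c b) d * Equiv.swap a c, ?_, ?_⟩
  · rw [Equiv.Perm.mul_apply, Equiv.swap_apply_left]
    apply Equiv.swap_apply_of_ne_of_ne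
    · intro h
      have : Equiv.swap a c a = Equiv.swap a c b := by rw [Equiv.swap_apply_left]; exact h
      exact hab ((Equiv.swap a c).injective this)
    · exact hcd
  · rw [Equiv.Perm.mul_apply, Equiv.swap_apply_left]

theorem card_offDiag_fin : (Finset.univ : Finset (Fin n)).offDiag.card = n * (n - 1) := by
  rw [Finset.offDiag_card, Finset.card_univ, Fintype.card_fin, Nat.mul_sub_one]

/-- By symmetry all `n * (n - 1)` ordered pairs are equally likely to be adjacent, and every tree
has `2 * (n - 1)` ordered adjacent pairs. -/
theorem treeProb_adj (hn : 2 ≤ n) {a b : Fin n} (hab : a ≠ b) :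
    treeProb (fun T => T.1.Adj a b) = 2 / n := by
  classical
  have := nonempty_spanningTree (n := n) (by omega)
  have := Fintype.ofFinite (SpanningTree n)
  have hsym : ∀ x ∈ (Finset.univ : Finset (Fin n)).offDiag,
      (Finset.univ.filter fun T : SpanningTree n => T.1.Adj x.1 x.2).card =
        (Finset.univ.filter fun T : SpanningTree n => T.1.Adj a b).card := by
    rintro ⟨c, d⟩ hcd
    obtain ⟨π, h1, h2⟩ := exists_perm_pair hab (Finset.mem_offDiag.1 hcd).2.2
    refine Finset.card_equiv (relabelTree π) fun T => ?_
    simp [relabelTree_adj, h1, h2]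
  have hdc : ∑ x ∈ (Finset.univ : Finset (Fin n)).offDiag,
      (Finset.univ.filter fun T : SpanningTree n => T.1.Adj x.1 x.2).card =
      ∑ T : SpanningTree n,
        ((Finset.univ : Finset (Fin n)).offDiag.filter fun x => T.1.Adj x.1 x.2).card := by
    simp only [Finset.card_filter]
    exact Finset.sum_comm
  rw [Finset.sum_congr rfl hsym, Finset.sum_const, card_offDiag_fin, smul_eq_mul] at hdc
  have hT : ∀ T : SpanningTree n,
      ((Finset.univ : Finset (Fin n)).offDiag.filter fun x => T.1.Adj x.1 x.2).card =
        2 * (n - 1) := by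
    intro T
    have h1 : ((Finset.univ : Finset (Fin n)).offDiag.filter fun x => T.1.Adj x.1 x.2).card =
        ∑ v, T.1.degree v := by
      rw [Finset.card_eq_sum_card_fiberwise (f := Prod.fst) (t := Finset.univ) (by simp)]
      refine Finset.sum_congr rfl fun v _ => ?_
      rw [← SimpleGraph.card_neighborFinset_eq_degree]
      refine Finset.card_nbij' Prod.snd (fun w => (v, w)) ?_ ?_ ?_ ?_
      · rintro ⟨x, y⟩ h
        simp only [Finset.coe_filter, Set.mem_ofPred_eq, Finset.mem_filter] at h
        simp [← h.2, h.1.2]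
      · intro w h
        have h : T.1.Adj v w := by simpa using h
        simp [h, h.ne]
      · rintro ⟨x, y⟩ h
        simp only [Finset.coe_filter, Set.mem_ofPred_eq] at h
        simp [← h.2]
      · intro w _; rfl
    rw [h1, SimpleGraph.sum_degrees_eq_twice_card_edges]
    have := T.2.card_edgeFinset
    rw [Fintype.card_fin] at this
    omega
  rw [Finset.sum_congr rfl fun T _ => hT T, Finset.sum_const, Finset.card_univ, smul_eq_mul] at hdc
  unfold treeProb
  rw [Nat.card_eq_fintype_card, Nat.card_eq_fintype_card, Fintype.card_subtype]
  have hpos : (0 : ℝ) < Fintype.card (SpanningTree n) := by exact_mod_cast Fintype.card_pos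
  have hnpos : (0 : ℝ) < n := by exact_mod_cast (by omega : 0 < n)
  rw [div_eq_div_iff hpos.ne' hnpos.ne']
  have h3 : n * (Finset.univ.filter fun T : SpanningTree n => T.1.Adj a b).card =
      2 * Fintype.card (SpanningTree n) := by
    have h4 : 0 < n - 1 := by omega
    refine Nat.eq_of_mul_eq_mul_right h4 ?_
    linarith [hdc]
  rw [mul_comm]
  exact_mod_cast h3

/-- A tree avoids all pairs from `v` to outside `W` only if it has an edge from `v` to `W`. -/
theorem treeProb_not_hits_star_le (hn : 2 ≤ n) (S : Finset (Fin n × Fin n)) (v : Fin n)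
    (W : Finset (Fin n)) (hS : ∀ w, w ≠ v → w ∉ W → (v, w) ∈ S) :
    treeProb (fun T => ¬ Hits T S) ≤ 2 * W.card / n := by
  have h1 : treeProb (fun T => ¬ Hits T S) ≤
      treeProb (fun T : SpanningTree n => ∃ w ∈ W.erase v, T.1.Adj v w) := by
    refine treeProb_mono fun T hT => ?_
    have hnt : Nontrivial (Fin n) := Fin.nontrivial_iff_two_le.2 hn
    obtain ⟨w, hw⟩ := T.2.connected.preconnected.exists_adj_of_nontrivial v
    refine ⟨w, ?_, hw⟩
    rw [Finset.mem_erase]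
    refine ⟨hw.ne', ?_⟩
    by_contra hwW
    exact hT ⟨(v, w), hS w hw.ne' hwW, hw⟩
  refine h1.trans ?_
  have h2 : ∀ W : Finset (Fin n), v ∉ W →
      treeProb (fun T : SpanningTree n => ∃ w ∈ W, T.1.Adj v w) ≤ 2 * W.card / n := by
    intro W
    induction W using Finset.induction_on with
    | empty => intro _; simp [treeProb]
    | insert w W hw ih =>
      intro hv
      rw [Finset.mem_insert, not_or] at hv
      have h3 : treeProb (fun T : SpanningTree n => ∃ x ∈ insert w W, T.1.Adj v x) ≤
          treeProb (fun T : SpanningTree n => T.1.Adj v w ∨ ∃ x ∈ W, T.1.Adj v x) :=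
        treeProb_mono fun T => by simp
      refine h3.trans ((treeProb_or_le _ _).trans ?_)
      rw [treeProb_adj hn hv.1, Finset.card_insert_of_notMem hw]
      have := ih hv.2
      push_cast
      rw [mul_add, add_div, add_comm]
      linarith
  refine (h2 _ (Finset.notMem_erase v W)).trans ?_
  have : (W.erase v).card ≤ W.card := Finset.card_le_card (Finset.erase_subset _ _)
  gcongr

/-- Averaging over all permutations: a random relabelling sends each pair of `S` to a uniformly
random pair of distinct vertices. -/
theorem exists_perm_card_inter_le (S W : Finset (Fin n × Fin n))
    (hS : ∀ x ∈ S, x.1 ≠ x.2) (hW : ∀ x ∈ W, x.1 ≠ x.2) :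
    ∃ π : Equiv.Perm (Fin n),
      (S.filter fun x => (π x.1, π x.2) ∈ W).card * (n * (n - 1)) ≤ S.card * W.card := by
  classical
  by_contra! hcon
  let c : Fin n × Fin n → Fin n × Fin n → ℕ := fun x y =>
    (Finset.univ.filter fun π : Equiv.Perm (Fin n) => (π x.1, π x.2) = y).card
  have hc : ∀ x y y', x.1 ≠ x.2 → y.1 ≠ y.2 → y'.1 ≠ y'.2 → c x y = c x y' := by
    rintro ⟨a, b⟩ ⟨u, v⟩ ⟨u', v'⟩ hx hy hy'
    obtain ⟨ρ, h1, h2⟩ := exists_perm_pair hy hy'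
    refine Finset.card_equiv (Equiv.mulLeft ρ) fun π => ?_
    simp only [Finset.mem_filter, Finset.mem_univ, true_and, Prod.mk.injEq, Equiv.coe_mulLeft,
      Equiv.Perm.mul_apply]
    simp only at h1 h2
    rw [← h1, ← h2, ρ.injective.eq_iff, ρ.injective.eq_iff]
  have hsum : ∀ x : Fin n × Fin n, x.1 ≠ x.2 → ∀ y, y.1 ≠ y.2 →
      n * (n - 1) * c x y = Fintype.card (Equiv.Perm (Fin n)) := by
    intro x hx y hy
    have h1 : (Finset.univ : Finset (Equiv.Perm (Fin n))).card =
        ∑ y ∈ (Finset.univ : Finset (Fin n)).offDiag, c x y := by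
      refine Finset.card_eq_sum_card_fiberwise fun π _ => ?_
      simp [hx]
    rw [Finset.sum_congr rfl fun y' hy' => hc x y' y hx (Finset.mem_offDiag.1 hy').2.2 hy,
      Finset.sum_const, card_offDiag_fin, smul_eq_mul] at h1
    exact h1.symm
  have htot : ∑ π : Equiv.Perm (Fin n),
      (S.filter fun x => (π x.1, π x.2) ∈ W).card * (n * (n - 1)) =
      Fintype.card (Equiv.Perm (Fin n)) * (S.card * W.card) := by
    rw [← Finset.sum_mul]
    have h1 : ∑ π : Equiv.Perm (Fin n), (S.filter fun x => (π x.1, π x.2) ∈ W).card =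
        ∑ x ∈ S, ∑ y ∈ W, c x y := by
      simp only [Finset.card_filter]
      rw [Finset.sum_comm]
      refine Finset.sum_congr rfl fun x _ => ?_
      simp only [c, Finset.card_filter]
      rw [Finset.sum_comm]
      refine Finset.sum_congr rfl fun π _ => ?_
      simp
    rw [h1, Finset.sum_mul]
    rw [Finset.sum_congr rfl fun x hx => (by
      rw [Finset.sum_mul, Finset.sum_congr rfl fun y hy => (by
        rw [mul_comm, hsum x (hS x hx) y (hW y hy)] :
          c x y * (n * (n - 1)) = Fintype.card (Equiv.Perm (Fin n))), Finset.sum_const,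
        smul_eq_mul] : (∑ y ∈ W, c x y) * (n * (n - 1)) =
          W.card * Fintype.card (Equiv.Perm (Fin n)))]
    rw [Finset.sum_const, smul_eq_mul]
    ring
  have hlt : ∑ _π : Equiv.Perm (Fin n), S.card * W.card <
      ∑ π : Equiv.Perm (Fin n), (S.filter fun x => (π x.1, π x.2) ∈ W).card * (n * (n - 1)) :=
    Finset.sum_lt_sum_of_nonempty Finset.univ_nonempty fun π _ => hcon π
  rw [htot, Finset.sum_const, Finset.card_univ, smul_eq_mul] at hlt
  exact lt_irrefl _ hlt

/-- Unions of `t` relabelled copies of `S` grow linearly, up to half of all pairs. -/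
theorem exists_union_of_copies (hn : 2 ≤ n) (S : Finset (Fin n × Fin n))
    (hS : ∀ x ∈ S, x.1 ≠ x.2) (t : ℕ) :
    ∃ W : Finset (Fin n × Fin n), (∀ x ∈ W, x.1 ≠ x.2) ∧
      (t * S.card ≤ 2 * W.card ∨ n * (n - 1) ≤ 2 * W.card) ∧
      treeProb (fun T => Hits T W) ≤ t * treeProb (fun T => Hits T S) := by
  classical
  induction t with
  | zero => exact ⟨∅, by simp, by simp, by simp [Hits, treeProb]⟩
  | succ t ih =>
    obtain ⟨W, hW, hcard, hprob⟩ := ih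
    by_cases hbig : n * (n - 1) ≤ 2 * W.card
    · refine ⟨W, hW, Or.inr hbig, hprob.trans ?_⟩
      have := treeProb_nonneg fun T => Hits T S
      push_cast
      nlinarith
    have hcard := hcard.resolve_right hbig
    obtain ⟨π, hπ⟩ := exists_perm_card_inter_le S W hS hW
    let m : Fin n × Fin n ↪ Fin n × Fin n := (π.prodCongr π).toEmbedding
    refine ⟨W ∪ S.map m, ?_, Or.inl ?_, ?_⟩
    · intro x hx
      rcases Finset.mem_union.1 hx with hx | hx
      · exact hW x hx
      · obtain ⟨y, hy, rfl⟩ := Finset.mem_map.1 hx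
        exact fun h => hS y hy (π.injective h)
    · have h1 : (W ∩ S.map m).card = (S.filter fun x => (π x.1, π x.2) ∈ W).card := by
        rw [← Finset.card_map m (s := S.filter fun x => (π x.1, π x.2) ∈ W)]
        congr 1
        ext y
        simp only [Finset.mem_inter, Finset.mem_map, Finset.mem_filter]
        constructor
        · rintro ⟨h1, x, hx, rfl⟩
          exact ⟨x, ⟨hx, h1⟩, rfl⟩
        · rintro ⟨x, ⟨hx, h1⟩, rfl⟩
          exact ⟨h1, x, hx, rfl⟩
      have h2 := Finset.card_union_add_card_inter W (S.map m)
      rw [Finset.card_map, h1] at h2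
      set i := (S.filter fun x => (π x.1, π x.2) ∈ W).card
      -- As long as `W` contains less than half of all ordered pairs, at least half of a well chosen
      -- copy of `S` is new.
      have h3 : 2 * i ≤ S.card := by
        have hN : 0 < n * (n - 1) := Nat.mul_pos (by omega) (by omega)
        refine Nat.le_of_mul_le_mul_right ?_ hN
        calc 2 * i * (n * (n - 1)) = 2 * (i * (n * (n - 1))) := by ring
          _ ≤ 2 * (S.card * W.card) := by omega
          _ = S.card * (2 * W.card) := by ring
          _ ≤ S.card * (n * (n - 1)) := Nat.mul_le_mul_left _ (by omega)
      rw [Nat.succ_mul]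
      omega
    · have h1 : treeProb (fun T => Hits T (W ∪ S.map m)) ≤
          treeProb (fun T => Hits T W ∨ Hits T (S.map m)) := by
        refine treeProb_mono fun T => ?_
        rintro ⟨x, hx, hadj⟩
        rcases Finset.mem_union.1 hx with hx | hx
        · exact Or.inl ⟨x, hx, hadj⟩
        · exact Or.inr ⟨x, hx, hadj⟩
      have h2 : treeProb (fun T => Hits T (S.map m)) = treeProb (fun T => Hits T S) := by
        rw [← treeProb_relabel π (fun T => Hits T S)]
        congr 1
        ext T
        simp only [Hits, Finset.mem_map]
        constructor
        · rintro ⟨_, ⟨x, hx, rfl⟩, hadj⟩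
          exact ⟨x, hx, hadj⟩
        · rintro ⟨x, hx, hadj⟩
          exact ⟨_, ⟨x, hx, rfl⟩, hadj⟩
      refine h1.trans ((treeProb_or_le _ _).trans ?_)
      rw [h2]
      push_cast
      linarith

/-- A lower bound, linear in the number of pairs, for the probability to hit a small set. -/
theorem le_treeProb_hits (hn : 2 ≤ n) (S : Finset (Fin n × Fin n))
    (hS : ∀ x ∈ S, x.1 ≠ x.2) (hS0 : 0 < S.card) {L : ℕ} (hSL : S.card ≤ L)
    (hL : 2 * L ≤ n * (n - 1)) (hexp : n * Real.exp (-(L / n : ℝ)) ≤ 1 / 2) :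
    (S.card : ℝ) / (6 * L) ≤ treeProb (fun T => Hits T S) := by
  -- With this many copies the union has at least `L` pairs and is hit with probability at least `1
  -- / 2`. The union bound then gives `1 / (2 * t)` for a single copy, and `t * S.card ≤ 3 * L`.
  set t := 2 * L / S.card + 1 with ht
  obtain ⟨W, hW, hcard, hprob⟩ := exists_union_of_copies hn S hS t
  have h1 : L ≤ W.card := by
    rcases hcard with h | h
    · have : 2 * L < t * S.card := by
        rw [ht, mul_comm (_ + 1)]
        exact Nat.lt_mul_div_succ _ hS0
      omega
    · omega
  have h2 := treeProb_not_hits_le (by omega) W hW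
  rw [treeProb_not (by omega)] at h2
  have h3 : (n : ℝ) * Real.exp (-(W.card / n : ℝ)) ≤ n * Real.exp (-(L / n : ℝ)) := by
    have : (L : ℝ) ≤ W.card := by exact_mod_cast h1
    gcongr
  have h4 : (t : ℝ) * S.card ≤ 3 * L := by
    have : t * S.card ≤ 3 * L := by
      rw [ht, Nat.succ_mul]
      have := Nat.div_mul_le_self (2 * L) S.card
      omega
    exact_mod_cast this
  have h5 : (0 : ℝ) < S.card := by exact_mod_cast hS0
  have h6 : (0 : ℝ) < L := by exact_mod_cast hS0.trans_le hSL
  rw [div_le_iff₀ (by positivity)]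
  have h7 : 1 / 2 ≤ t * treeProb (fun T => Hits T S) := by linarith
  have h8 := treeProb_nonneg fun T => Hits T S
  nlinarith

end TreeProbability

/-! ### Strategies, the stopped process, and the potential method. -/

section Rounds

variable {n : ℕ}

/-- The graph obtained by adding the edge between the two vertices of a pair. -/
def addPair {V : Type*} (F : SimpleGraph V) (x : V × V) : SimpleGraph V :=
  F ⊔ SimpleGraph.fromEdgeSet {s(x.1, x.2)}

theorem addPair_adj {V : Type*} {F : SimpleGraph V} {x : V × V} (hx : x.1 ≠ x.2) {a b : V} :
    (addPair F x).Adj a b ↔ F.Adj a b ∨ (a = x.1 ∧ b = x.2) ∨ (a = x.2 ∧ b = x.1) := by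
  rw [addPair, SimpleGraph.sup_adj, SimpleGraph.fromEdgeSet_adj, Set.mem_singleton_iff,
    Sym2.eq_iff]
  refine or_congr_right ⟨fun h => h.1, fun h => ⟨h, ?_⟩⟩
  rintro rfl
  rcases h with h | h
  · exact hx (h.1.symm.trans h.2)
  · exact hx (h.2.symm.trans h.1)

theorem ncard_edgeSet_addPair {V : Type*} [Finite V] {F : SimpleGraph V} {x : V × V}
    (hx : x.1 ≠ x.2) (hF : ¬ F.Adj x.1 x.2) :
    (addPair F x).edgeSet.ncard = F.edgeSet.ncard + 1 := by
  have : (addPair F x).edgeSet = insert s(x.1, x.2) F.edgeSet := by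
    rw [addPair, SimpleGraph.edgeSet_sup, SimpleGraph.edgeSet_fromEdgeSet]
    ext e
    simp only [Set.mem_union, Set.mem_sdiff, Set.mem_singleton_iff, Set.mem_insert_iff]
    constructor
    · rintro (h | h)
      · exact Or.inr h
      · exact Or.inl h.1
    · rintro (rfl | h)
      · exact Or.inr ⟨rfl, by simpa using hx⟩
      · exact Or.inl h
  rw [this, Set.ncard_insert_of_notMem (by simpa using hF) (Set.toFinite _)]

/-- The graph after one more round. -/
def nextGraph (σ : Strategy n) (F : SimpleGraph (Fin n)) (T : SpanningTree n) :
    SimpleGraph (Fin n) :=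
  F ⊔ SimpleGraph.fromEdgeSet {σ.pick F T}

theorem exists_edge (hn : 2 ≤ n) (T : SpanningTree n) : ∃ e, e ∈ T.1.edgeSet := by
  have hnt : Nontrivial (Fin n) := Fin.nontrivial_iff_two_le.2 hn
  obtain ⟨w, hw⟩ := T.2.connected.preconnected.exists_adj_of_nontrivial ⟨0, by omega⟩
  exact ⟨s(_, w), hw⟩

/-- A strategy that picks an edge among the preferred pairs if there is one, and otherwise repeats
an edge if it can. -/
theorem exists_strategy (hn : 2 ≤ n)
    (S : SimpleGraph (Fin n) → Finset (Fin n × Fin n)) :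
    ∃ σ : Strategy n, ∀ F T,
      (Hits T (S F) → ∃ x ∈ S F, nextGraph σ F T = addPair F x) ∧
      (¬ Hits T (S F) → ¬ Disjoint T.1.edgeSet F.edgeSet → nextGraph σ F T = F) := by
  classical
  have h : ∀ F (T : SpanningTree n), ∃ e ∈ T.1.edgeSet,
      (Hits T (S F) → ∃ x ∈ S F, e = s(x.1, x.2)) ∧
      (¬ Hits T (S F) → ¬ Disjoint T.1.edgeSet F.edgeSet → e ∈ F.edgeSet) := by
    intro F T
    by_cases h1 : Hits T (S F)
    · obtain ⟨x, hx, hadj⟩ := h1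
      exact ⟨s(x.1, x.2), hadj, fun _ => ⟨x, hx, rfl⟩, fun h => absurd ⟨x, hx, hadj⟩ h⟩
    · by_cases h2 : Disjoint T.1.edgeSet F.edgeSet
      · obtain ⟨e, he⟩ := exists_edge hn T
        exact ⟨e, he, fun h => absurd h h1, fun _ h => absurd h2 h⟩
      · obtain ⟨e, he, heF⟩ := Set.not_disjoint_iff.1 h2
        exact ⟨e, he, fun h => absurd h h1, fun _ _ => heF⟩
  choose pick hpick h1 h2 using h
  refine ⟨⟨pick, hpick⟩, fun F T => ⟨fun hT => ?_, fun hT hd => ?_⟩⟩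
  · obtain ⟨x, hx, he⟩ := h1 F T hT
    exact ⟨x, hx, by simp only [nextGraph, addPair, he]⟩
  · have he := h2 F T hT hd
    rw [nextGraph, sup_eq_left, ← SimpleGraph.edgeSet_subset_edgeSet,
      SimpleGraph.edgeSet_fromEdgeSet]
    rintro e ⟨rfl, -⟩
    exact he

open Classical in
/-- The process stopped when it reaches `P` or leaves `Valid`. -/
noncomputable def stopped (σ : Strategy n) (Valid P : Set (SimpleGraph (Fin n)))
    (T : ℕ → SpanningTree n) : ℕ → SimpleGraph (Fin n)
  | 0 => ⊥
  | i + 1 => if stopped σ Valid P T i ∈ Valid \ P then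
      nextGraph σ (stopped σ Valid P T i) (T i) else stopped σ Valid P T i

open Classical in
/-- The probability that the process started from a given graph does not reach `P ∩ Valid`
within `t` rounds before leaving `Valid`. -/
noncomputable def failProb (σ : Strategy n) (Valid P : Set (SimpleGraph (Fin n))) :
    ℕ → SimpleGraph (Fin n) → ℝ
  | 0, F => if F ∈ Valid ∩ P then 0 else 1
  | t + 1, F => if F ∈ Valid \ P then
      (∑ᶠ T : SpanningTree n, failProb σ Valid P t (nextGraph σ F T)) / Nat.card (SpanningTree n)
      else if F ∈ Valid ∩ P then 0 else 1

variable {σ : Strategy n} {Valid P : Set (SimpleGraph (Fin n))}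

theorem stopped_spec (T : ℕ → SpanningTree n) (t : ℕ) :
    (stopped σ Valid P T t = graphAfter σ T t ∧ ∀ s < t, graphAfter σ T s ∈ Valid \ P) ∨
      ∃ s < t, stopped σ Valid P T t = graphAfter σ T s ∧ graphAfter σ T s ∉ Valid \ P ∧
        ∀ s' < s, graphAfter σ T s' ∈ Valid \ P := by
  induction t with
  | zero => exact Or.inl ⟨rfl, by simp⟩
  | succ t ih =>
    rcases ih with ⟨h1, h2⟩ | ⟨s, hs, h1, h2, h3⟩
    · by_cases h : graphAfter σ T t ∈ Valid \ P
      · refine Or.inl ⟨by rw [stopped, h1, if_pos h]; rfl, fun s hs => ?_⟩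
        rcases Nat.lt_succ_iff_lt_or_eq.1 hs with h' | rfl
        · exact h2 s h'
        · exact h
      · exact Or.inr ⟨t, Nat.lt_succ_self t, by rw [stopped, h1, if_neg h], h, h2⟩
    · exact Or.inr ⟨s, by omega, by rw [stopped, h1, if_neg h2], h2, h3⟩

/-- Until it freezes the process stays in `Valid \ P`, so a frozen graph in `P` is the first one in
`P`. -/
theorem hittingTime_of_stopped {T : ℕ → SpanningTree n} {N : ℕ}
    (h : stopped σ Valid P T N ∈ Valid ∩ P) :
    ∃ t ≤ N, hittingTime σ P T = (t : ℕ∞) ∧ graphAfter σ T t ∈ Valid ∩ P := by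
  have key : ∀ t, graphAfter σ T t ∈ P → (∀ s < t, graphAfter σ T s ∈ Valid \ P) →
      hittingTime σ P T = (t : ℕ∞) := by
    intro t ht hs
    refine le_antisymm (iInf₂_le t ht) (le_iInf₂ fun i hi => ?_)
    by_contra hlt
    exact (hs i (by exact_mod_cast not_le.1 hlt)).2 hi
  rcases stopped_spec (σ := σ) (Valid := Valid) (P := P) T N with ⟨h1, h2⟩ | ⟨s, hs, h1, h2, h3⟩
  · rw [h1] at h
    exact ⟨N, le_rfl, key N h.2 h2, h⟩
  · rw [h1] at h
    exact ⟨s, hs.le, key s h.2 h3, h⟩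

theorem stopped_congr {T T' : ℕ → SpanningTree n} {t : ℕ} (h : ∀ i < t, T i = T' i) :
    stopped σ Valid P T t = stopped σ Valid P T' t := by
  induction t with
  | zero => rfl
  | succ t ih =>
    rw [stopped, stopped, ih fun i hi => h i (by omega), h t (by omega)]

theorem isProbabilityMeasure_uniformTree (hn : 0 < n) :
    IsProbabilityMeasure
      (ProbabilityTheory.uniformOn (Set.univ : Set (SpanningTree n))) := by
  have := nonempty_spanningTree hn
  have : MeasurableSingletonClass (SpanningTree n) := ⟨fun _ => trivial⟩
  exact ProbabilityTheory.isProbabilityMeasure_uniformOn Set.finite_univ Set.univ_nonempty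

theorem isProbabilityMeasure_treesLaw (hn : 0 < n) : IsProbabilityMeasure (treesLaw n) := by
  have := isProbabilityMeasure_uniformTree hn
  unfold treesLaw
  infer_instance

theorem failProb_nonneg (t : ℕ) (F : SimpleGraph (Fin n)) : 0 ≤ failProb σ Valid P t F := by
  induction t generalizing F with
  | zero => unfold failProb; split_ifs <;> norm_num
  | succ t ih =>
    unfold failProb
    split_ifs
    · exact div_nonneg (finsum_nonneg fun T => ih _) (Nat.cast_nonneg _)
    · exact le_rfl
    · exact zero_le_one

open Classical in
theorem measurable_stopped (t : ℕ) :
    Measurable[_, ⊤] fun T => stopped σ Valid P T t := by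
  let _ : MeasurableSpace (SimpleGraph (Fin n)) := ⊤
  have : MeasurableSingletonClass (SpanningTree n) := ⟨fun _ => trivial⟩
  induction t with
  | zero => exact measurable_const
  | succ t ih =>
    exact (measurable_of_countable (fun x : SimpleGraph (Fin n) × SpanningTree n =>
      if x.1 ∈ Valid \ P then nextGraph σ x.1 x.2 else x.1)).comp
        (ih.prodMk (measurable_pi_apply t))

-- The Markov property: the stopped graph after `t` rounds depends only on the first `t` trees and
-- is therefore independent of `T t`.
open Classical in
theorem lintegral_stopped_succ (hn : 0 < n) (f : SimpleGraph (Fin n) → ENNReal) (t : ℕ) :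
    ∫⁻ T, f (stopped σ Valid P T (t + 1)) ∂(treesLaw n) =
      ∫⁻ T, (∫⁻ a, f (if stopped σ Valid P T t ∈ Valid \ P then
        nextGraph σ (stopped σ Valid P T t) a else stopped σ Valid P T t)
          ∂(ProbabilityTheory.uniformOn (Set.univ : Set (SpanningTree n)))) ∂(treesLaw n) := by
  let _ : MeasurableSpace (SimpleGraph (Fin n)) := ⊤
  have : MeasurableSingletonClass (SpanningTree n) := ⟨fun _ => trivial⟩
  have := isProbabilityMeasure_uniformTree hn
  have := isProbabilityMeasure_treesLaw hn
  set μ := ProbabilityTheory.uniformOn (Set.univ : Set (SpanningTree n)) with hμ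
  have hY := measurable_stopped (σ := σ) (Valid := Valid) (P := P)
  have hind : ProbabilityTheory.iIndepFun (fun (i : ℕ) (T : ℕ → SpanningTree n) => T i)
      (treesLaw n) := by
    have := ProbabilityTheory.iIndepFun_infinitePi (P := fun _ : ℕ => μ)
      (X := fun _ => id) (fun _ => measurable_id)
    exact this
  obtain ⟨T0⟩ := nonempty_spanningTree hn
  have hind2 : ProbabilityTheory.IndepFun (fun T => stopped σ Valid P T t)
      (fun T : ℕ → SpanningTree n => T t) (treesLaw n) := by
    have h := hind.indepFun_finset (Finset.range t) {t} (by simp) fun i => measurable_pi_apply i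
    -- `T0` is a dummy for the trees from index `t` on, which do not influence the first `t` rounds.
    have h2 := h.comp (φ := fun x : Finset.range t → SpanningTree n =>
        stopped σ Valid P (fun i => if hi : i ∈ Finset.range t then x ⟨i, hi⟩ else T0) t)
      (ψ := fun x : ({t} : Finset ℕ) → SpanningTree n => x ⟨t, Finset.mem_singleton_self t⟩)
      (measurable_of_countable _) (measurable_of_countable _)
    convert h2 using 1
    · funext T
      exact stopped_congr fun i hi => by simp [hi]
    · rfl
  have hmap : (treesLaw n).map (fun T => (stopped σ Valid P T t, T t)) =
      ((treesLaw n).map fun T => stopped σ Valid P T t).prod μ := by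
    rw [(ProbabilityTheory.indepFun_iff_map_prod_eq_prod_map_map (hY t).aemeasurable
      (measurable_pi_apply t).aemeasurable).1 hind2]
    congr 1
    exact Measure.infinitePi_map_eval (fun _ : ℕ => μ) t
  let g : SimpleGraph (Fin n) × SpanningTree n → ENNReal := fun x =>
    f (if x.1 ∈ Valid \ P then nextGraph σ x.1 x.2 else x.1)
  have hg : Measurable g := measurable_of_countable _
  calc ∫⁻ T, f (stopped σ Valid P T (t + 1)) ∂(treesLaw n)
      = ∫⁻ T, g (stopped σ Valid P T t, T t) ∂(treesLaw n) := rfl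
    _ = ∫⁻ x, g x ∂((treesLaw n).map fun T => (stopped σ Valid P T t, T t)) :=
        (lintegral_map hg ((hY t).prodMk (measurable_pi_apply t))).symm
    _ = ∫⁻ F, ∫⁻ a, g (F, a) ∂μ ∂((treesLaw n).map fun T => stopped σ Valid P T t) := by
        rw [hmap, lintegral_prod _ hg.aemeasurable]
    _ = _ := lintegral_map (measurable_of_countable _) (hY t)

theorem lintegral_uniformTree (hn : 0 < n) (f : SpanningTree n → ℝ) (hf : ∀ T, 0 ≤ f T) :
    ∫⁻ a, ENNReal.ofReal (f a) ∂(ProbabilityTheory.uniformOn (Set.univ : Set (SpanningTree n))) =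
      ENNReal.ofReal ((∑ᶠ T, f T) / Nat.card (SpanningTree n)) := by
  classical
  have := Fintype.ofFinite (SpanningTree n)
  have := nonempty_spanningTree hn
  have : MeasurableSingletonClass (SpanningTree n) := ⟨fun _ => trivial⟩
  rw [lintegral_fintype, finsum_eq_sum_of_fintype, Nat.card_eq_fintype_card,
    ENNReal.ofReal_div_of_pos (by exact_mod_cast Fintype.card_pos),
    ENNReal.ofReal_sum_of_nonneg fun T _ => hf T, div_eq_mul_inv, Finset.sum_mul]
  refine Finset.sum_congr rfl fun T _ => ?_
  rw [ProbabilityTheory.uniformOn_univ]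
  simp

/-- This links the backward recursion `failProb` to the law of the process; with no rounds left,
`failProb` is the indicator of failure. -/
theorem treesLaw_stopped (hn : 0 < n) (N : ℕ) :
    treesLaw n {T | stopped σ Valid P T N ∉ Valid ∩ P} ≤
      ENNReal.ofReal (failProb σ Valid P N ⊥) := by
  classical
  have := isProbabilityMeasure_uniformTree hn
  have := isProbabilityMeasure_treesLaw hn
  -- The expected failure probability with `s` rounds left after `t` rounds depends only on `s + t`,
  -- because `failProb` averages over the next tree.
  have key : ∀ s t, ∫⁻ T, ENNReal.ofReal (failProb σ Valid P s (stopped σ Valid P T t))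
      ∂(treesLaw n) = ENNReal.ofReal (failProb σ Valid P (s + t) ⊥) := by
    intro s t
    induction t generalizing s with
    | zero => simp [stopped]
    | succ t ih =>
      rw [lintegral_stopped_succ hn (fun F => ENNReal.ofReal (failProb σ Valid P s F)),
        show s + (t + 1) = (s + 1) + t by ring, ← ih (s + 1)]
      refine lintegral_congr fun T => ?_
      by_cases h : stopped σ Valid P T t ∈ Valid \ P
      · simp only [if_pos h]
        rw [failProb, if_pos h]
        exact lintegral_uniformTree hn _ fun _ => failProb_nonneg _ _
      · simp only [if_neg h, lintegral_const, measure_univ, mul_one]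
        rw [failProb.eq_2, if_neg h]
        cases s with
        | zero => rw [failProb]
        | succ s => rw [failProb, if_neg h]
  have h0 := key 0 N
  rw [zero_add] at h0
  rw [← h0]
  refine le_trans ?_ (meas_ge_le_lintegral_div (μ := treesLaw n)
    (f := fun T => ENNReal.ofReal (failProb σ Valid P 0 (stopped σ Valid P T N)))
    ?_ one_ne_zero ENNReal.one_ne_top |>.trans_eq (div_one _))
  · refine measure_mono fun T hT => ?_
    simp only [Set.mem_ofPred_eq] at hT ⊢
    rw [failProb, if_neg hT]
    simp
  · let _ : MeasurableSpace (SimpleGraph (Fin n)) := ⊤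
    have hY := measurable_stopped (σ := σ) (Valid := Valid) (P := P)
    exact ((measurable_of_countable
      (fun F => ENNReal.ofReal (failProb σ Valid P 0 F))).comp (hY N)).aemeasurable

theorem failProb_le_one (t : ℕ) (F : SimpleGraph (Fin n)) : failProb σ Valid P t F ≤ 1 := by
  induction t generalizing F with
  | zero => unfold failProb; split_ifs <;> norm_num
  | succ t ih =>
    unfold failProb
    split_ifs
    · have := Fintype.ofFinite (SpanningTree n)
      refine div_le_one_of_le₀ ?_ (Nat.cast_nonneg _)
      rw [finsum_eq_sum_of_fintype, Nat.card_eq_fintype_card]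
      refine (Finset.sum_le_sum fun T _ => ih _).trans ?_
      simp
    · exact zero_le_one
    · exact le_rfl

/-- The average of a function that is at most `A` on `p`, at most `B` off `p`, and at most `C`
more on `p'`. -/
theorem average_le (hn : 0 < n) (f : SpanningTree n → ℝ) (p p' : SpanningTree n → Prop)
    {A B C : ℝ} (hA : ∀ T, p T → f T ≤ A) (hC : ∀ T, ¬ p T → p' T → f T ≤ B + C)
    (hB : ∀ T, ¬ p T → ¬ p' T → f T ≤ B) :
    (∑ᶠ T, f T) / Nat.card (SpanningTree n) ≤
      treeProb p * A + (1 - treeProb p) * B + treeProb (fun T => ¬ p T ∧ p' T) * C := by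
  classical
  have := Fintype.ofFinite (SpanningTree n)
  have := nonempty_spanningTree hn
  have hpos : (0 : ℝ) < Nat.card (SpanningTree n) := by exact_mod_cast Nat.card_pos
  rw [div_le_iff₀ hpos, finsum_eq_sum_of_fintype]
  have hle : ∀ T, f T ≤ B + (if p T then A - B else 0) +
      (if ¬ p T ∧ p' T then C else 0) := by
    intro T
    by_cases h1 : p T
    · simpa [h1] using hA T h1
    · by_cases h2 : p' T
      · simpa [h1, h2] using hC T h1 h2
      · simpa [h1, h2] using hB T h1 h2
  refine (Finset.sum_le_sum fun T _ => hle T).trans (le_of_eq ?_)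
  have hprob : ∀ (p : SpanningTree n → Prop) [DecidablePred p],
      treeProb p * Nat.card (SpanningTree n) = (Finset.univ.filter p).card := by
    intro p _
    rw [treeProb, div_mul_cancel₀ _ hpos.ne', Nat.card_eq_fintype_card, Fintype.card_subtype]
  rw [Finset.sum_add_distrib, Finset.sum_add_distrib, ← Finset.sum_filter, ← Finset.sum_filter,
    Finset.sum_const, Finset.sum_const, Finset.sum_const, Finset.card_univ,
    ← Nat.card_eq_fintype_card, nsmul_eq_mul, nsmul_eq_mul, nsmul_eq_mul, ← hprob, ← hprob]
  ring

/-- If the process can always be advanced with positive probability, with the failure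
probabilities and the expected waiting times controlled by two potentials, then some strategy
reaches the goal in time with high probability. -/
theorem exists_strategy_of_potential (hn : 2 ≤ n) (Valid P : Set (SimpleGraph (Fin n)))
    (Φ Ψ : SimpleGraph (Fin n) → ℝ) (N W : ℕ) (hW : 0 < W)
    (hΦ : ∀ F, 0 ≤ Φ F) (hΨ : ∀ F, 0 ≤ Ψ F) (hbot : ⊥ ∈ Valid)
    (hN : ∀ F ∈ Valid, F.edgeSet.ncard ≤ N)
    (hstep : ∀ F ∈ Valid, F ∉ P → ∃ (S : Finset (Fin n × Fin n)) (l b : ℝ), 0 < l ∧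
      l ≤ treeProb (fun T => Hits T S) ∧
      treeProb (fun T => ¬ Hits T S ∧ Disjoint T.1.edgeSet F.edgeSet) ≤ b ∧
      ∀ x ∈ S, x.1 ≠ x.2 ∧ ¬ F.Adj x.1 x.2 ∧ addPair F x ∈ Valid ∧
        Φ (addPair F x) + b / l ≤ Φ F ∧ Ψ (addPair F x) + (1 / l - 1) ≤ Ψ F) :
    ∃ σ : Strategy n, ENNReal.ofReal (1 - (Φ ⊥ + Ψ ⊥ / W)) ≤
      treesLaw n {T | ∃ t : ℕ, t + 1 ≤ N + W ∧ hittingTime σ P T = (t : ℕ∞) ∧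
        graphAfter σ T t ∈ Valid ∩ P} := by
  classical
  choose S l b hl0 hl hb hS using hstep
  obtain ⟨σ, hσ⟩ := exists_strategy hn fun F =>
    if h : F ∈ Valid ∧ F ∉ P then S F h.1 h.2 else ∅
  refine ⟨σ, ?_⟩
  -- Here `w - 1` is the number of rounds that may still be wasted: `t` rounds remain, and at most
  -- `N - F.edgeSet.ncard` of them can add an edge. Multiplying by `w` turns the bound `Ψ F / w` of
  -- Markov type into one that can be proved by induction.
  have key : ∀ t F w, F ∈ Valid → t + 1 = (N - F.edgeSet.ncard) + w →
      w * failProb σ Valid P t F ≤ Ψ F + w * Φ F := by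
    intro t
    induction t with
    | zero =>
      intro F w hF hw
      have h0 : 0 ≤ Ψ F + w * Φ F := add_nonneg (hΨ F) (mul_nonneg (Nat.cast_nonneg _) (hΦ F))
      have hNF := hN F hF
      by_cases hP : F ∈ P
      · rw [failProb, if_pos ⟨hF, hP⟩]; simpa using h0
      · by_cases hw0 : w = 0
        · subst hw0; simpa using h0
        -- No round is left and `w = 1`, so `F` has `N` edges. Outside `P` it could still be
        -- extended within `Valid`, beyond the maximal number of edges.
        · exfalso
          have hr : F.edgeSet.ncard = N := by omega
          have hpos := (hl0 F hF hP).trans_le (hl F hF hP)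
          have hne : (S F hF hP).Nonempty := by
            by_contra hne
            rw [Finset.not_nonempty_iff_eq_empty] at hne
            rw [hne] at hpos
            simp [Hits, treeProb] at hpos
          obtain ⟨x, hx⟩ := hne
          obtain ⟨h1, h2, h3, -⟩ := hS F hF hP x hx
          have := hN _ h3
          rw [ncard_edgeSet_addPair h1 h2] at this
          omega
    | succ t ih =>
      intro F w hF hw
      have h0 : 0 ≤ Ψ F + w * Φ F := add_nonneg (hΨ F) (mul_nonneg (Nat.cast_nonneg _) (hΦ F))
      have hNF := hN F hF
      by_cases hP : F ∈ P
      · rw [failProb, if_neg (fun h => h.2 hP), if_pos ⟨hF, hP⟩]; simpa using h0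
      by_cases hw0 : w = 0
      · subst hw0; simpa using h0
      obtain ⟨w, rfl⟩ := Nat.exists_eq_succ_of_ne_zero hw0
      have hl0' := hl0 F hF hP
      have hl' := hl F hF hP
      have hb' := hb F hF hP
      have hS' := hS F hF hP
      have hb0 : 0 ≤ b F hF hP := (treeProb_nonneg _).trans hb'
      set S' := S F hF hP
      set l' := l F hF hP
      set b' := b F hF hP
      rw [failProb, if_pos ⟨hF, hP⟩]
      have hσF := hσ F
      simp only [hF, hP, not_false_eq_true, and_self, dite_true] at hσF
      have hw1 : (0 : ℝ) < (w.succ : ℝ) := by positivity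
      -- A hit keeps `w` and lowers both potentials. A miss that repeats an edge lowers `w` by one,
      -- which costs at most `1` because a failure probability is at most `1`. After a miss with a
      -- tree disjoint from `F` nothing is known, and failure is charged in full, at a cost of `w`.
      have havg := average_le (n := n) (by omega)
        (fun T => (w.succ : ℝ) * failProb σ Valid P t (nextGraph σ F T))
        (fun T => Hits T S') (fun T => Disjoint T.1.edgeSet F.edgeSet)
        (A := Ψ F - (1 / l' - 1) + w.succ * (Φ F - b' / l')) (B := Ψ F + w.succ * Φ F + 1)
        (C := w.succ) ?_ ?_ ?_
      · rw [← mul_finsum, mul_div_assoc] at havg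
        refine havg.trans ?_
        set p := treeProb fun T => Hits T S'
        have h1 : 1 ≤ p / l' := (one_le_div hl0').2 hl'
        have h2 : treeProb (fun T => ¬ Hits T S' ∧ Disjoint T.1.edgeSet F.edgeSet) * (w.succ : ℝ)
            ≤ b' * w.succ := mul_le_mul_of_nonneg_right hb' hw1.le
        -- The prescribed drops of the potentials are those for which the average differs from the
        -- claim by `(1 + b' * w) * (1 - p / l')`, which is not positive since `l' ≤ p`.
        have h3 : p * (Ψ F - (1 / l' - 1) + w.succ * (Φ F - b' / l')) +
            (1 - p) * (Ψ F + w.succ * Φ F + 1) + b' * w.succ =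
            Ψ F + w.succ * Φ F + (1 - p / l') + (b' * w.succ) * (1 - p / l') := by
          field_simp
          ring
        have h4 : (b' * w.succ) * (1 - p / l') ≤ 0 :=
          mul_nonpos_of_nonneg_of_nonpos (mul_nonneg hb0 hw1.le) (by linarith)
        linarith
      · intro T hT
        obtain ⟨x, hx, hnext⟩ := (hσF T).1 hT
        obtain ⟨h1, h2, h3, h4, h5⟩ := hS' x hx
        have hcard := ncard_edgeSet_addPair h1 h2
        have hNx := hN _ h3
        have := ih (addPair F x) w.succ h3 (by omega)
        rw [hnext]
        refine this.trans ?_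
        have h6 : (w.succ : ℝ) * Φ (addPair F x) ≤ w.succ * (Φ F - b' / l') :=
          mul_le_mul_of_nonneg_left (by linarith) hw1.le
        linarith
      · intro T _ _
        have h1 := failProb_le_one (σ := σ) (Valid := Valid) (P := P) t (nextGraph σ F T)
        have h2 : (w.succ : ℝ) * failProb σ Valid P t (nextGraph σ F T) ≤ w.succ * 1 :=
          mul_le_mul_of_nonneg_left h1 hw1.le
        linarith
      · intro T hT hd
        have hnext := (hσF T).2 hT hd
        rw [hnext]
        have h1 := failProb_le_one (σ := σ) (Valid := Valid) (P := P) t F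
        have h2 := ih F w hF (by omega)
        have h3 := hΦ F
        push_cast
        linarith
  have h1 := treesLaw_stopped (σ := σ) (Valid := Valid) (P := P) (by omega : 0 < n) (N + W - 1)
  have h2 := key (N + W - 1) ⊥ W hbot (by simp; omega)
  have hW' : (0 : ℝ) < W := by exact_mod_cast hW
  have h3 : failProb σ Valid P (N + W - 1) ⊥ ≤ Φ ⊥ + Ψ ⊥ / W := by
    rw [← mul_le_mul_iff_right₀ hW', mul_add, mul_div_cancel₀ _ hW'.ne']
    linarith
  have := isProbabilityMeasure_treesLaw (n := n) (by omega)
  have h4 : treesLaw n {T | stopped σ Valid P T (N + W - 1) ∈ Valid ∩ P} ≤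
      treesLaw n {T | ∃ t : ℕ, t + 1 ≤ N + W ∧ hittingTime σ P T = (t : ℕ∞) ∧
        graphAfter σ T t ∈ Valid ∩ P} := by
    refine measure_mono fun T hT => ?_
    obtain ⟨t, ht, h⟩ := hittingTime_of_stopped hT
    exact ⟨t, by omega, h⟩
  refine le_trans ?_ h4
  have h5 : (1 : ENNReal) ≤ treesLaw n {T | stopped σ Valid P T (N + W - 1) ∈ Valid ∩ P} +
      treesLaw n {T | stopped σ Valid P T (N + W - 1) ∉ Valid ∩ P} := by
    rw [← measure_univ (μ := treesLaw n)]
    refine (measure_mono fun T _ => ?_).trans (measure_union_le _ _)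
    exact em (stopped σ Valid P T (N + W - 1) ∈ Valid ∩ P)
  rw [ENNReal.ofReal_sub _ (add_nonneg (hΦ _) (div_nonneg (hΨ _) hW'.le)), ENNReal.ofReal_one]
  rw [tsub_le_iff_right]
  refine h5.trans (add_le_add_right (h1.trans (ENNReal.ofReal_le_ofReal h3)) _)

end Rounds

/-! ### Neighbourhoods, and connectivity in terms of closed sets. -/

section Graphs

set_option linter.unusedSectionVars false

variable {V : Type*} [Fintype V] [DecidableEq V]

open Classical in
/-- The ordered pairs of adjacent vertices. -/
noncomputable def adjPairs (F : SimpleGraph V) : Finset (V × V) :=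
  Finset.univ.filter fun x => F.Adj x.1 x.2

open Classical in
/-- The neighbours of a vertex. -/
noncomputable def nbrs (F : SimpleGraph V) (v : V) : Finset V := Finset.univ.filter (F.Adj v)

theorem mem_nbrs {F : SimpleGraph V} {v w : V} : w ∈ nbrs F v ↔ F.Adj v w := by
  simp [nbrs]

theorem mem_adjPairs {F : SimpleGraph V} {x : V × V} : x ∈ adjPairs F ↔ F.Adj x.1 x.2 := by
  simp [adjPairs]

theorem card_adjPairs_eq_sum (F : SimpleGraph V) :
    (adjPairs F).card = ∑ v, (nbrs F v).card := by
  rw [Finset.card_eq_sum_card_fiberwise (f := Prod.fst) (t := Finset.univ) (by simp)]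
  refine Finset.sum_congr rfl fun v _ => ?_
  refine Finset.card_nbij' Prod.snd (fun w => (v, w)) ?_ ?_ ?_ ?_
  · rintro ⟨x, y⟩ h
    simp only [Finset.coe_filter, Set.mem_ofPred_eq, mem_adjPairs] at h
    simp [← h.2, h.1, mem_nbrs]
  · intro w h
    have h : F.Adj v w := by simpa [mem_nbrs] using h
    simp [h, mem_adjPairs]
  · rintro ⟨x, y⟩ h
    simp only [Finset.coe_filter, Set.mem_ofPred_eq] at h
    simp [← h.2]
  · intro w _; rfl

theorem sum_card_nbrs (F : SimpleGraph V) :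
    ∑ v, (nbrs F v).card = 2 * F.edgeSet.ncard := by
  classical
  have h := F.sum_degrees_eq_twice_card_edges
  rw [← Set.ncard_coe_finset, SimpleGraph.coe_edgeFinset] at h
  rw [← h]
  refine Finset.sum_congr rfl fun v _ => ?_
  rw [← SimpleGraph.card_neighborFinset_eq_degree]
  congr 1
  ext w
  simp [mem_nbrs]

/-- The set `S` avoids `X` and contains all neighbours outside `X` of its elements. -/
def IsClosedOff (G : SimpleGraph V) (X : Finset V) (S : Set V) : Prop :=
  (∀ u ∈ S, u ∉ X) ∧ ∀ u ∈ S, ∀ v, G.Adj u v → v ∉ X → v ∈ S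

theorem IsClosedOff.compl {G : SimpleGraph V} {X : Finset V} {S : Set V}
    (h : IsClosedOff G X S) : IsClosedOff G X {v | v ∉ X ∧ v ∉ S} :=
  ⟨fun _ hu => hu.1, fun u hu v hadj hv => ⟨hv, fun hvS => hu.2 (h.2 v hvS u hadj.symm hu.1)⟩⟩

/-- The hypothesis is applied to the component of a vertex in the graph that remains after the
deletion of `X`. -/
theorem isKConnected_of_closed {k : ℕ} {G : SimpleGraph V} (hk : k < Fintype.card V)
    (h : ∀ X : Finset V, X.card < k → ∀ S, IsClosedOff G X S → S.Nonempty →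
      ∀ v, v ∉ X → v ∈ S) : IsKConnected k G := by
  refine ⟨hk, fun X hX => ?_⟩
  have hne : Nonempty {v : V | v ∉ X} := by
    by_contra hne
    have : X = Finset.univ := by
      ext v
      simp only [Finset.mem_univ, iff_true]
      by_contra hv
      exact hne ⟨⟨v, hv⟩⟩
    rw [this, Finset.card_univ] at hX
    omega
  refine { preconnected := fun u v => ?_, nonempty := hne }
  have hv := h X hX {w | ∃ hw : w ∉ X, (G.induce {v : V | v ∉ X}).Reachable u ⟨w, hw⟩} ?_ ?_ v v.2
  · exact hv.2
  · refine ⟨fun w hw => hw.1, ?_⟩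
    rintro w ⟨hw, hr⟩ x hadj hx
    refine ⟨hx, hr.trans (SimpleGraph.Adj.reachable ?_)⟩
    exact hadj
  · exact ⟨u, u.2, SimpleGraph.Reachable.refl _⟩

/-- Otherwise deleting the neighbours of `v` would isolate it from some other vertex. -/
theorem IsKConnected.le_card_nbrs {k : ℕ} {G : SimpleGraph V} (h : IsKConnected k G) (v : V) :
    k ≤ (nbrs G v).card := by
  by_contra! hlt
  have hv : v ∉ nbrs G v := by simp [mem_nbrs]
  have hex : ∃ w, w ∉ insert v (nbrs G v) := by
    by_contra! hall
    have := Finset.card_le_card (fun x _ => hall x : (Finset.univ : Finset V) ⊆ _)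
    rw [Finset.card_insert_of_notMem hv, Finset.card_univ] at this
    have := h.1
    omega
  obtain ⟨w, hw⟩ := hex
  rw [Finset.mem_insert, not_or] at hw
  have hc := h.2 (nbrs G v) hlt
  have hnt : Nontrivial {x : V | x ∉ nbrs G v} :=
    ⟨⟨v, hv⟩, ⟨w, hw.2⟩, fun h => hw.1 (congrArg Subtype.val h).symm⟩
  obtain ⟨⟨x, hx⟩, hadj⟩ := hc.preconnected.exists_adj_of_nontrivial ⟨v, hv⟩
  exact hx (mem_nbrs.2 hadj)

theorem degreesKOrSucc_of_card_nbrs {k : ℕ} {G : SimpleGraph V} (h : IsKConnected k G)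
    (hd : ∀ v, (nbrs G v).card ≤ k + 1) : DegreesKOrSucc k G := by
  classical
  intro v
  have h1 := h.le_card_nbrs v
  have h2 := hd v
  have h3 : ∀ v, G.degree v = (nbrs G v).card := by
    intro v
    rw [← SimpleGraph.card_neighborFinset_eq_degree]
    congr 1
    ext w
    simp [mem_nbrs]
  have h4 := h3 v
  have : (nbrs G v).card = k ∨ (nbrs G v).card = k + 1 := by omega
  rw [← h4] at this
  convert this

end Graphs

/-! ### Powers of a cycle are highly connected. -/

section Circulant

variable {n : ℕ}

/-- The vertex `j` places after `a` in cyclic order. -/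
def cyc (a : Fin n) (j : ℕ) : Fin n := ⟨(a.val + j) % n, Nat.mod_lt _ a.pos⟩

/-- The graph joining vertices at cyclic distance at most `r`. -/
def cyclePower (n r : ℕ) : SimpleGraph (Fin n) :=
  SimpleGraph.fromRel fun u v => ∃ j, 1 ≤ j ∧ j ≤ r ∧ v = cyc u j

theorem cyc_zero (a : Fin n) : cyc a 0 = a := by
  apply Fin.ext
  simp [cyc, Nat.mod_eq_of_lt a.2]

theorem cyc_cyc (a : Fin n) (i j : ℕ) : cyc (cyc a i) j = cyc a (i + j) := by
  apply Fin.ext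
  simp [cyc, add_assoc]

theorem cyc_self (a : Fin n) : cyc a n = a := by
  apply Fin.ext
  simp [cyc, Nat.mod_eq_of_lt a.2]

theorem cyc_injOn (a : Fin n) {i j : ℕ} (hi : i < n) (hj : j < n) (h : cyc a i = cyc a j) :
    i = j := by
  have h1 : (a.val + i) % n = (a.val + j) % n := congrArg Fin.val h
  have h2 : i % n = j % n := Nat.ModEq.add_left_cancel' a.val h1
  rwa [Nat.mod_eq_of_lt hi, Nat.mod_eq_of_lt hj] at h2

theorem exists_cyc_eq (a b : Fin n) : ∃ L < n, cyc a L = b := by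
  have hinj : Function.Injective fun j : Fin n => cyc a j :=
    fun i j h => Fin.ext (cyc_injOn a i.2 j.2 h)
  obtain ⟨L, hL⟩ := (Finite.injective_iff_surjective.1 hinj) b
  exact ⟨L, L.2, hL⟩

theorem cyclePower_adj_cyc {r : ℕ} (a : Fin n) {i j : ℕ} (hij : i < j) (hjr : j ≤ i + r)
    (hne : cyc a i ≠ cyc a j) : (cyclePower n r).Adj (cyc a i) (cyc a j) := by
  rw [cyclePower, SimpleGraph.fromRel_adj]
  refine ⟨hne, Or.inl ⟨j - i, by omega, by omega, ?_⟩⟩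
  rw [cyc_cyc]
  congr 1
  omega

/-- Edges span up to `r` places, so walking along an arc is blocked only by `r` consecutive deleted
vertices. -/
theorem mem_of_arc {r : ℕ} (hr : 0 < r) {X : Finset (Fin n)} {S : Set (Fin n)}
    (hS : IsClosedOff (cyclePower n r) X S) {a : Fin n} (ha : a ∈ S) (L : ℕ)
    (hL : ((Finset.Ioo 0 L).filter fun j => cyc a j ∈ X).card < r) (j : ℕ) (hj : j ≤ L)
    (hjX : cyc a j ∉ X) : cyc a j ∈ S := by
  induction j using Nat.strong_induction_on with
  | _ j ih =>
    have hstep : ∀ i < j, j ≤ i + r → cyc a i ∈ S → cyc a j ∈ S := by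
      intro i hij hjr hi
      by_cases hne : cyc a i = cyc a j
      · rwa [← hne]
      · exact hS.2 _ hi _ (cyclePower_adj_cyc a hij hjr hne) hjX
    rcases Nat.eq_zero_or_pos j with rfl | hj0
    · rwa [cyc_zero]
    by_cases hjr : j ≤ r
    · exact hstep 0 hj0 (by omega) (by rwa [cyc_zero])
    · have hex : ∃ i ∈ Finset.Ico (j - r) j, cyc a i ∉ X := by
        by_contra! hall
        have hsub : Finset.Ico (j - r) j ⊆ (Finset.Ioo 0 L).filter fun j => cyc a j ∈ X := by
          intro i hi
          have := Finset.mem_Ico.1 hi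
          rw [Finset.mem_filter, Finset.mem_Ioo]
          exact ⟨by omega, hall i hi⟩
        have := Finset.card_le_card hsub
        rw [Nat.card_Ico] at this
        omega
      obtain ⟨i, hi, hiX⟩ := hex
      rw [Finset.mem_Ico] at hi
      exact hstep i hi.2 (by omega) (ih i hi.2 (by omega) hiX)

/-- To separate `a` from `b`, both arcs between them must contain `r` deleted vertices, hence at
least `2 * r ≥ k` are deleted. -/
theorem isKConnected_cyclePower {r k : ℕ} (hr : 0 < r) (hk : k ≤ 2 * r) (hkn : k < n) :
    IsKConnected k (cyclePower n r) := by
  refine isKConnected_of_closed (by simpa using hkn) fun X hX S hS hne b hb => ?_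
  obtain ⟨a, ha⟩ := hne
  by_contra hbS
  have haX := hS.1 a ha
  obtain ⟨L, hLn, hL⟩ := exists_cyc_eq a b
  have h1 : r ≤ ((Finset.Ioo 0 L).filter fun j => cyc a j ∈ X).card := by
    by_contra! hlt
    refine hbS ?_
    rw [← hL]
    exact mem_of_arc hr hS ha L hlt L le_rfl (by rwa [hL])
  have hba : cyc b (n - L) = a := by
    rw [← hL, cyc_cyc, show L + (n - L) = n by omega, cyc_self]
  have h2 : r ≤ ((Finset.Ioo 0 (n - L)).filter fun j => cyc b j ∈ X).card := by
    by_contra! hlt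
    have := mem_of_arc hr hS.compl (a := b) ⟨hb, hbS⟩ (n - L) hlt (n - L) le_rfl (by rwa [hba])
    rw [hba] at this
    exact this.2 ha
  have h3 : ((Finset.Ioo 0 (n - L)).filter fun j => cyc b j ∈ X).card =
      ((Finset.Ioo L n).filter fun j => cyc a j ∈ X).card := by
    refine Finset.card_nbij' (fun j => L + j) (fun j => j - L) ?_ ?_ ?_ ?_
    · intro j hj
      simp only [Finset.coe_filter, Finset.mem_Ioo, Set.mem_ofPred_eq] at hj ⊢
      rw [← hL, cyc_cyc] at hj
      exact ⟨by omega, hj.2⟩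
    · intro j hj
      simp only [Finset.coe_filter, Finset.mem_Ioo, Set.mem_ofPred_eq] at hj ⊢
      rw [← hL, cyc_cyc, show L + (j - L) = j by omega]
      exact ⟨by omega, hj.2⟩
    · intro j _
      simp
    · intro j hj
      simp only [Finset.coe_filter, Finset.mem_Ioo, Set.mem_ofPred_eq] at hj
      simp only
      omega
  rw [h3] at h2
  have hdisj : Disjoint ((Finset.Ioo 0 L).filter fun j => cyc a j ∈ X)
      ((Finset.Ioo L n).filter fun j => cyc a j ∈ X) := by
    rw [Finset.disjoint_left]
    intro j hj hj'
    simp only [Finset.mem_filter, Finset.mem_Ioo] at hj hj'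
    omega
  have h4 : (((Finset.Ioo 0 L).filter fun j => cyc a j ∈ X) ∪
      ((Finset.Ioo L n).filter fun j => cyc a j ∈ X)).card ≤ X.card := by
    refine Finset.card_le_card_of_injOn (cyc a) ?_ ?_
    · intro j hj
      simp only [Finset.coe_union, Finset.coe_filter, Set.mem_union, Set.mem_ofPred_eq] at hj
      rcases hj with hj | hj <;> exact hj.2
    · intro i hi j hj hij
      simp only [Finset.coe_union, Finset.coe_filter, Set.mem_union, Set.mem_ofPred_eq,
        Finset.mem_Ioo] at hi hj
      exact cyc_injOn a (by omega) (by omega) hij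
  rw [Finset.card_union_of_disjoint hdisj] at h4
  omega

theorem card_nbrs_cyclePower_le {r : ℕ} (hrn : r ≤ n) (v : Fin n) :
    (nbrs (cyclePower n r) v).card ≤ 2 * r := by
  have hsub : nbrs (cyclePower n r) v ⊆ (Finset.Icc 1 r).image (cyc v) ∪
      (Finset.Icc 1 r).image fun j => cyc v (n - j) := by
    intro w hw
    rw [mem_nbrs, cyclePower, SimpleGraph.fromRel_adj] at hw
    rw [Finset.mem_union, Finset.mem_image, Finset.mem_image]
    rcases hw.2 with ⟨j, h1, h2, rfl⟩ | ⟨j, h1, h2, rfl⟩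
    · exact Or.inl ⟨j, Finset.mem_Icc.2 ⟨h1, h2⟩, rfl⟩
    · refine Or.inr ⟨j, Finset.mem_Icc.2 ⟨h1, h2⟩, ?_⟩
      rw [cyc_cyc, show j + (n - j) = n by omega, cyc_self]
  refine (Finset.card_le_card hsub).trans ((Finset.card_union_le _ _).trans ?_)
  have h1 := Finset.card_image_le (s := Finset.Icc 1 r) (f := cyc v)
  have h2 := Finset.card_image_le (s := Finset.Icc 1 r) (f := fun j => cyc v (n - j))
  rw [Nat.card_Icc] at h1 h2
  omega

end Circulant

/-! ### Large `k`: collecting the edges of a fixed graph. -/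

section FixedTarget

variable {n : ℕ}

/-- A round without a useful pair is harmless if an old edge can be repeated, so once `F` has many
edges the risk is small even when `S` is tiny. -/
theorem treeProb_not_hits_and_disjoint_le (S : Finset (Fin n × Fin n))
    (F : SimpleGraph (Fin n)) :
    treeProb (fun T => ¬ Hits T S ∧ Disjoint T.1.edgeSet F.edgeSet) ≤
      treeProb (fun T => ¬ Hits T (adjPairs F)) := by
  refine treeProb_mono fun T hT => ?_
  rintro ⟨x, hx, hadj⟩
  have h1 : s(x.1, x.2) ∈ T.1.edgeSet := hadj
  have h2 : s(x.1, x.2) ∈ F.edgeSet := mem_adjPairs.1 hx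
  exact Set.disjoint_left.1 hT.2 h1 h2

/-- Collecting the edges of a fixed `k`-connected graph `H`. -/
theorem exists_strategy_fixed_target (hn : 2 ≤ n) {k L W : ℕ} {η : ℝ} {H : SimpleGraph (Fin n)}
    (hH : IsKConnected k H) (hL0 : 0 < L) (hL : 2 * L ≤ n * (n - 1)) (hLk : 2 * L ≤ n * k)
    (hη : n * Real.exp (-(L / n : ℝ)) ≤ η) (hη2 : η ≤ 1 / 2) (hW : 0 < W) :
    ∃ σ : Strategy n, ENNReal.ofReal (1 - (6 * L * η * H.edgeSet.ncard +
        (2 * η * H.edgeSet.ncard + 3 * L * (1 + Real.log H.edgeSet.ncard)) / W)) ≤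
      treesLaw n {T | ∃ t : ℕ, t + 1 ≤ H.edgeSet.ncard + W ∧
        hittingTime σ (kConnectedGraphs n k) T = (t : ℕ∞) ∧
        graphAfter σ T t ∈ {F | F ≤ H} ∩ kConnectedGraphs n k} := by
  classical
  set m := H.edgeSet.ncard with hm
  have hη0 : 0 ≤ η := le_trans (by positivity) hη
  have hL0' : (1 : ℝ) ≤ L := by exact_mod_cast hL0
  -- With `j + 1` edges missing, the expected waiting time is at most `3 * L / (j + 1)` while few
  -- are missing and exceeds `1` by at most `2 * η` while many are. The first kind sums to a
  -- harmonic number.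
  let ψ : ℕ → ℝ := fun u => ∑ j ∈ Finset.range u, (2 * η + 3 * L / ((j : ℝ) + 1))
  have hle : ∀ F ≤ H, F.edgeSet.ncard ≤ m := fun F hF =>
    Set.ncard_le_ncard (SimpleGraph.edgeSet_subset_edgeSet.2 hF) (Set.toFinite _)
  have hmiss : ∀ S : Finset (Fin n × Fin n), (∀ x ∈ S, x.1 ≠ x.2) → L ≤ S.card →
      treeProb (fun T => ¬ Hits T S) ≤ η := by
    intro S hS hc
    refine (treeProb_not_hits_le (by omega) S hS).trans (le_trans ?_ hη)
    have : (L : ℝ) ≤ S.card := by exact_mod_cast hc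
    gcongr
  refine Exists.imp (fun σ hσ => ?_) (exists_strategy_of_potential hn {F | F ≤ H} (kConnectedGraphs n k)
    (fun F => 6 * L * η * (m - F.edgeSet.ncard : ℕ)) (fun F => ψ (m - F.edgeSet.ncard)) m W hW
    (fun F => by positivity) (fun F => Finset.sum_nonneg fun j _ => by positivity) (by simp)
    (fun F hF => hle F hF) ?_)
  · refine le_trans (ENNReal.ofReal_le_ofReal ?_) hσ
    have hψ : ψ m ≤ 2 * η * m + 3 * L * (1 + Real.log m) := by
      have h1 := harmonic_le_one_add_log m
      simp only [ψ, Finset.sum_add_distrib, Finset.sum_const, Finset.card_range, nsmul_eq_mul,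
        div_eq_mul_inv, ← Finset.mul_sum]
      have h2 : ∑ j ∈ Finset.range m, ((j : ℝ) + 1)⁻¹ = (harmonic m : ℝ) := by
        simp [harmonic]
      rw [h2]
      have : (3 * (L : ℝ)) * harmonic m ≤ 3 * L * (1 + Real.log m) :=
        mul_le_mul_of_nonneg_left h1 (by positivity)
      linarith
    have h0 : (⊥ : SimpleGraph (Fin n)).edgeSet.ncard = 0 := by simp
    simp only [h0, Nat.sub_zero]
    gcongr
  · intro F hF hP
    have hFH : F ≤ H := hF
    set u := m - F.edgeSet.ncard with hu
    let S := adjPairs H \ adjPairs F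
    have hScard : S.card = 2 * u := by
      rw [Finset.card_sdiff_of_subset, card_adjPairs_eq_sum, card_adjPairs_eq_sum, sum_card_nbrs,
        sum_card_nbrs]
      · have := hle F hF; omega
      · intro x hx
        exact mem_adjPairs.2 (hFH (mem_adjPairs.1 hx))
    have hS : ∀ x ∈ S, x.1 ≠ x.2 := fun x hx =>
      (mem_adjPairs.1 (Finset.mem_sdiff.1 hx).1).ne
    have hu0 : 0 < u := by
      by_contra hu0
      have h1 : F.edgeSet = H.edgeSet := Set.eq_of_subset_of_ncard_le
        (SimpleGraph.edgeSet_subset_edgeSet.2 hFH) (by omega) (Set.toFinite _)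
      have h2 : F = H := SimpleGraph.edgeSet_injective h1
      exact hP (h2 ▸ hH)
    have hu0' : (0 : ℝ) < u := by exact_mod_cast hu0
    have hu1 : (u : ℝ) ≥ 1 := by exact_mod_cast hu0
    have hadd : ∀ x ∈ S, (x.1 ≠ x.2 ∧ ¬ F.Adj x.1 x.2 ∧ addPair F x ∈ {F | F ≤ H}) ∧
        m - (addPair F x).edgeSet.ncard = u - 1 := by
      intro x hx
      have h1 := mem_adjPairs.1 (Finset.mem_sdiff.1 hx).1
      have h2 : ¬ F.Adj x.1 x.2 := fun h => (Finset.mem_sdiff.1 hx).2 (mem_adjPairs.2 h)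
      refine ⟨⟨h1.ne, h2, ?_⟩, ?_⟩
      · intro a b hab
        rcases (addPair_adj h1.ne).1 hab with h | ⟨rfl, rfl⟩ | ⟨rfl, rfl⟩
        · exact hFH h
        · exact h1
        · exact h1.symm
      · rw [ncard_edgeSet_addPair h1.ne h2]; omega
    have hψs : ψ (u - 1) + (2 * η + 3 * L / u) = ψ u := by
      obtain ⟨w, hw⟩ := Nat.exists_eq_succ_of_ne_zero hu0.ne'
      rw [hw]
      simp only [ψ, Nat.succ_eq_add_one, Nat.add_sub_cancel, Finset.sum_range_succ]
      push_cast
      ring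
    have hΦs : 6 * L * η * ((u - 1 : ℕ) : ℝ) + 6 * L * η = 6 * L * η * u := by
      rw [Nat.cast_sub hu0]; push_cast; ring
    -- With many missing pairs a miss is unlikely. With few, `F` contains almost all of `H`, at
    -- least `n * k - L ≥ L` ordered pairs, so a miss almost surely comes with an old edge to
    -- repeat.
    by_cases hbig : L ≤ S.card
    · have hmS := hmiss S hS hbig
      refine ⟨S, 1 - η, η, by linarith, ?_, ?_, fun x hx => ?_⟩
      · rw [treeProb_not (by omega)] at hmS
        linarith
      · exact (treeProb_mono fun T hT => hT.1).trans hmS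
      · obtain ⟨⟨h1, h2, h3⟩, h4⟩ := hadd x hx
        refine ⟨h1, h2, h3, ?_, ?_⟩
        · simp only [h4]
          have : η / (1 - η) ≤ 6 * L * η := by
            rw [div_le_iff₀ (by linarith)]
            have h5 : 0 ≤ 6 * L * η * (1 / 2 - η) := mul_nonneg (by positivity) (by linarith)
            have h6 : 0 ≤ η * (L - 1) := mul_nonneg hη0 (by linarith)
            linarith
          linarith
        · simp only [h4]
          rw [← hψs]
          have : 1 / (1 - η) - 1 ≤ 2 * η := by
            rw [sub_le_iff_le_add, div_le_iff₀ (by linarith)]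
            nlinarith
          have h6 : 0 ≤ 3 * (L : ℝ) / u := by positivity
          linarith
    · have hmF : treeProb (fun T => ¬ Hits T (adjPairs F)) ≤ η := by
        refine hmiss _ (fun x hx => (mem_adjPairs.1 hx).ne) ?_
        have h1 : n * k ≤ (adjPairs H).card := by
          rw [card_adjPairs_eq_sum]
          have := Finset.card_nsmul_le_sum (Finset.univ : Finset (Fin n))
            (fun v => (nbrs H v).card) k fun v _ => hH.le_card_nbrs v
          simpa using this
        have h2 : (adjPairs H).card ≤ S.card + (adjPairs F).card := by
          have := Finset.card_le_card (show adjPairs H ⊆ S ∪ adjPairs F from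
            fun x hx => by by_cases h : x ∈ adjPairs F <;> simp [S, h, hx])
          exact this.trans (Finset.card_union_le _ _)
        omega
      have hSl := le_treeProb_hits hn S hS (by omega) (not_le.1 hbig).le hL (hη.trans hη2)
      refine ⟨S, S.card / (6 * L), η, ?_, hSl, ?_, fun x hx => ?_⟩
      · rw [hScard]; push_cast; positivity
      · exact (treeProb_not_hits_and_disjoint_le S F).trans hmF
      · obtain ⟨⟨h1, h2, h3⟩, h4⟩ := hadd x hx
        refine ⟨h1, h2, h3, ?_, ?_⟩
        · simp only [h4]
          have : η / ((S.card : ℝ) / (6 * L)) ≤ 6 * L * η := by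
            rw [div_div_eq_mul_div, hScard, div_le_iff₀ (by push_cast; positivity)]
            push_cast
            have : 0 ≤ 6 * L * η := by positivity
            nlinarith
          linarith
        · simp only [h4]
          rw [← hψs]
          have : 1 / ((S.card : ℝ) / (6 * L)) = 3 * L / u := by
            rw [hScard]
            push_cast
            field_simp
            ring
          rw [this]
          linarith

end FixedTarget

/-! ### Path covers and the criterion for `k`-connectivity. -/

section PathCovers

set_option linter.unusedSectionVars false

variable {V : Type*} [Fintype V] [DecidableEq V]

/-- A partition of the vertices into paths: each vertex has the label of its path and a position
on it. -/
structure PathCover (V : Type*) where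
  label : V → V
  pos : V → ℕ
  inj : ∀ u v, label u = label v → pos u = pos v → u = v
  down : ∀ v j, pos v = j + 1 → ∃ u, label u = label v ∧ pos u = j

namespace PathCover

variable (C : PathCover V)

/-- The union of the paths. -/
def graph : SimpleGraph V where
  Adj u v := C.label u = C.label v ∧ (C.pos v = C.pos u + 1 ∨ C.pos u = C.pos v + 1)
  symm := ⟨fun _ _ h => ⟨h.1.symm, h.2.symm⟩⟩
  loopless := ⟨fun u h => by have := h.2; omega⟩

theorem graph_adj {u v : V} : C.graph.Adj u v ↔
    C.label u = C.label v ∧ (C.pos v = C.pos u + 1 ∨ C.pos u = C.pos v + 1) := Iff.rfl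

/-- The vertices of the path with a given label. -/
def piece (a : V) : Finset V := Finset.univ.filter fun v => C.label v = a

theorem mem_piece {a v : V} : v ∈ C.piece a ↔ C.label v = a := by simp [piece]

theorem exists_bottom (v : V) : ∃ u, C.label u = C.label v ∧ C.pos u = 0 := by
  induction h : C.pos v generalizing v with
  | zero => exact ⟨v, rfl, h⟩
  | succ j ih =>
    obtain ⟨u, hu, hj⟩ := C.down v j h
    obtain ⟨w, hw, h0⟩ := ih u hj
    exact ⟨w, hw.trans hu, h0⟩

theorem exists_of_le (v : V) {j : ℕ} (hj : j ≤ C.pos v) :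
    ∃ u, C.label u = C.label v ∧ C.pos u = j := by
  induction h : C.pos v - j generalizing j with
  | zero => exact ⟨v, rfl, by omega⟩
  | succ d ih =>
    obtain ⟨u, hu, hju⟩ := ih (j := j + 1) (by omega) (by omega)
    obtain ⟨w, hw, hjw⟩ := C.down u j hju
    exact ⟨w, hw.trans hu, hjw⟩

/-- The last vertex of its path. -/
def IsTop (v : V) : Prop := ∀ w, C.label w = C.label v → C.pos w ≠ C.pos v + 1

theorem IsTop.le {v : V} (h : C.IsTop v) {w : V} (hw : C.label w = C.label v) :
    C.pos w ≤ C.pos v := by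
  by_contra! hlt
  obtain ⟨u, hu, hp⟩ := C.exists_of_le w (j := C.pos v + 1) hlt
  exact h u (hu.trans hw) hp

theorem IsTop.eq {v w : V} (hv : C.IsTop v) (hw : C.IsTop w) (h : C.label v = C.label w) :
    v = w :=
  C.inj v w h (le_antisymm (hw.le C h) (hv.le C h.symm))

theorem exists_top (v : V) : ∃ u, C.label u = C.label v ∧ C.IsTop u := by
  obtain ⟨u, hu, hmax⟩ := Finset.exists_max_image (C.piece (C.label v)) C.pos
    ⟨v, C.mem_piece.2 rfl⟩
  rw [mem_piece] at hu
  refine ⟨u, hu, fun w hw hp => ?_⟩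
  have := hmax w (C.mem_piece.2 (hw.trans hu))
  omega

theorem card_piece_le {M : ℕ} (hM : ∀ v, C.pos v < M) (a : V) : (C.piece a).card ≤ M := by
  rw [← Finset.card_range M]
  refine Finset.card_le_card_of_injOn C.pos (fun v _ => by simpa using hM v) fun u hu v hv h => ?_
  rw [Finset.mem_coe, mem_piece] at hu hv
  exact C.inj u v (hu.trans hv.symm) h

theorem card_labelled_le {M : ℕ} (hM : ∀ v, C.pos v < M) (A : Finset V) :
    (Finset.univ.filter fun v => C.label v ∈ A).card ≤ A.card * M := by
  have : (Finset.univ.filter fun v => C.label v ∈ A) = A.biUnion C.piece := by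
    ext v
    simp [mem_piece]
  rw [this]
  exact Finset.card_biUnion_le_card_mul _ _ _ fun a _ => C.card_piece_le hM a

/-- The neighbours of `v` on other paths. -/
noncomputable def flex (F : SimpleGraph V) (v : V) : Finset V :=
  (nbrs F v).filter fun w => C.label w ≠ C.label v

theorem mem_flex {F : SimpleGraph V} {v w : V} :
    w ∈ C.flex F v ↔ F.Adj v w ∧ C.label w ≠ C.label v := by
  simp [flex, mem_nbrs]

/-- The paths adjacent to the path with label `p`. -/
noncomputable def adjLabels (F : SimpleGraph V) (p : V) : Finset V :=
  ((C.piece p).biUnion (C.flex F)).image C.label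

theorem mem_adjLabels {F : SimpleGraph V} {p a : V} :
    a ∈ C.adjLabels F p ↔ a ≠ p ∧ ∃ u w, C.label u = p ∧ C.label w = a ∧ F.Adj u w := by
  simp only [adjLabels, Finset.mem_image, Finset.mem_biUnion, mem_piece, mem_flex]
  constructor
  · rintro ⟨w, ⟨u, rfl, h1, h2⟩, rfl⟩
    exact ⟨h2, u, w, rfl, rfl, h1⟩
  · rintro ⟨hne, u, w, rfl, rfl, h⟩
    exact ⟨w, ⟨u, rfl, h, hne⟩, rfl⟩

/-- The graph `F` contains the paths, no other edge inside the vertex set of a path, and at most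
one edge from each vertex to each other path; degrees and paths are bounded. -/
structure Fits (F : SimpleGraph V) (k M : ℕ) : Prop where
  le : C.graph ≤ F
  internal : ∀ u v, F.Adj u v → C.label u = C.label v → C.graph.Adj u v
  distinct : ∀ u v w, F.Adj u v → F.Adj u w → C.label v = C.label w →
    C.label v ≠ C.label u → v = w
  small : ∀ v, C.pos v < M
  deg : ∀ v, (nbrs F v).card ≤ k + 1

variable {C} {F : SimpleGraph V} {k M : ℕ}

theorem card_nbrs_le_of (hint : ∀ u v, F.Adj u v → C.label u = C.label v → C.graph.Adj u v)
    (v : V) :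
    (nbrs F v).card ≤ (Finset.univ.filter fun w => C.label w = C.label v ∧
        C.pos w = C.pos v + 1).card +
      (Finset.univ.filter fun w => C.label w = C.label v ∧ C.pos v = C.pos w + 1).card +
      (C.flex F v).card := by
  refine le_trans (Finset.card_le_card (t := (Finset.univ.filter fun w =>
    C.label w = C.label v ∧ C.pos w = C.pos v + 1) ∪ (Finset.univ.filter fun w =>
    C.label w = C.label v ∧ C.pos v = C.pos w + 1) ∪ C.flex F v) ?_)
    ((Finset.card_union_le _ _).trans (Nat.add_le_add_right (Finset.card_union_le _ _) _))
  intro w hw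
  rw [mem_nbrs] at hw
  simp only [Finset.mem_union, Finset.mem_filter, Finset.mem_univ, true_and, mem_flex]
  by_cases h : C.label w = C.label v
  · have := (hint v w hw h.symm).2
    tauto
  · exact Or.inr ⟨hw, h⟩

theorem card_up_le (C : PathCover V) (v : V) :
    (Finset.univ.filter fun w => C.label w = C.label v ∧ C.pos w = C.pos v + 1).card ≤ 1 := by
  rw [Finset.card_le_one]
  intro a ha b hb
  simp only [Finset.mem_filter, Finset.mem_univ, true_and] at ha hb
  exact C.inj a b (ha.1.trans hb.1.symm) (ha.2.trans hb.2.symm)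

theorem card_down_le (C : PathCover V) (v : V) :
    (Finset.univ.filter fun w => C.label w = C.label v ∧ C.pos v = C.pos w + 1).card ≤ 1 := by
  rw [Finset.card_le_one]
  intro a ha b hb
  simp only [Finset.mem_filter, Finset.mem_univ, true_and] at ha hb
  exact C.inj a b (ha.1.trans hb.1.symm) (by omega)

theorem card_nbrs_le_two_add
    (hint : ∀ u v, F.Adj u v → C.label u = C.label v → C.graph.Adj u v) (v : V) :
    (nbrs F v).card ≤ 2 + (C.flex F v).card := by
  have h1 := card_nbrs_le_of hint v
  have h2 := C.card_up_le v
  have h3 := C.card_down_le v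
  omega

theorem card_nbrs_le_of_top
    (hint : ∀ u v, F.Adj u v → C.label u = C.label v → C.graph.Adj u v) {v : V}
    (hv : C.IsTop v) : (nbrs F v).card ≤ 1 + (C.flex F v).card := by
  have h1 := card_nbrs_le_of hint v
  have h3 := C.card_down_le v
  have : (Finset.univ.filter fun w => C.label w = C.label v ∧ C.pos w = C.pos v + 1) = ∅ := by
    rw [Finset.filter_eq_empty_iff]
    rintro w - ⟨h, h'⟩
    exact hv w h h'
  rw [this] at h1
  simp only [Finset.card_empty] at h1
  omega

theorem card_nbrs_le_of_bottom
    (hint : ∀ u v, F.Adj u v → C.label u = C.label v → C.graph.Adj u v) {v : V}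
    (hv : C.pos v = 0) : (nbrs F v).card ≤
      (Finset.univ.filter fun w => C.label w = C.label v ∧ C.pos w = C.pos v + 1).card +
      (C.flex F v).card := by
  have h1 := card_nbrs_le_of hint v
  have : (Finset.univ.filter fun w => C.label w = C.label v ∧ C.pos v = C.pos w + 1) = ∅ := by
    rw [Finset.filter_eq_empty_iff]
    rintro w - ⟨h, h'⟩
    omega
  rw [this] at h1
  simp only [Finset.card_empty] at h1
  omega

theorem Fits.card_flex (h : C.Fits F k M) (v : V) :
    ((C.flex F v).image C.label).card = (C.flex F v).card := by
  refine Finset.card_image_of_injOn fun a ha b hb hab => ?_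
  rw [Finset.mem_coe, mem_flex] at ha hb
  exact h.distinct v a b ha.1 hb.1 hab ha.2

/-- A path without deleted vertices cannot be split by a closed set. -/
theorem mem_of_same_label (hle : C.graph ≤ F) {X : Finset V} {S : Set V}
    (hS : IsClosedOff F X S) {u v : V} (huv : C.label u = C.label v)
    (hX : C.label u ∉ X.image C.label) (hu : u ∈ S) : v ∈ S := by
  obtain ⟨b, hb, hb0⟩ := C.exists_bottom u
  have hnX : ∀ w, C.label w = C.label u → w ∉ X := fun w hw hwX =>
    hX (hw ▸ Finset.mem_image_of_mem _ hwX)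
  have key : ∀ m w, C.pos w = m → C.label w = C.label u → (w ∈ S ↔ b ∈ S) := by
    intro m
    induction m with
    | zero =>
      intro w hw hl
      rw [C.inj w b (hl.trans hb.symm) (by omega)]
    | succ m ih =>
      intro w hw hl
      obtain ⟨x, hx, hxm⟩ := C.down w m hw
      rw [← ih x hxm (hx.trans hl)]
      have hadj : F.Adj x w := hle ⟨hx, Or.inl (by omega)⟩
      exact ⟨fun h => hS.2 w h x hadj.symm (hnX x (hx.trans hl)),
        fun h => hS.2 x h w hadj (hnX w hl)⟩
  exact (key _ v rfl huv.symm).2 ((key _ u rfl rfl).1 hu)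

/-- Deleting fewer than `k` vertices does not separate those paths with labels in `A` that it
leaves intact. -/
def Robust (C : PathCover V) (F : SimpleGraph V) (k : ℕ) (A : Finset V) : Prop :=
  ∀ X : Finset V, X.card < k → ∀ S, IsClosedOff F X S → ∀ u v, C.label u ∈ A → C.label v ∈ A →
    C.label u ∉ X.image C.label → C.label v ∉ X.image C.label → u ∈ S → v ∈ S

theorem Robust.mono {F' : SimpleGraph V} {A : Finset V} (h : C.Robust F k A) (hF : F ≤ F') :
    C.Robust F' k A := fun X hX S hS =>
  h X hX S ⟨hS.1, fun u hu v hadj hv => hS.2 u hu v (hF hadj) hv⟩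

theorem mem_iff_of_adjLabels (hle : C.graph ≤ F) {X : Finset V} {S : Set V}
    (hS : IsClosedOff F X S) {u v : V} (hadj : C.label v ∈ C.adjLabels F (C.label u))
    (hu : C.label u ∉ X.image C.label) (hv : C.label v ∉ X.image C.label) : u ∈ S ↔ v ∈ S := by
  obtain ⟨hne, x, y, hx, hy, hxy⟩ := C.mem_adjLabels.1 hadj
  have hxX : x ∉ X := fun h => hu (hx ▸ Finset.mem_image_of_mem _ h)
  have hyX : y ∉ X := fun h => hv (hy ▸ Finset.mem_image_of_mem _ h)
  constructor
  · intro h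
    have h1 := mem_of_same_label hle hS hx.symm hu h
    exact mem_of_same_label hle hS hy (by rwa [hy]) (hS.2 x h1 y hxy hyX)
  · intro h
    have h1 := mem_of_same_label hle hS hy.symm hv h
    exact mem_of_same_label hle hS hx (by rwa [hx]) (hS.2 y h1 x hxy.symm hxX)

theorem robust_of_pairwise (hle : C.graph ≤ F) {A : Finset V}
    (hA : ∀ a ∈ A, ∀ b ∈ A, a ≠ b → b ∈ C.adjLabels F a) : C.Robust F k A := by
  intro X _ S hS u v hu hv huX hvX huS
  by_cases huv : C.label u = C.label v
  · exact mem_of_same_label hle hS huv huX huS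
  · exact (mem_iff_of_adjLabels hle hS (hA _ hu _ hv huv) huX hvX).1 huS

/-- Fewer than `k` deleted vertices damage fewer than `k` paths, so `p` keeps an edge to some intact
path of `A`. -/
theorem Robust.insert (hle : C.graph ≤ F) {A : Finset V} (h : C.Robust F k A) {p : V}
    (hp : k ≤ (C.adjLabels F p ∩ A).card) : C.Robust F k (insert p A) := by
  intro X hX S hS u v hu hv huX hvX huS
  obtain ⟨a, ha, haX⟩ : ∃ a ∈ C.adjLabels F p ∩ A, a ∉ X.image C.label := by
    by_contra! hall
    have := (Finset.card_le_card hall).trans Finset.card_image_le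
    omega
  rw [Finset.mem_inter] at ha
  obtain ⟨-, -, w, -, hw, -⟩ := C.mem_adjLabels.1 ha.1
  subst hw
  have key : ∀ x, C.label x ∈ Insert.insert p A → C.label x ∉ X.image C.label →
      (x ∈ S ↔ w ∈ S) := by
    intro x hx hxX
    rw [Finset.mem_insert] at hx
    rcases hx with rfl | hx
    · exact mem_iff_of_adjLabels hle hS ha.1 hxX haX
    · exact ⟨h X hX S hS x w hx ha.2 hxX haX, h X hX S hS w x ha.2 hx haX hxX⟩
  exact (key v hv hvX).2 ((key u hu huX).1 huS)

/-- A graph that fits a path cover is `k`-connected as soon as its degrees are at least `k` and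
few deletions do not separate the intact paths. -/
theorem Fits.isKConnected [Nonempty V] (h : C.Fits F k M) (hk : ∀ v, k ≤ (nbrs F v).card)
    {A : Finset V} (hA : ∀ v, C.label v ∈ A) (hrob : C.Robust F k A) : IsKConnected k F := by
  -- No nonempty closed set can live entirely on damaged paths.
  have core : ∀ X : Finset V, X.card < k → ∀ S, IsClosedOff F X S → S.Nonempty →
      (∀ u ∈ S, C.label u ∈ X.image C.label) → False := by
    intro X hX S hS hne hhit
    have hXi : (X.image C.label).card ≤ X.card := Finset.card_image_le
    -- The neighbours of `u` on other paths lie on distinct paths, all damaged: such a neighbour is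
    -- either deleted or in `S`. The path of `u` itself is a further damaged one.
    have hflex : ∀ u ∈ S, (C.flex F u).card + 1 ≤ (X.image C.label).card := by
      intro u hu
      rw [← h.card_flex u, ← Finset.card_insert_of_notMem (a := C.label u)]
      · refine Finset.card_le_card fun a ha => ?_
        rw [Finset.mem_insert, Finset.mem_image] at ha
        rcases ha with rfl | ⟨w, hw, rfl⟩
        · exact hhit u hu
        · rw [mem_flex] at hw
          by_cases hwX : w ∈ X
          · exact Finset.mem_image_of_mem _ hwX
          · exact hhit w (hS.2 u hu w hw.1 hwX)
      · rw [Finset.mem_image]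
        rintro ⟨w, hw, hwl⟩
        exact (C.mem_flex.1 hw).2 hwl
    -- So `u` has at most `k - 2` neighbours on other paths. Degree `k` forces equality everywhere:
    -- `u` has both neighbours on its path, and no two deleted vertices share a path.
    have hcount : ∀ u ∈ S, 1 ≤ (Finset.univ.filter fun w => C.label w = C.label u ∧
          C.pos w = C.pos u + 1).card ∧
        1 ≤ (Finset.univ.filter fun w => C.label w = C.label u ∧ C.pos u = C.pos w + 1).card ∧
        X.card ≤ (X.image C.label).card := by
      intro u hu
      have h1 := card_nbrs_le_of h.internal u
      have h2 := hk u
      have h3 := hflex u hu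
      have h4 := C.card_up_le u
      have h5 := C.card_down_le u
      omega
    obtain ⟨u, hu⟩ := hne
    have hinj : Set.InjOn C.label X :=
      Finset.card_image_iff.1 (le_antisymm hXi (hcount u hu).2.2)
    obtain ⟨x, hxX, hxu⟩ := Finset.mem_image.1 (hhit u hu)
    have hpos : C.pos u ≠ C.pos x := fun he => by
      have := C.inj u x hxu.symm he
      exact hS.1 u hu (this ▸ hxX)
    classical
    -- The extreme vertex of `S` on this path, on the side away from its only deleted vertex `x`,
    -- still has a further neighbour there, and that neighbour must be in `S`.
    rcases lt_or_gt_of_ne hpos with hlt | hlt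
    · obtain ⟨t, ht, hmin⟩ := Finset.exists_min_image
        (Finset.univ.filter fun w => w ∈ S ∧ C.label w = C.label u) C.pos ⟨u, by simp [hu]⟩
      simp only [Finset.mem_filter, Finset.mem_univ, true_and] at ht hmin
      obtain ⟨w, hw⟩ := Finset.card_pos.1 (hcount t ht.1).2.1
      simp only [Finset.mem_filter, Finset.mem_univ, true_and] at hw
      have hadj : F.Adj t w := h.le ⟨hw.1.symm, Or.inr hw.2⟩
      have h1 := hmin u ⟨hu, rfl⟩
      by_cases hwX : w ∈ X
      · have : w = x := hinj hwX hxX (by rw [hw.1, ht.2, hxu])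
        subst this
        omega
      · have := hmin w ⟨hS.2 t ht.1 w hadj hwX, hw.1.trans ht.2⟩
        omega
    · obtain ⟨t, ht, hmax⟩ := Finset.exists_max_image
        (Finset.univ.filter fun w => w ∈ S ∧ C.label w = C.label u) C.pos ⟨u, by simp [hu]⟩
      simp only [Finset.mem_filter, Finset.mem_univ, true_and] at ht hmax
      obtain ⟨w, hw⟩ := Finset.card_pos.1 (hcount t ht.1).1
      simp only [Finset.mem_filter, Finset.mem_univ, true_and] at hw
      have hadj : F.Adj t w := h.le ⟨hw.1.symm, Or.inl hw.2⟩
      have h1 := hmax u ⟨hu, rfl⟩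
      by_cases hwX : w ∈ X
      · have : w = x := hinj hwX hxX (by rw [hw.1, ht.2, hxu])
        subst this
        omega
      · have := hmax w ⟨hS.2 t ht.1 w hadj hwX, hw.1.trans ht.2⟩
        omega
  refine isKConnected_of_closed ?_ fun X hX S hS hne v hv => ?_
  · obtain ⟨v⟩ := ‹Nonempty V›
    have hvn : v ∉ nbrs F v := by simp [mem_nbrs]
    have := Finset.card_le_univ (insert v (nbrs F v))
    rw [Finset.card_insert_of_notMem hvn] at this
    have := hk v
    omega
  · by_contra hvS
    -- If `S` meets an intact path, robustness puts all intact paths into `S`, and the complement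
    -- lives on damaged paths. Otherwise `S` itself does.
    by_cases h1 : ∃ u ∈ S, C.label u ∉ X.image C.label
    · obtain ⟨u, hu, huX⟩ := h1
      refine core X hX _ hS.compl ⟨v, hv, hvS⟩ fun w hw => ?_
      by_contra hwX
      exact hw.2 (hrob X hX S hS u w (hA u) (hA w) huX hwX hu)
    · push Not at h1
      exact core X hX S hS hne h1

end PathCover

end PathCovers

/-! ### Attaching paths and raising degrees to `k`. -/

section Attaching

set_option linter.unusedSectionVars false

variable {V : Type*} [Fintype V] [DecidableEq V]

theorem le_addPair (F : SimpleGraph V) (x : V × V) : F ≤ addPair F x := le_sup_left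

theorem nbrs_mono {F F' : SimpleGraph V} (h : F ≤ F') (v : V) : nbrs F v ⊆ nbrs F' v :=
  fun _ hw => mem_nbrs.2 (h (mem_nbrs.1 hw))

theorem card_nbrs_addPair {F : SimpleGraph V} {a b : V} (hab : a ≠ b) (hF : ¬ F.Adj a b) (v : V) :
    (nbrs (addPair F (a, b)) v).card = (nbrs F v).card + if v = a ∨ v = b then 1 else 0 := by
  have hmem : ∀ v w, w ∈ nbrs (addPair F (a, b)) v ↔
      w ∈ nbrs F v ∨ (v = a ∧ w = b) ∨ (v = b ∧ w = a) := by
    intro v w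
    rw [mem_nbrs, mem_nbrs, addPair_adj (x := (a, b)) hab]
  by_cases h1 : v = a
  · subst h1
    have : nbrs (addPair F (v, b)) v = insert b (nbrs F v) := by
      ext w
      rw [hmem, Finset.mem_insert]
      constructor
      · rintro (h | h | h)
        · exact Or.inr h
        · exact Or.inl h.2
        · exact absurd h.1 hab
      · rintro (h | h)
        · exact Or.inr (Or.inl ⟨rfl, h⟩)
        · exact Or.inl h
    rw [this, Finset.card_insert_of_notMem (by rwa [mem_nbrs])]
    simp
  · by_cases h2 : v = b
    · subst h2
      have : nbrs (addPair F (a, v)) v = insert a (nbrs F v) := by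
        ext w
        rw [hmem, Finset.mem_insert]
        constructor
        · rintro (h | h | h)
          · exact Or.inr h
          · exact absurd h.1 h1
          · exact Or.inl h.2
        · rintro (h | h)
          · exact Or.inr (Or.inr ⟨rfl, h⟩)
          · exact Or.inl h
      rw [this, Finset.card_insert_of_notMem (by rw [mem_nbrs]; exact fun h => hF h.symm)]
      simp
    · rw [if_neg (by tauto), add_zero]
      congr 1
      ext w
      rw [hmem]
      tauto

theorem sum_add_pair {f f' : V → ℕ} {a b : V} (hab : a ≠ b) (h : ∀ v, v ≠ a → v ≠ b → f' v = f v) :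
    ∑ v, f' v + (f a + f b) = ∑ v, f v + (f' a + f' b) := by
  have hs : ∀ f : V → ℕ, ∑ v, f v = f a + (f b + ∑ v ∈ (Finset.univ.erase a).erase b, f v) := by
    intro f
    rw [Finset.add_sum_erase _ _ (by simp [hab.symm]), Finset.add_sum_erase _ _ (by simp)]
  rw [hs f, hs f', Finset.sum_congr rfl fun v hv => h v
    (by simp only [Finset.mem_erase] at hv; exact hv.2.1)
    (by simp only [Finset.mem_erase] at hv; exact hv.1)]
  ring

/-- The total number of edge ends that are missing for all degrees to be at least `k`. -/
noncomputable def deficit (F : SimpleGraph V) (k : ℕ) : ℕ := ∑ v, (k - (nbrs F v).card)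

/-- The number of vertices of degree more than `k`. -/
noncomputable def excess (F : SimpleGraph V) (k : ℕ) : ℕ :=
  (Finset.univ.filter fun v => k < (nbrs F v).card).card

theorem excess_eq_sum (F : SimpleGraph V) (k : ℕ) :
    excess F k = ∑ v, if k < (nbrs F v).card then 1 else 0 := by
  rw [excess, Finset.card_filter]

theorem deficit_anti {F F' : SimpleGraph V} (h : F ≤ F') (k : ℕ) : deficit F' k ≤ deficit F k :=
  Finset.sum_le_sum fun v _ => Nat.sub_le_sub_left (Finset.card_le_card (nbrs_mono h v)) k

theorem deficit_addPair_lt {F : SimpleGraph V} {k : ℕ} {a b : V} (hab : a ≠ b)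
    (hF : ¬ F.Adj a b) (ha : (nbrs F a).card < k) :
    deficit (addPair F (a, b)) k < deficit F k := by
  refine Finset.sum_lt_sum (fun v _ => Nat.sub_le_sub_left (Finset.card_le_card
    (nbrs_mono (le_addPair F _) v)) k) ⟨a, Finset.mem_univ a, ?_⟩
  rw [card_nbrs_addPair hab hF, if_pos (Or.inl rfl)]
  omega

/-- The deficit drops by one at `a`. At `b` either it drops as well, or the excess rises by one. -/
theorem excess_add_deficit_addPair {F : SimpleGraph V} {k : ℕ} {a b : V} (hab : a ≠ b)
    (hF : ¬ F.Adj a b) (ha : (nbrs F a).card < k) (hb : (nbrs F b).card ≤ k) :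
    excess (addPair F (a, b)) k + deficit (addPair F (a, b)) k ≤ excess F k + deficit F k := by
  rw [excess_eq_sum, excess_eq_sum, deficit, deficit, ← Finset.sum_add_distrib,
    ← Finset.sum_add_distrib]
  have h := sum_add_pair (f := fun v => (if k < (nbrs F v).card then 1 else 0) +
      (k - (nbrs F v).card)) (f' := fun v => (if k < (nbrs (addPair F (a, b)) v).card then 1 else 0)
      + (k - (nbrs (addPair F (a, b)) v).card)) hab (fun v h1 h2 => by
        simp only [card_nbrs_addPair hab hF v, if_neg (show ¬ (v = a ∨ v = b) by tauto), add_zero])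
  simp only [card_nbrs_addPair hab hF a, card_nbrs_addPair hab hF b, true_or, or_true,
    if_true] at h
  split_ifs at h <;> omega

theorem excess_addPair_le {F : SimpleGraph V} {k : ℕ} {a b : V} (hab : a ≠ b)
    (hF : ¬ F.Adj a b) (ha : (nbrs F a).card < k) (hb : (nbrs F b).card < k) :
    excess (addPair F (a, b)) k ≤ excess F k := by
  refine Finset.card_le_card fun v hv => ?_
  simp only [Finset.mem_filter, Finset.mem_univ, true_and, card_nbrs_addPair hab hF] at hv ⊢
  split_ifs at hv with h
  · rcases h with rfl | rfl <;> omega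
  · exact hv

/-- This caps the number of rounds that add an edge; the overhead above `n * k / 2` is half the
excess. -/
theorem two_mul_ncard_edgeSet_le {F : SimpleGraph V} {k : ℕ}
    (h : ∀ v, (nbrs F v).card ≤ k + 1) :
    2 * F.edgeSet.ncard ≤ Fintype.card V * k + excess F k := by
  rw [← sum_card_nbrs, excess_eq_sum, ← smul_eq_mul, ← Finset.card_univ, ← Finset.sum_const,
    ← Finset.sum_add_distrib]
  refine Finset.sum_le_sum fun v _ => ?_
  have := h v
  split_ifs <;> omega

theorem le_two_mul_ncard_edgeSet (F : SimpleGraph V) (k : ℕ) :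
    Fintype.card V * k ≤ 2 * F.edgeSet.ncard + deficit F k := by
  rw [← sum_card_nbrs, deficit, ← smul_eq_mul, ← Finset.card_univ, ← Finset.sum_const,
    ← Finset.sum_add_distrib]
  exact Finset.sum_le_sum fun v _ => by omega

theorem mul_le_card_pairs {S : Finset (V × V)} {D : Finset V} {m : ℕ}
    (h : ∀ a ∈ D, ∃ E : Finset V, m ≤ E.card ∧ ∀ b ∈ E, (a, b) ∈ S) : D.card * m ≤ S.card := by
  choose! E hE hES using h
  have hsub : (D.sigma E).card ≤ S.card := by
    refine Finset.card_le_card_of_injOn (fun x => (x.1, x.2)) ?_ ?_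
    · rintro ⟨a, b⟩ hx
      simp only [Finset.mem_coe, Finset.mem_sigma] at hx
      exact hES a hx.1 b hx.2
    · rintro ⟨a, b⟩ _ ⟨a', b'⟩ _ hx
      simp only [Prod.mk.injEq] at hx
      rw [hx.1, hx.2]
  rw [Finset.card_sigma] at hsub
  refine le_trans ?_ hsub
  rw [← smul_eq_mul]
  exact Finset.card_nsmul_le_sum _ _ _ fun a ha => hE a ha

namespace PathCover

variable {C : PathCover V} {F : SimpleGraph V} {k M : ℕ} {A : Finset V}

theorem Fits.addPair (h : C.Fits F k M) {a b : V} (hab : C.label a ≠ C.label b)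
    (h1 : ∀ w, F.Adj a w → C.label w ≠ C.label b) (h2 : ∀ w, F.Adj b w → C.label w ≠ C.label a)
    (ha : (nbrs F a).card ≤ k) (hb : (nbrs F b).card ≤ k) :
    C.Fits (addPair F (a, b)) k M := by
  have hne : a ≠ b := fun h => hab (by rw [h])
  have hF : ¬ F.Adj a b := fun h => h1 b h rfl
  have hadj : ∀ u v, (USTSR.addPair F (a, b)).Adj u v ↔
    F.Adj u v ∨ (u = a ∧ v = b) ∨ (u = b ∧ v = a) := fun u v => addPair_adj (x := (a, b)) hne
  refine ⟨h.le.trans (le_addPair _ _), fun u v huv hl => ?_, fun u v w huv huw hvw hvu => ?_,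
    h.small, fun v => ?_⟩
  · rcases (hadj u v).1 huv with h' | ⟨rfl, rfl⟩ | ⟨rfl, rfl⟩
    · exact h.internal u v h' hl
    · exact absurd hl hab
    · exact absurd hl.symm hab
  · rcases (hadj u v).1 huv with h' | ⟨rfl, rfl⟩ | ⟨rfl, rfl⟩ <;>
    rcases (hadj u w).1 huw with h'' | ⟨h3, rfl⟩ | ⟨h3, rfl⟩
    · exact h.distinct u v w h' h'' hvw hvu
    · subst h3; exact absurd hvw (h1 v h')
    · subst h3; exact absurd hvw (h2 v h')
    · exact absurd hvw.symm (h1 w h'')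
    · rfl
    · exact absurd h3 hne
    · exact absurd hvw.symm (h2 w h'')
    · exact absurd h3.symm hne
    · rfl
  · rw [card_nbrs_addPair hne hF]
    split_ifs with hv
    · rcases hv with rfl | rfl <;> omega
    · simpa using h.deg v

theorem adjLabels_mono {F' : SimpleGraph V} (h : F ≤ F') (p : V) :
    C.adjLabels F p ⊆ C.adjLabels F' p := by
  intro a ha
  rw [mem_adjLabels] at ha ⊢
  obtain ⟨hne, u, w, hu, hw, hadj⟩ := ha
  exact ⟨hne, u, w, hu, hw, h hadj⟩

theorem card_flex_addPair {a b : V} (hab : C.label a ≠ C.label b) (hF : ¬ F.Adj a b) (v : V) :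
    (C.flex (USTSR.addPair F (a, b)) v).card =
      (C.flex F v).card + if v = a ∨ v = b then 1 else 0 := by
  have hne : a ≠ b := fun h => hab (by rw [h])
  have hs : ∀ F : SimpleGraph V, (nbrs F v).card = (C.flex F v).card +
      ((nbrs F v).filter fun w => ¬ C.label w ≠ C.label v).card := fun F =>
    (Finset.card_filter_add_card_filter_not (s := nbrs F v)
      (fun w => C.label w ≠ C.label v)).symm
  have h1 := card_nbrs_addPair hne hF v
  rw [hs, hs F] at h1
  have h2 : ((nbrs (USTSR.addPair F (a, b)) v).filter fun w => ¬ C.label w ≠ C.label v) =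
      (nbrs F v).filter fun w => ¬ C.label w ≠ C.label v := by
    ext w
    simp only [Finset.mem_filter, mem_nbrs, not_not, addPair_adj (x := (a, b)) hne]
    constructor
    · rintro ⟨h | ⟨rfl, rfl⟩ | ⟨rfl, rfl⟩, hl⟩
      · exact ⟨h, hl⟩
      · exact absurd hl.symm hab
      · exact absurd hl hab
    · exact fun h => ⟨Or.inl h.1, h.2⟩
  rw [h2] at h1
  omega

variable (C F) in
/-- The number of pairs `(v, w)` such that `w` is a neighbour of `v` on another path. -/
noncomputable def flexSum : ℕ := ∑ v, (C.flex F v).card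

theorem flexSum_addPair {a b : V} (hab : C.label a ≠ C.label b) (hF : ¬ F.Adj a b) :
    C.flexSum (USTSR.addPair F (a, b)) = C.flexSum F + 2 := by
  have h := sum_add_pair (f := fun v => (C.flex F v).card)
    (f' := fun v => (C.flex (USTSR.addPair F (a, b)) v).card)
    (fun h => hab (by rw [h]) : a ≠ b) (fun v h1 h2 => by
      simp only [card_flex_addPair hab hF v, if_neg (show ¬ (v = a ∨ v = b) by tauto), add_zero])
  simp only [card_flex_addPair hab hF, true_or, or_true, if_true] at h
  simp only [flexSum, card_flex_addPair hab hF]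
  omega

/-- A vertex of degree above `k` has at most two neighbours on its path, hence at least `k - 1` on
others. -/
theorem Fits.mul_excess_le (h : C.Fits F k M) : (k - 1) * excess F k ≤ C.flexSum F := by
  rw [excess_eq_sum, flexSum, Finset.mul_sum]
  refine Finset.sum_le_sum fun v _ => ?_
  have := card_nbrs_le_two_add h.internal v
  split_ifs <;> omega

variable (C) in
/-- The labels in use. -/
def labels : Finset V := Finset.univ.image C.label

variable (C) in
/-- The number of vertices with labels in `A`. -/
def mass (A : Finset V) : ℕ := (Finset.univ.filter fun v => C.label v ∈ A).card

variable (C F k M A) in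
/-- The path cover fits, the paths with labels in `A` are robustly connected, and every other
path has enough free edge ends to be attached to `k` of them. -/
structure Inv : Prop where
  fits : C.Fits F k M
  robust : C.Robust F k A
  supply : ∀ v, C.label v ∉ A → k ≤ (C.adjLabels F (C.label v) ∩ A).card +
    ∑ u ∈ C.piece (C.label v), (k - (nbrs F u).card)

variable (C F k A) in
/-- The number of edges needed to attach all paths. -/
noncomputable def need : ℕ := ∑ p ∈ C.labels \ A, (k - (C.adjLabels F p ∩ A).card)

variable (C F k A) in
/-- No further path is attached to `k` of the paths with labels in `A`. -/
def IsMaximal : Prop := ∀ p ∈ C.labels \ A, (C.adjLabels F p ∩ A).card < k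

/-- Absorb paths with `k` neighbouring paths in `A` until none is left. Enlarging `A` preserves the
invariant by `Robust.insert` and can only reduce what is still needed. -/
theorem Inv.exists_maximal (h : C.Inv F k M A) :
    ∃ A', A ⊆ A' ∧ C.Inv F k M A' ∧ C.need F k A' ≤ C.need F k A ∧ C.IsMaximal F k A' := by
  induction hm : (C.labels \ A).card using Nat.strong_induction_on generalizing A with
  | _ m ih =>
    by_cases hmax : C.IsMaximal F k A
    · exact ⟨A, subset_rfl, h, le_rfl, hmax⟩
    · simp only [IsMaximal, not_forall, not_lt] at hmax
      obtain ⟨p, hp, hpk⟩ := hmax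
      have hp' := Finset.mem_sdiff.1 hp
      have hsub : C.labels \ insert p A ⊆ C.labels \ A :=
        Finset.sdiff_subset_sdiff subset_rfl (Finset.subset_insert p A)
      have hlt : (C.labels \ insert p A).card < m := by
        rw [← hm]
        refine Finset.card_lt_card ⟨hsub, fun hc => ?_⟩
        exact (Finset.mem_sdiff.1 (hc hp)).2 (Finset.mem_insert_self p A)
      have hinter : ∀ r, (C.adjLabels F r ∩ A).card ≤ (C.adjLabels F r ∩ insert p A).card :=
        fun r => Finset.card_le_card
          (Finset.inter_subset_inter subset_rfl (Finset.subset_insert p A))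
      have hinv : C.Inv F k M (insert p A) := by
        refine ⟨h.fits, h.robust.insert h.fits.le hpk, fun v hv => ?_⟩
        rw [Finset.mem_insert, not_or] at hv
        exact (h.supply v hv.2).trans (Nat.add_le_add_right (hinter _) _)
      obtain ⟨A', h1, h2, h3, h4⟩ := ih _ hlt hinv rfl
      refine ⟨A', (Finset.subset_insert p A).trans h1, h2, h3.trans ?_, h4⟩
      exact (Finset.sum_le_sum fun r _ => Nat.sub_le_sub_left (hinter r) k).trans
        (Finset.sum_le_sum_of_subset hsub)

variable (C F k A) in
/-- The edge `ab` may be added, to raise the degree of `a` which is less than `k`. -/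
structure CanJoin (a b : V) : Prop where
  label_ne : C.label a ≠ C.label b
  left : ∀ w, F.Adj a w → C.label w ≠ C.label b
  right : ∀ w, F.Adj b w → C.label w ≠ C.label a
  deg_left : (nbrs F a).card < k
  deg_right : (nbrs F b).card ≤ k
  mem : C.label b ∈ A
  fresh : C.label a ∉ A → C.label b ∉ C.adjLabels F (C.label a)

theorem CanJoin.ne {a b : V} (h : C.CanJoin F k A a b) : a ≠ b := fun hab =>
  h.label_ne (by rw [hab])

theorem CanJoin.not_adj {a b : V} (h : C.CanJoin F k A a b) : ¬ F.Adj a b := fun hab =>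
  h.left b hab rfl

/-- If `a` is on an unattached path, the free edge end used at `a` is compensated by a new adjacent
path of `A`; this is what `fresh` ensures. Free ends on other unattached paths are untouched, since
`b` lies on an attached path. -/
theorem Inv.addPair (h : C.Inv F k M A) {a b : V} (hj : C.CanJoin F k A a b) :
    C.Inv (addPair F (a, b)) k M A := by
  have hF := hj.not_adj
  refine ⟨h.fits.addPair hj.label_ne hj.left hj.right hj.deg_left.le hj.deg_right,
    h.robust.mono (le_addPair _ _), fun v hv => ?_⟩
  have hs := h.supply v hv
  have hmono := adjLabels_mono (C := C) (le_addPair F (a, b)) (C.label v)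
  by_cases hva : C.label v = C.label a
  · have hfresh := hj.fresh (hva ▸ hv)
    rw [← hva] at hfresh
    have h1 : (C.adjLabels F (C.label v) ∩ A).card + 1 ≤
        (C.adjLabels (USTSR.addPair F (a, b)) (C.label v) ∩ A).card := by
      rw [← Finset.card_insert_of_notMem (a := C.label b)
        (fun hm => hfresh (Finset.mem_inter.1 hm).1)]
      refine Finset.card_le_card fun p hp => ?_
      rcases Finset.mem_insert.1 hp with rfl | hp
      · refine Finset.mem_inter.2 ⟨C.mem_adjLabels.2 ⟨?_, a, b, hva.symm, rfl, ?_⟩, hj.mem⟩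
        · rw [hva]; exact hj.label_ne.symm
        · exact (addPair_adj (x := (a, b)) hj.ne).2 (Or.inr (Or.inl ⟨rfl, rfl⟩))
      · exact Finset.mem_inter.2 ⟨hmono (Finset.mem_inter.1 hp).1, (Finset.mem_inter.1 hp).2⟩
    have h2 : ∑ u ∈ C.piece (C.label v), (k - (nbrs F u).card) ≤
        ∑ u ∈ C.piece (C.label v), ((k - (nbrs (USTSR.addPair F (a, b)) u).card) +
          if u = a then 1 else 0) := by
      refine Finset.sum_le_sum fun u hu => ?_
      have hub : u ≠ b := fun hub => hj.label_ne (by rw [← hva, ← hub, C.mem_piece.1 hu])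
      rw [card_nbrs_addPair hj.ne hF]
      by_cases hua : u = a
      · simp only [hua, true_or, if_true]; omega
      · simp [hua, hub]
    rw [Finset.sum_add_distrib, Finset.sum_ite_eq' _ _ (fun _ => 1)] at h2
    have h3 : (if a ∈ C.piece (C.label v) then 1 else 0) ≤ 1 := by split_ifs <;> omega
    omega
  · have h1 : (C.adjLabels F (C.label v) ∩ A).card ≤
        (C.adjLabels (USTSR.addPair F (a, b)) (C.label v) ∩ A).card :=
      Finset.card_le_card (Finset.inter_subset_inter hmono subset_rfl)
    have h2 : ∑ u ∈ C.piece (C.label v), (k - (nbrs (USTSR.addPair F (a, b)) u).card) =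
        ∑ u ∈ C.piece (C.label v), (k - (nbrs F u).card) := by
      refine Finset.sum_congr rfl fun u hu => ?_
      rw [mem_piece] at hu
      have hua : u ≠ a := fun h => hva (by rw [← hu, h])
      have hub : u ≠ b := fun h => hv (by rw [← hu, h]; exact hj.mem)
      rw [card_nbrs_addPair hj.ne hF, if_neg (by tauto), add_zero]
    omega

theorem need_addPair_lt (hmax : C.IsMaximal F k A) {a b : V} (hj : C.CanJoin F k A a b)
    (ha : C.label a ∉ A) : C.need (USTSR.addPair F (a, b)) k A < C.need F k A := by
  have hmono := fun p => adjLabels_mono (C := C) (le_addPair F (a, b)) p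
  have hmem : C.label a ∈ C.labels \ A :=
    Finset.mem_sdiff.2 ⟨Finset.mem_image_of_mem _ (Finset.mem_univ a), ha⟩
  refine Finset.sum_lt_sum (fun p _ => Nat.sub_le_sub_left (Finset.card_le_card
    (Finset.inter_subset_inter (hmono p) subset_rfl)) k) ⟨C.label a, hmem, ?_⟩
  have hlt := hmax _ hmem
  have : (C.adjLabels F (C.label a) ∩ A).card <
      (C.adjLabels (USTSR.addPair F (a, b)) (C.label a) ∩ A).card := by
    refine Finset.card_lt_card ⟨Finset.inter_subset_inter (hmono _) subset_rfl, fun hc => ?_⟩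
    refine hj.fresh ha (Finset.mem_inter.1 (hc (Finset.mem_inter.2 ⟨C.mem_adjLabels.2
      ⟨hj.label_ne.symm, a, b, rfl, rfl, ?_⟩, hj.mem⟩))).1
    exact (addPair_adj (x := (a, b)) hj.ne).2 (Or.inr (Or.inl ⟨rfl, rfl⟩))
  omega

open Classical in
/-- A vertex of degree less than `k` can be joined to almost all attached vertices of degree at
most `k`. -/
theorem Inv.card_le_canJoin (h : C.Inv F k M A) (hmax : C.IsMaximal F k A) {a : V}
    (ha : (nbrs F a).card < k) (D : Finset V)
    (hD : ∀ b ∈ D, C.label b ∈ A ∧ (nbrs F b).card ≤ k) :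
    D.card ≤ (D.filter fun b => C.CanJoin F k A a b).card + (3 * k + 2) * M := by
  have hsmall := h.fits.small
  -- The obstructions to joining `a` and `b`: `b` is on the path of `a`; `a` has a neighbour on the
  -- path of `b`; `b` has a neighbour on the path of `a`; the two paths are already adjacent while
  -- that of `a` is unattached.
  let W1 := C.piece (C.label a)
  let W2 := Finset.univ.filter fun b => C.label b ∈ (C.flex F a).image C.label
  let W3 := (C.piece (C.label a)).biUnion (C.flex F)
  let W4 := Finset.univ.filter fun b => C.label b ∈
    if C.label a ∈ A then ∅ else C.adjLabels F (C.label a) ∩ A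
  have hsub : D ⊆ (D.filter fun b => C.CanJoin F k A a b) ∪ (W1 ∪ W2 ∪ W3 ∪ W4) := by
    intro b hb
    by_cases hj : C.CanJoin F k A a b
    · exact Finset.mem_union_left _ (Finset.mem_filter.2 ⟨hb, hj⟩)
    · refine Finset.mem_union_right _ ?_
      by_contra hW
      simp only [Finset.mem_union, not_or] at hW
      obtain ⟨⟨⟨hW1, hW2⟩, hW3⟩, hW4⟩ := hW
      have hne : C.label a ≠ C.label b := fun he => hW1 (C.mem_piece.2 he.symm)
      refine hj ⟨hne, fun w hw hl => hW2 ?_, fun w hw hl => hW3 ?_, ha, (hD b hb).2, (hD b hb).1,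
        fun haA hfr => hW4 ?_⟩
      · simp only [W2, Finset.mem_filter, Finset.mem_univ, true_and, Finset.mem_image, mem_flex]
        exact ⟨w, ⟨hw, by rw [hl]; exact hne.symm⟩, hl⟩
      · simp only [W3, Finset.mem_biUnion, mem_piece, mem_flex]
        exact ⟨w, hl, hw.symm, by rw [hl]; exact hne.symm⟩
      · simp only [W4, Finset.mem_filter, Finset.mem_univ, true_and, if_neg haA]
        exact Finset.mem_inter.2 ⟨hfr, (hD b hb).1⟩
  have hflex : ∀ u, (C.flex F u).card ≤ (nbrs F u).card := fun u => Finset.card_filter_le _ _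
  have h1 : W1.card ≤ M := C.card_piece_le hsmall _
  have h2 : W2.card ≤ k * M := (C.card_labelled_le hsmall _).trans
    (Nat.mul_le_mul_right _ (Finset.card_image_le.trans ((hflex a).trans ha.le)))
  have h3 : W3.card ≤ M * (k + 1) := (Finset.card_biUnion_le_card_mul _ _ (k + 1)
    fun u _ => (hflex u).trans (h.fits.deg u)).trans
      (Nat.mul_le_mul_right _ (C.card_piece_le hsmall _))
  have h4 : W4.card ≤ k * M := by
    refine (C.card_labelled_le hsmall _).trans (Nat.mul_le_mul_right _ ?_)
    split_ifs with haA
    · simp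
    · exact (hmax _ (Finset.mem_sdiff.2
        ⟨Finset.mem_image_of_mem _ (Finset.mem_univ a), haA⟩)).le
  have h5 := Finset.card_le_card hsub
  have h6 := Finset.card_union_le (D.filter fun b => C.CanJoin F k A a b) (W1 ∪ W2 ∪ W3 ∪ W4)
  have h7 := Finset.card_union_le (W1 ∪ W2 ∪ W3) W4
  have h8 := Finset.card_union_le (W1 ∪ W2) W3
  have h9 := Finset.card_union_le W1 W2
  have h10 : M + k * M + M * (k + 1) + k * M = (3 * k + 2) * M := by ring
  omega

/-- Without free edge ends, the supply condition would give `k` adjacent paths in `A`, against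
maximality. -/
theorem Inv.exists_deficient (h : C.Inv F k M A) (hmax : C.IsMaximal F k A) {p : V}
    (hp : p ∈ C.labels \ A) : ∃ a, C.label a = p ∧ (nbrs F a).card < k := by
  rw [Finset.mem_sdiff] at hp
  obtain ⟨v, -, rfl⟩ := Finset.mem_image.1 hp.1
  have h1 := h.supply v hp.2
  have h2 := hmax _ (Finset.mem_sdiff.2 hp)
  by_contra! hall
  rw [Finset.sum_eq_zero fun u hu => Nat.sub_eq_zero_of_le (hall u (C.mem_piece.1 hu))] at h1
  omega

theorem Inv.card_le_mass_add (h : C.Inv F k M A) :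
    Fintype.card V ≤ C.mass A + (C.labels \ A).card * M := by
  have h1 := Finset.card_filter_add_card_filter_not (s := (Finset.univ : Finset V))
    (fun v => C.label v ∈ A)
  rw [Finset.card_univ] at h1
  have h2 : (Finset.univ.filter fun v => ¬ C.label v ∈ A).card ≤ (C.labels \ A).card * M := by
    refine (Finset.card_le_card fun v hv => ?_).trans (C.card_labelled_le h.fits.small _)
    simp only [Finset.mem_filter, Finset.mem_univ, true_and] at hv ⊢
    exact Finset.mem_sdiff.2 ⟨Finset.mem_image_of_mem _ (Finset.mem_univ v), hv⟩
  rw [mass]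
  omega

theorem card_filter_deg_le (F : SimpleGraph V) (k : ℕ) (A : Finset V) :
    C.mass A ≤ (Finset.univ.filter fun b => C.label b ∈ A ∧ (nbrs F b).card ≤ k).card +
      excess F k := by
  refine (Finset.card_le_card (t := (Finset.univ.filter fun b =>
    C.label b ∈ A ∧ (nbrs F b).card ≤ k) ∪ Finset.univ.filter fun v => k < (nbrs F v).card)
    fun v hv => ?_).trans (Finset.card_union_le _ _)
  simp only [Finset.mem_filter, Finset.mem_univ, true_and, Finset.mem_union] at hv ⊢
  by_cases hk : (nbrs F v).card ≤ k
  · exact Or.inl ⟨hv, hk⟩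
  · exact Or.inr (not_le.1 hk)

end PathCover

open PathCover

/-- At least `L` ordered pairs of non-adjacent vertices can each be joined within `P`. -/
def HasMoves (F : SimpleGraph V) (P : SimpleGraph V → Prop) (L : ℕ) : Prop :=
  ∃ S : Finset (V × V), L ≤ S.card ∧
    ∀ x ∈ S, x.1 ≠ x.2 ∧ ¬ F.Adj x.1 x.2 ∧ P (addPair F x)

/-- Some vertex can be joined within `P` to all but `w` vertices, decreasing the deficit. -/
def HasStar (F : SimpleGraph V) (k : ℕ) (P : SimpleGraph V → Prop) (w : ℕ) : Prop :=
  ∃ (S : Finset (V × V)) (a : V) (W : Finset V), W.card ≤ w ∧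
    (∀ b, b ≠ a → b ∉ W → (a, b) ∈ S) ∧
    ∀ x ∈ S, x.1 ≠ x.2 ∧ ¬ F.Adj x.1 x.2 ∧ P (addPair F x) ∧
      deficit (addPair F x) k < deficit F k

/-- The states in which paths are attached to the robustly connected part. -/
def AttachState (k M B m : ℕ) (F : SimpleGraph V) : Prop :=
  ∃ (C : PathCover V) (A : Finset V), C.Inv F k M A ∧ C.flexSum F + 2 * C.need F k A ≤ B ∧
    m ≤ C.mass A

/-- The states in which attached vertices of degree less than `k` are joined. -/
def FillState (k M q X : ℕ) (F : SimpleGraph V) : Prop :=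
  ∃ (C : PathCover V) (A : Finset V), C.Inv F k M A ∧ (C.labels \ A).card < q ∧ excess F k ≤ X

/-- The states in which the last vertices of degree less than `k` are joined to arbitrary
vertices. -/
def FinalState (k M q X : ℕ) (F : SimpleGraph V) : Prop :=
  ∃ (C : PathCover V) (A : Finset V), C.Inv F k M A ∧ (C.labels \ A).card < q ∧
    excess F k + deficit F k ≤ X

/-- Each attaching edge adds `2` to `flexSum` and lowers `need` by at least `1`, so their
combination stays within the budget `B`. The budget also bounds the number of vertices of degree `k
+ 1`, which leaves many possible ends `b`. -/
theorem AttachState.step {k M B m q X L : ℕ} {F : SimpleGraph V} (h : AttachState k M B m F)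
    (hk : 2 ≤ k) (hB : B ≤ (k - 1) * X)
    (hL : ∀ u mass, q ≤ u → m ≤ mass → Fintype.card V ≤ mass + u * M →
      L ≤ u * (mass - X - (3 * k + 2) * M)) :
    HasMoves F (AttachState k M B m) L ∨ FillState k M q X F := by
  classical
  obtain ⟨C, A₀, hinv₀, hflex₀, hm₀⟩ := h
  obtain ⟨A, hA, hinv, hneed, hmax⟩ := hinv₀.exists_maximal
  have hflex : C.flexSum F + 2 * C.need F k A ≤ B := by omega
  have hm : m ≤ C.mass A := hm₀.trans (Finset.card_le_card fun v hv => by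
    simp only [Finset.mem_filter, Finset.mem_univ, true_and] at hv ⊢
    exact hA hv)
  have hX : excess F k ≤ X := by
    have h1 := hinv.fits.mul_excess_le
    have h2 : (k - 1) * excess F k ≤ (k - 1) * X := by omega
    exact Nat.le_of_mul_le_mul_left h2 (by omega)
  by_cases hq : (C.labels \ A).card < q
  · exact Or.inr ⟨C, A, hinv, hq, hX⟩
  · left
    refine ⟨Finset.univ.filter fun x => C.label x.1 ∉ A ∧ C.CanJoin F k A x.1 x.2, ?_, ?_⟩
    · refine (hL _ _ (not_lt.1 hq) hm hinv.card_le_mass_add).trans ?_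
      -- One deficient vertex from each unattached path already gives enough pairs.
      have hdef : ∀ p : V, ∃ a, p ∈ C.labels \ A → C.label a = p ∧ (nbrs F a).card < k := by
        intro p
        by_cases hp : p ∈ C.labels \ A
        · obtain ⟨a, ha⟩ := hinv.exists_deficient hmax hp
          exact ⟨a, fun _ => ha⟩
        · exact ⟨p, fun h => absurd h hp⟩
      choose d hd using hdef
      have hinj : Set.InjOn d (C.labels \ A : Finset V) := by
        intro p hp r hr hpr
        rw [← (hd p hp).1, ← (hd r hr).1, hpr]
      rw [← Finset.card_image_of_injOn hinj]
      refine mul_le_card_pairs fun a ha => ?_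
      obtain ⟨p, hp, rfl⟩ := Finset.mem_image.1 ha
      have h1 := hinv.card_le_canJoin hmax (hd p hp).2
        (Finset.univ.filter fun b => C.label b ∈ A ∧ (nbrs F b).card ≤ k)
        (fun b hb => (Finset.mem_filter.1 hb).2)
      have h2 := card_filter_deg_le (C := C) F k A
      refine ⟨(Finset.univ.filter fun b => C.label b ∈ A ∧ (nbrs F b).card ≤ k).filter
        fun b => C.CanJoin F k A (d p) b, ?_, fun b hb => ?_⟩
      · omega
      · simp only [Finset.mem_filter, Finset.mem_univ, true_and] at hb ⊢
        exact ⟨by rw [(hd p hp).1]; exact (Finset.mem_sdiff.1 hp).2, hb.2⟩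
    · rintro ⟨a, b⟩ hx
      simp only [Finset.mem_filter, Finset.mem_univ, true_and] at hx
      obtain ⟨ha, hj⟩ := hx
      refine ⟨hj.ne, hj.not_adj, C, A, hinv.addPair hj, ?_, hm⟩
      rw [flexSum_addPair hj.label_ne hj.not_adj]
      have := need_addPair_lt hmax hj ha
      omega

/-- While many attached vertices are deficient, they are joined to each other, so no degree exceeds
`k` anew and the excess does not grow. -/
theorem FillState.step {k M q X X' D L : ℕ} {F : SimpleGraph V} (h : FillState k M q X F)
    (hX : X + k * (D + q * M) ≤ X') (hL : L ≤ D * (D - (3 * k + 2) * M)) :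
    HasMoves F (FillState k M q X) L ∨ FinalState k M q X' F := by
  classical
  obtain ⟨C, A₀, hinv₀, hq₀, hex⟩ := h
  obtain ⟨A, hA, hinv, -, hmax⟩ := hinv₀.exists_maximal
  have hq : (C.labels \ A).card < q :=
    (Finset.card_le_card (Finset.sdiff_subset_sdiff subset_rfl hA)).trans_lt hq₀
  set E := Finset.univ.filter fun v => C.label v ∈ A ∧ (nbrs F v).card < k with hE
  by_cases hD : E.card < D
  · refine Or.inr ⟨C, A, hinv, hq, ?_⟩
    -- Only vertices of `E` and vertices on the fewer than `q` unattached paths can be deficient,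
    -- each by at most `k`.
    have h1 : deficit F k ≤ ∑ v, if v ∈ E ∨ C.label v ∉ A then k else 0 := by
      refine Finset.sum_le_sum fun v _ => ?_
      split_ifs with hv
      · omega
      · simp only [hE, Finset.mem_filter, Finset.mem_univ, true_and, not_or, not_and, not_lt,
          not_not] at hv
        have := hv.1 hv.2
        omega
    rw [← Finset.sum_filter, Finset.sum_const, smul_eq_mul] at h1
    have h2 : (Finset.univ.filter fun v => v ∈ E ∨ C.label v ∉ A).card ≤ D + q * M := by
      rw [Finset.filter_or]
      refine (Finset.card_union_le _ _).trans (Nat.add_le_add ?_ ?_)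
      · rw [Finset.filter_mem_eq_inter, Finset.univ_inter]
        exact hD.le
      · refine (Finset.card_le_card fun v hv => ?_).trans
          ((C.card_labelled_le hinv.fits.small (C.labels \ A)).trans
            (Nat.mul_le_mul_right M hq.le))
        simp only [Finset.mem_filter, Finset.mem_univ, true_and] at hv ⊢
        exact Finset.mem_sdiff.2 ⟨Finset.mem_image_of_mem _ (Finset.mem_univ v), hv⟩
    have h3 := Nat.mul_le_mul_right k h2
    rw [mul_comm k] at hX
    omega
  · left
    refine ⟨Finset.univ.filter fun x => x.1 ∈ E ∧ x.2 ∈ E ∧ C.CanJoin F k A x.1 x.2, ?_, ?_⟩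
    · refine hL.trans ((Nat.mul_le_mul (not_lt.1 hD)
        (Nat.sub_le_sub_right (not_lt.1 hD) _)).trans ?_)
      refine mul_le_card_pairs fun a ha => ⟨E.filter fun b => C.CanJoin F k A a b, ?_, ?_⟩
      · have := hinv.card_le_canJoin hmax (a := a) (Finset.mem_filter.1 ha).2.2 E
          (fun b hb => ⟨(Finset.mem_filter.1 hb).2.1, (Finset.mem_filter.1 hb).2.2.le⟩)
        omega
      · intro b hb
        rw [Finset.mem_filter] at hb
        exact Finset.mem_filter.2 ⟨Finset.mem_univ _, ha, hb.1, hb.2⟩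
    · rintro ⟨a, b⟩ hx
      simp only [Finset.mem_filter, Finset.mem_univ, true_and] at hx
      obtain ⟨ha, hb, hj⟩ := hx
      refine ⟨hj.ne, hj.not_adj, C, A, hinv.addPair hj, hq, ?_⟩
      exact (excess_addPair_le hj.ne hj.not_adj hj.deg_left (Finset.mem_filter.1 hb).2.2).trans hex

/-- Now a deficient vertex may be joined to all but `w` vertices, raising some degrees to `k + 1`.
Excess plus deficit does not increase, so the excess stays small. Once fewer than `D` deficient
vertices remain, a single one of them still offers a large star. -/
theorem FinalState.step [Nonempty V] {k M q X D L w : ℕ} {F : SimpleGraph V}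
    (h : FinalState k M q X F) (hw : q * M + X + (3 * k + 2) * M ≤ w)
    (hL : L ≤ D * (Fintype.card V - w)) :
    IsKConnected k F ∨ HasMoves F (FinalState k M q X) L ∨
      (deficit F k ≤ k * D ∧ HasStar F k (FinalState k M q X) w) := by
  classical
  obtain ⟨C, A₀, hinv₀, hq₀, hex⟩ := h
  obtain ⟨A, hA, hinv, -, hmax⟩ := hinv₀.exists_maximal
  have hq : (C.labels \ A).card < q :=
    (Finset.card_le_card (Finset.sdiff_subset_sdiff subset_rfl hA)).trans_lt hq₀
  set E := Finset.univ.filter fun v => (nbrs F v).card < k with hE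
  have hdef : deficit F k ≤ E.card * k := by
    have h1 : deficit F k ≤ ∑ v, if (nbrs F v).card < k then k else 0 := by
      refine Finset.sum_le_sum fun v _ => ?_
      split_ifs <;> omega
    rwa [← Finset.sum_filter, Finset.sum_const, smul_eq_mul] at h1
  have hmove : ∀ a b, C.CanJoin F k A a b → a ≠ b ∧ ¬ F.Adj a b ∧
      FinalState k M q X (addPair F (a, b)) ∧ deficit (addPair F (a, b)) k < deficit F k :=
    fun a b hj => ⟨hj.ne, hj.not_adj, ⟨C, A, hinv.addPair hj, hq,
      (excess_add_deficit_addPair hj.ne hj.not_adj hj.deg_left hj.deg_right).trans hex⟩,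
      deficit_addPair_lt hj.ne hj.not_adj hj.deg_left⟩
  have hmany : ∀ a ∈ E, Fintype.card V ≤
      (Finset.univ.filter fun b => C.CanJoin F k A a b).card + w := by
    intro a ha
    have h1 := hinv.card_le_canJoin hmax (a := a) (Finset.mem_filter.1 ha).2
        (Finset.univ.filter fun b => C.label b ∈ A ∧ (nbrs F b).card ≤ k)
        (fun b hb => (Finset.mem_filter.1 hb).2)
    have h2 := card_filter_deg_le (C := C) F k A
    have h3 := hinv.card_le_mass_add
    have h4 := Nat.mul_le_mul_right M hq.le
    have h5 : ((Finset.univ.filter fun b => C.label b ∈ A ∧ (nbrs F b).card ≤ k).filter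
        fun b => C.CanJoin F k A a b).card ≤
        (Finset.univ.filter fun b => C.CanJoin F k A a b).card :=
      Finset.card_le_card (Finset.filter_subset_filter _ (Finset.subset_univ _))
    omega
  by_cases hD : E.card < D
  · rcases E.eq_empty_or_nonempty with hE0 | ⟨a, ha⟩
    · left
      have hall : ∀ v, k ≤ (nbrs F v).card := by
        intro v
        by_contra hv
        have : v ∈ E := Finset.mem_filter.2 ⟨Finset.mem_univ v, not_le.1 hv⟩
        rw [hE0] at this
        exact absurd this (Finset.notMem_empty v)
      -- By `exists_deficient`, an unattached path would contain a deficient vertex, so all paths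
      -- are attached.
      refine hinv.fits.isKConnected hall (fun v => ?_) hinv.robust
      by_contra hv
      obtain ⟨a, -, ha⟩ := hinv.exists_deficient hmax (p := C.label v)
        (Finset.mem_sdiff.2 ⟨Finset.mem_image_of_mem _ (Finset.mem_univ v), hv⟩)
      have := hall a
      omega
    · right; right
      refine ⟨hdef.trans ?_, Finset.univ.filter fun x => C.CanJoin F k A x.1 x.2, a,
        Finset.univ.filter fun b => ¬ C.CanJoin F k A a b, ?_, fun b _ hb => ?_, ?_⟩
      · rw [mul_comm]; exact Nat.mul_le_mul_left k hD.le
      · have h1 := Finset.card_filter_add_card_filter_not (s := (Finset.univ : Finset V))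
          (fun b => C.CanJoin F k A a b)
        rw [Finset.card_univ] at h1
        have := hmany a ha
        omega
      · simpa using hb
      · rintro ⟨a, b⟩ hx
        simp only [Finset.mem_filter, Finset.mem_univ, true_and] at hx
        exact hmove a b hx
  · right; left
    refine ⟨Finset.univ.filter fun x => C.CanJoin F k A x.1 x.2, ?_, ?_⟩
    · refine hL.trans ((Nat.mul_le_mul_right _ (not_lt.1 hD)).trans ?_)
      refine mul_le_card_pairs fun a ha =>
        ⟨Finset.univ.filter fun b => C.CanJoin F k A a b, ?_, fun b hb => ?_⟩
      · have := hmany a ha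
        omega
      · simpa using hb
    · rintro ⟨a, b⟩ hx
      simp only [Finset.mem_filter, Finset.mem_univ, true_and] at hx
      have := hmove a b hx
      exact ⟨this.1, this.2.1, this.2.2.1⟩

end Attaching

/-! ### Building the paths and the core of pairwise adjacent paths. -/

section Hub

set_option linter.unusedSectionVars false

variable {V : Type*} [Fintype V] [DecidableEq V]

namespace PathCover

variable {C : PathCover V} {F : SimpleGraph V} {k M : ℕ} {A : Finset V}

theorem mul_le_mass {m : ℕ} (h : ∀ p ∈ A, m ≤ (C.piece p).card) : A.card * m ≤ C.mass A := by
  have hmaps : ∀ v ∈ Finset.univ.filter fun v => C.label v ∈ A, C.label v ∈ A :=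
    fun v hv => (Finset.mem_filter.1 hv).2
  rw [mass, Finset.card_eq_sum_card_fiberwise hmaps, ← smul_eq_mul]
  refine Finset.card_nsmul_le_sum _ _ _ fun p hp => (h p hp).trans (Finset.card_le_card ?_)
  intro v hv
  rw [mem_piece] at hv
  simp [hv, hp]

theorem mass_le : C.mass A ≤ Fintype.card V := Finset.card_le_univ _

theorem lt_card_piece (t : V) : C.pos t < (C.piece (C.label t)).card := by
  classical
  rw [Nat.lt_iff_add_one_le, ← Finset.card_range (C.pos t + 1)]
  refine (Finset.card_le_card (t := (C.piece (C.label t)).image C.pos) fun j hj => ?_).trans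
    Finset.card_image_le
  rw [Finset.mem_range] at hj
  obtain ⟨u, hu, hp⟩ := C.exists_of_le t (j := j) (by omega)
  exact Finset.mem_image.2 ⟨u, C.mem_piece.2 hu, hp⟩

variable (C) in
/-- The vertices that are alone on their path. -/
def singles : Finset V := Finset.univ.filter fun w => ∀ u, C.label u = C.label w → u = w

open Classical in
variable (C M) in
/-- The last vertices of the nontrivial paths with fewer than `M` vertices. -/
noncomputable def unfinished : Finset V :=
  Finset.univ.filter fun e => C.IsTop e ∧ 0 < C.pos e ∧ C.pos e + 1 < M

theorem mem_singles {w : V} : w ∈ C.singles ↔ ∀ u, C.label u = C.label w → u = w := by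
  simp [singles]

theorem mem_unfinished {e : V} :
    e ∈ C.unfinished M ↔ C.IsTop e ∧ 0 < C.pos e ∧ C.pos e + 1 < M := by
  simp [unfinished]

theorem pos_of_mem_singles {w : V} (hw : w ∈ C.singles) : C.pos w = 0 := by
  obtain ⟨b, hb, h0⟩ := C.exists_bottom w
  rwa [mem_singles.1 hw b hb] at h0

theorem isTop_of_mem_singles {w : V} (hw : w ∈ C.singles) : C.IsTop w := by
  intro u hu hp
  rw [mem_singles.1 hw u hu] at hp
  omega

variable (C) in
/-- Append the single vertex `w` to the path that ends in `e`. -/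
def extend (e w : V) (he : C.IsTop e) (hw : w ∈ C.singles) (hne : e ≠ w) : PathCover V where
  label := Function.update C.label w (C.label e)
  pos := Function.update C.pos w (C.pos e + 1)
  inj u v hl hp := by
    by_cases hu : u = w <;> by_cases hv : v = w
    · rw [hu, hv]
    · subst hu
      simp only [Function.update_self, Function.update_of_ne hv] at hl hp
      exact absurd hp.symm (he v hl.symm)
    · subst hv
      simp only [Function.update_self, Function.update_of_ne hu] at hl hp
      exact absurd hp (he u hl)
    · simp only [Function.update_of_ne hu, Function.update_of_ne hv] at hl hp
      exact C.inj u v hl hp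
  down v j h := by
    by_cases hv : v = w
    · subst hv
      simp only [Function.update_self] at h ⊢
      refine ⟨e, ?_, ?_⟩
      · rw [Function.update_of_ne hne]
      · rw [Function.update_of_ne hne]; omega
    · simp only [Function.update_of_ne hv] at h ⊢
      obtain ⟨u, hu, hj⟩ := C.down v j h
      have huw : u ≠ w := by
        rintro rfl
        exact hv (mem_singles.1 hw v hu.symm)
      exact ⟨u, by rwa [Function.update_of_ne huw], by rwa [Function.update_of_ne huw]⟩

theorem graph_extend {e w : V} (he : C.IsTop e) (hw : w ∈ C.singles) (hne : e ≠ w) :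
    (C.extend e w he hw hne).graph = addPair C.graph (e, w) := by
  ext a b
  rw [addPair_adj (x := (e, w)) hne, graph_adj, graph_adj]
  simp only [extend]
  have hsing := mem_singles.1 hw
  have key : ∀ c, c ≠ w → ((C.label e = C.label c ∧ (C.pos c = C.pos e + 1 + 1 ∨
      C.pos e + 1 = C.pos c + 1)) ↔ c = e) := by
    intro c hc
    constructor
    · rintro ⟨h1, h2⟩
      have := he.le C h1.symm
      exact C.inj c e h1.symm (by omega)
    · rintro rfl
      exact ⟨rfl, Or.inr rfl⟩
  by_cases ha : a = w <;> by_cases hb : b = w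
  · subst ha; subst hb
    simp only [Function.update_self]
    constructor
    · rintro ⟨-, h⟩; omega
    · rintro (⟨-, h⟩ | h | h)
      · omega
      · exact absurd h.1.symm hne
      · exact absurd h.2.symm hne
  · subst ha
    simp only [Function.update_self, Function.update_of_ne hb]
    rw [key b hb]
    constructor
    · rintro rfl; exact Or.inr (Or.inr ⟨trivial, rfl⟩)
    · rintro (⟨h, -⟩ | h | h)
      · exact absurd (hsing b h.symm) hb
      · exact absurd h.1.symm hne
      · exact h.2
  · subst hb
    simp only [Function.update_self, Function.update_of_ne ha]
    have h1 := key a ha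
    constructor
    · rintro ⟨h, h'⟩; exact Or.inr (Or.inl ⟨h1.1 ⟨h.symm, h'.symm⟩, trivial⟩)
    · rintro (⟨h, -⟩ | h | h)
      · exact absurd (hsing a h) ha
      · have := h1.2 h.1
        exact ⟨this.1.symm, this.2.symm⟩
      · exact absurd h.1 ha
  · simp only [Function.update_of_ne ha, Function.update_of_ne hb]
    constructor
    · exact Or.inl
    · rintro (h | h | h)
      · exact h
      · exact absurd h.2 hb
      · exact absurd h.1 ha

/-- The new end `w` replaces `e`. Extending an unfinished path thus does not increase their number,
and starting a path from two single vertices increases it by at most one. -/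
theorem unfinished_extend_subset {e w : V} (he : C.IsTop e) (hw : w ∈ C.singles) (hne : e ≠ w) :
    (C.extend e w he hw hne).unfinished M ⊆ insert w ((C.unfinished M).erase e) := by
  intro v hv
  rw [mem_unfinished] at hv
  obtain ⟨htop, hpos, hM⟩ := hv
  rw [Finset.mem_insert]
  by_cases hvw : v = w
  · exact Or.inl hvw
  right
  simp only [IsTop, extend, Function.update_of_ne hvw] at htop hpos hM
  have htop' : C.IsTop v := by
    intro u hu
    by_cases huw : u = w
    · subst huw
      exact absurd (mem_singles.1 hw v hu.symm) hvw
    · have := htop u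
      simp only [Function.update_of_ne huw] at this
      exact this hu
  rw [Finset.mem_erase, mem_unfinished]
  refine ⟨?_, htop', hpos, hM⟩
  rintro rfl
  have := htop w
  simp only [Function.update_self] at this
  exact this trivial rfl

end PathCover

open PathCover

/-- The states in which paths on at most `M` vertices are built. -/
def ForestState (M J : ℕ) (F : SimpleGraph V) : Prop :=
  ∃ C : PathCover V, F = C.graph ∧ (∀ v, C.pos v < M) ∧ (C.unfinished M).card ≤ J

/-- `K` paths on at least `M` vertices, with labels in `Λ`, are joined to each other: each pair of
them by at most one edge, and these edges are disjoint and avoid the ends of the paths. -/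
structure IsHub (C : PathCover V) (Λ : Finset V) (K M P : ℕ) (F : SimpleGraph V) : Prop where
  le : C.graph ≤ F
  internal : ∀ u v, F.Adj u v → C.label u = C.label v → C.graph.Adj u v
  small : ∀ v, C.pos v < M
  card_labels : C.labels.card ≤ P
  card_eq : Λ.card = K
  card_piece : ∀ p ∈ Λ, M ≤ (C.piece p).card
  inner : ∀ u v, F.Adj u v → C.label u ≠ C.label v → C.label u ∈ Λ ∧ 0 < C.pos u ∧ ¬ C.IsTop u
  unique : ∀ u v u' v', F.Adj u v → F.Adj u' v' → C.label u = C.label u' →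
    C.label v = C.label v' → C.label u ≠ C.label v → u = u'
  flex_eq : ∀ u v w, F.Adj u v → F.Adj u w → C.label v ≠ C.label u → C.label w ≠ C.label u → v = w

/-- The states in which `K` paths on `M` vertices are joined to each other. -/
def HubState (K M P : ℕ) (F : SimpleGraph V) : Prop :=
  ∃ (C : PathCover V) (Λ : Finset V), IsHub C Λ K M P F

theorem forestState_bot {M J : ℕ} (hM : 0 < M) : ForestState M J (⊥ : SimpleGraph V) := by
  refine ⟨⟨id, fun _ => 0, fun u v h _ => h, fun v j h => absurd h (by simp)⟩, ?_, fun v => hM, ?_⟩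
  · ext a b
    simp [graph_adj]
  · rw [Finset.card_eq_zero.2]
    · exact Nat.zero_le _
    · ext e
      simp [mem_unfinished]

theorem ForestState.card_nbrs_le {M J : ℕ} {F : SimpleGraph V} (h : ForestState M J F) (v : V) :
    (nbrs F v).card ≤ 2 := by
  obtain ⟨C, rfl, -, -⟩ := h
  refine (card_nbrs_le_two_add (C := C) (fun u v h _ => h) v).trans ?_
  have : C.flex C.graph v = ∅ := by
    ext w
    simp only [mem_flex, graph_adj, Finset.notMem_empty, iff_false]
    exact fun h => h.2 h.1.1.symm
  simp [this]

/-- The `J` open ends and at least `ι` single vertices supply enough pairs. When the single vertices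
run out, few paths are incomplete, so most vertices lie on full paths. -/
theorem ForestState.step {M J ι K P L : ℕ} {F : SimpleGraph V} (h : ForestState M J F)
    (hM : 2 ≤ M) (hL₁ : L ≤ J * ι) (hL₂ : L ≤ ι * (ι - 1))
    (hK : K * M + J * M + ι ≤ Fintype.card V) (hP : ι + J + Fintype.card V / M ≤ P) :
    HasMoves F (ForestState M J) L ∨ HubState K M P F := by
  classical
  obtain ⟨C, rfl, hsmall, hJ⟩ := h
  have hmove : ∀ e w (he : C.IsTop e) (hw : w ∈ C.singles) (hne : e ≠ w), C.pos e + 1 < M →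
      (insert w ((C.unfinished M).erase e)).card ≤ J →
      e ≠ w ∧ ¬ C.graph.Adj e w ∧ ForestState M J (addPair C.graph (e, w)) := by
    intro e w he hw hne hpos hcard
    refine ⟨hne, fun h => hne (mem_singles.1 hw e h.1), C.extend e w he hw hne,
      (graph_extend he hw hne).symm, fun v => ?_,
      (Finset.card_le_card (unfinished_extend_subset he hw hne)).trans hcard⟩
    by_cases hv : v = w
    · subst hv
      simpa [PathCover.extend] using hpos
    · simpa [PathCover.extend, Function.update_of_ne hv] using hsmall v
  by_cases hι : ι ≤ C.singles.card
  · left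
    -- With all `J` slots in use an open path is extended; otherwise a new path is started from two
    -- single vertices.
    by_cases hJ' : (C.unfinished M).card = J
    · refine ⟨C.unfinished M ×ˢ C.singles, ?_, ?_⟩
      · rw [Finset.card_product, hJ']
        exact hL₁.trans (Nat.mul_le_mul_left _ hι)
      · rintro ⟨e, w⟩ hx
        rw [Finset.mem_product] at hx
        have he := mem_unfinished.1 hx.1
        have hne : e ≠ w := by
          rintro rfl
          have h0 : C.pos e = 0 := pos_of_mem_singles hx.2
          have h1 : 0 < C.pos e := he.2.1
          omega
        refine hmove e w he.1 hx.2 hne he.2.2 ((Finset.card_insert_le _ _).trans ?_)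
        rw [Finset.card_erase_add_one hx.1, hJ']
    · refine ⟨C.singles.offDiag, ?_, ?_⟩
      · rw [Finset.offDiag_card, ← Nat.mul_sub_one]
        exact hL₂.trans (Nat.mul_le_mul hι (Nat.sub_le_sub_right hι 1))
      · rintro ⟨e, w⟩ hx
        rw [Finset.mem_offDiag] at hx
        refine hmove e w (isTop_of_mem_singles hx.1) hx.2.1 hx.2.2 ?_
          ((Finset.card_insert_le _ _).trans ?_)
        · have h0 : C.pos e = 0 := pos_of_mem_singles hx.1
          omega
        · have := Finset.card_le_card (Finset.erase_subset e (C.unfinished M))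
          omega
  · right
    set fin := Finset.univ.filter fun e => C.IsTop e ∧ M ≤ C.pos e + 1 with hfin
    have hcases : ∀ v, ∃ t, C.label t = C.label v ∧ (t ∈ C.singles ∨ t ∈ C.unfinished M ∨
        t ∈ fin) := by
      intro v
      obtain ⟨t, ht, htop⟩ := C.exists_top v
      refine ⟨t, ht, ?_⟩
      by_cases h0 : C.pos t = 0
      · left
        refine mem_singles.2 fun u hu => C.inj u t hu ?_
        have := htop.le C hu
        omega
      · by_cases h1 : C.pos t + 1 < M
        · exact Or.inr (Or.inl (mem_unfinished.2 ⟨htop, by omega, h1⟩))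
        · exact Or.inr (Or.inr (Finset.mem_filter.2 ⟨Finset.mem_univ _, htop, by omega⟩))
    have hpiece : ∀ p ∈ fin.image C.label, M ≤ (C.piece p).card := by
      intro p hp
      obtain ⟨t, ht, rfl⟩ := Finset.mem_image.1 hp
      have := C.lt_card_piece t
      have := (Finset.mem_filter.1 ht).2.2
      omega
    have hfinP : (fin.image C.label).card ≤ Fintype.card V / M := by
      rw [Nat.le_div_iff_mul_le (by omega)]
      exact (mul_le_mass hpiece).trans mass_le
    -- Single vertices and unfinished paths cover at most `ι + J * M` vertices, and full paths have
    -- at most `M` vertices each.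
    have hfinK : K ≤ (fin.image C.label).card := by
      have h1 : Fintype.card V ≤ C.singles.card +
          ((C.unfinished M).image C.label).card * M + (fin.image C.label).card * M := by
        rw [← Finset.card_univ]
        refine (Finset.card_le_card (t := C.singles ∪ (Finset.univ.filter fun v => C.label v ∈
          (C.unfinished M).image C.label) ∪ (Finset.univ.filter fun v => C.label v ∈
          fin.image C.label)) fun v _ => ?_).trans ((Finset.card_union_le _ _).trans
          (Nat.add_le_add ((Finset.card_union_le _ _).trans (Nat.add_le_add_left
          (C.card_labelled_le hsmall _) _)) (C.card_labelled_le hsmall _)))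
        obtain ⟨t, ht, h | h | h⟩ := hcases v
        · have := mem_singles.1 h v ht.symm
          subst this
          simp [h]
        · simp only [Finset.mem_union, Finset.mem_filter, Finset.mem_univ, true_and]
          exact Or.inl (Or.inr (Finset.mem_image.2 ⟨t, h, ht⟩))
        · simp only [Finset.mem_union, Finset.mem_filter, Finset.mem_univ, true_and]
          exact Or.inr (Finset.mem_image.2 ⟨t, h, ht⟩)
      have h2 : ((C.unfinished M).image C.label).card * M ≤ J * M :=
        Nat.mul_le_mul_right _ (Finset.card_image_le.trans hJ)
      have h3 : K * M ≤ (fin.image C.label).card * M := by omega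
      exact Nat.le_of_mul_le_mul_right h3 (by omega)
    obtain ⟨Λ, hΛ, hΛK⟩ := Finset.exists_subset_card_eq hfinK
    refine ⟨C, Λ, le_rfl, fun u v h _ => h, hsmall, ?_, hΛK, fun p hp => hpiece p (hΛ hp),
      fun u v h hn => absurd h.1 hn, fun u v _ _ h _ _ _ hn => absurd h.1 hn,
      fun u v w h _ hn => absurd h.1.symm hn⟩
    refine le_trans ?_ hP
    have h1 : C.labels ⊆ C.singles.image C.label ∪ (C.unfinished M).image C.label ∪
        fin.image C.label := by
      intro p hp
      obtain ⟨v, -, rfl⟩ := Finset.mem_image.1 hp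
      obtain ⟨t, ht, h⟩ := hcases v
      rw [← ht]
      simp only [Finset.mem_union]
      rcases h with h | h | h
      · exact Or.inl (Or.inl (Finset.mem_image_of_mem _ h))
      · exact Or.inl (Or.inr (Finset.mem_image_of_mem _ h))
      · exact Or.inr (Finset.mem_image_of_mem _ h)
    refine (Finset.card_le_card h1).trans ((Finset.card_union_le _ _).trans
      (Nat.add_le_add ((Finset.card_union_le _ _).trans (Nat.add_le_add ?_ ?_)) hfinP))
    · exact Finset.card_image_le.trans (not_le.1 hι).le
    · exact Finset.card_image_le.trans hJ

namespace IsHub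

variable {C : PathCover V} {Λ : Finset V} {K M P : ℕ} {F : SimpleGraph V}

theorem card_flex_le (h : IsHub C Λ K M P F) (v : V) : (C.flex F v).card ≤ 1 := by
  rw [Finset.card_le_one]
  intro a ha b hb
  rw [mem_flex] at ha hb
  exact h.flex_eq v a b ha.1 hb.1 ha.2 hb.2

theorem fits (h : IsHub C Λ K M P F) {k : ℕ} (hk : 2 ≤ k) : C.Fits F k M where
  le := h.le
  internal := h.internal
  distinct u v w huv huw hvw hne := h.flex_eq u v w huv huw hne (hvw ▸ hne)
  small := h.small
  deg v := by
    have := card_nbrs_le_two_add h.internal v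
    have := h.card_flex_le v
    omega

/-- The vertices of `p` in use lead to different paths of `Λ`. -/
theorem card_filter_flex_nonempty_le (h : IsHub C Λ K M P F) (p : V) :
    ((C.piece p).filter fun v => (C.flex F v).Nonempty).card ≤ K := by
  have hex : ∀ v, ∃ w, (C.flex F v).Nonempty → w ∈ C.flex F v := fun v => by
    by_cases hv : (C.flex F v).Nonempty
    · exact ⟨hv.choose, fun _ => hv.choose_spec⟩
    · exact ⟨v, fun h => absurd h hv⟩
  choose f hf using hex
  rw [← h.card_eq]
  refine Finset.card_le_card_of_injOn (fun v => C.label (f v)) (fun v hv => ?_)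
    fun u hu v hv huv => ?_
  · obtain ⟨-, hv⟩ := Finset.mem_filter.1 hv
    have := C.mem_flex.1 (hf v hv)
    exact (h.inner _ _ this.1.symm this.2).1
  · obtain ⟨hup, hu⟩ := Finset.mem_filter.1 hu
    obtain ⟨hvp, hv⟩ := Finset.mem_filter.1 hv
    rw [mem_piece] at hup hvp
    have h1 := C.mem_flex.1 (hf u hu)
    have h2 := C.mem_flex.1 (hf v hv)
    exact h.unique u _ v _ h1.1 h2.1 (hup.trans hvp.symm) huv h1.2.symm

theorem flexSum_le (h : IsHub C Λ K M P F) : C.flexSum F ≤ K * K := by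
  have h1 : C.flexSum F ≤ (Finset.univ.filter fun v => (C.flex F v).Nonempty).card := by
    rw [flexSum, Finset.card_filter]
    refine Finset.sum_le_sum fun v _ => ?_
    split_ifs with hv
    · exact h.card_flex_le v
    · rw [Finset.not_nonempty_iff_eq_empty.1 hv, Finset.card_empty]
  refine h1.trans ?_
  rw [Finset.card_eq_sum_card_fiberwise (f := C.label) (t := Λ)]
  · calc _ ≤ ∑ p ∈ Λ, K := Finset.sum_le_sum fun p _ => (Finset.card_le_card (fun v hv => ?_)).trans
          (h.card_filter_flex_nonempty_le p)
      _ = K * K := by rw [Finset.sum_const, h.card_eq, smul_eq_mul]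
    simp only [Finset.mem_filter, Finset.mem_univ, true_and] at hv ⊢
    exact ⟨C.mem_piece.2 hv.2, hv.1⟩
  · intro v hv
    obtain ⟨-, w, hw⟩ := Finset.mem_filter.1 hv
    rw [mem_flex] at hw
    exact (h.inner v w hw.1 hw.2.symm).1

variable (C Λ F) in
open Classical in
/-- The pairs of distinct paths with labels in `Λ` that are not adjacent. -/
noncomputable def missing : Finset (V × V) :=
  Λ.offDiag.filter fun x => x.2 ∉ C.adjLabels F x.1

variable (C F) in
open Classical in
/-- The inner vertices of the path `p` with no neighbour on another path. -/
noncomputable def free (p : V) : Finset V :=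
  (C.piece p).filter fun v => 0 < C.pos v ∧ ¬ C.IsTop v ∧ C.flex F v = ∅

theorem le_card_free (h : IsHub C Λ K M P F) {p : V} (hp : p ∈ Λ) :
    M - 2 - K ≤ (free C F p).card := by
  classical
  have hsub : C.piece p ⊆ free C F p ∪ ((C.piece p).filter (fun v => C.pos v = 0) ∪
      (C.piece p).filter (fun v => C.IsTop v) ∪
      (C.piece p).filter fun v => (C.flex F v).Nonempty) := by
    intro v hv
    simp only [free, Finset.mem_union, Finset.mem_filter, hv, true_and,
      Finset.nonempty_iff_ne_empty]
    by_cases h1 : C.pos v = 0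
    · tauto
    · have : 0 < C.pos v := by omega
      tauto
  have h1 : ((C.piece p).filter fun v => C.pos v = 0).card ≤ 1 := by
    rw [Finset.card_le_one]
    intro a ha b hb
    rw [Finset.mem_filter, mem_piece] at ha hb
    exact C.inj a b (ha.1.trans hb.1.symm) (ha.2.trans hb.2.symm)
  have h2 : ((C.piece p).filter fun v => C.IsTop v).card ≤ 1 := by
    rw [Finset.card_le_one]
    intro a ha b hb
    rw [Finset.mem_filter, mem_piece] at ha hb
    exact ha.2.eq C hb.2 (ha.1.trans hb.1.symm)
  have h3 := h.card_filter_flex_nonempty_le p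
  have h4 := (Finset.card_le_card hsub).trans ((Finset.card_union_le _ _).trans
    (Nat.add_le_add_left ((Finset.card_union_le _ _).trans
      (Nat.add_le_add_right (Finset.card_union_le _ _) _)) _))
  have h5 := h.card_piece p hp
  omega

theorem addPair (h : IsHub C Λ K M P F) {a b : V} (ha : C.label a ∈ Λ) (hb : C.label b ∈ Λ)
    (hab : C.label a ≠ C.label b) (hadj : C.label b ∉ C.adjLabels F (C.label a))
    (hfa : a ∈ free C F (C.label a)) (hfb : b ∈ free C F (C.label b)) :
    IsHub C Λ K M P (addPair F (a, b)) := by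
  have hne : a ≠ b := fun h => hab (by rw [h])
  have hadj' : ∀ u v, (USTSR.addPair F (a, b)).Adj u v →
      F.Adj u v ∨ (u = a ∧ v = b) ∨ (u = b ∧ v = a) := fun u v huv =>
    (addPair_adj (x := (a, b)) hne).1 huv
  have hnone : ∀ u v, F.Adj u v → C.label u = C.label a → C.label v = C.label b → False :=
    fun u v huv hu hv => hadj (C.mem_adjLabels.2 ⟨hab.symm, u, v, hu, hv, huv⟩)
  simp only [free, Finset.mem_filter, mem_piece, true_and] at hfa hfb
  have hflexa : ∀ v, F.Adj a v → C.label v ≠ C.label a → False := fun v hv hl => by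
    have : v ∈ C.flex F a := C.mem_flex.2 ⟨hv, hl⟩
    rw [hfa.2.2] at this
    exact absurd this (Finset.notMem_empty v)
  have hflexb : ∀ v, F.Adj b v → C.label v ≠ C.label b → False := fun v hv hl => by
    have : v ∈ C.flex F b := C.mem_flex.2 ⟨hv, hl⟩
    rw [hfb.2.2] at this
    exact absurd this (Finset.notMem_empty v)
  refine ⟨h.le.trans (le_addPair _ _), fun u v huv hl => ?_, h.small, h.card_labels, h.card_eq,
    h.card_piece, fun u v huv hl => ?_, fun u v u' v' h1 h2 hu hv hl => ?_,
    fun u v w h1 h2 hv hw => ?_⟩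
  · rcases hadj' u v huv with h1 | ⟨rfl, rfl⟩ | ⟨rfl, rfl⟩
    · exact h.internal u v h1 hl
    · exact absurd hl hab
    · exact absurd hl.symm hab
  · rcases hadj' u v huv with h1 | ⟨rfl, rfl⟩ | ⟨rfl, rfl⟩
    · exact h.inner u v h1 hl
    · exact ⟨ha, hfa.1, hfa.2.1⟩
    · exact ⟨hb, hfb.1, hfb.2.1⟩
  · rcases hadj' u v h1 with h3 | ⟨rfl, rfl⟩ | ⟨rfl, rfl⟩ <;>
      rcases hadj' u' v' h2 with h4 | ⟨rfl, rfl⟩ | ⟨rfl, rfl⟩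
    · exact h.unique u v u' v' h3 h4 hu hv hl
    · exact (hnone u v h3 hu hv).elim
    · exact (hnone v u h3.symm hv hu).elim
    · exact (hnone u' v' h4 hu.symm hv.symm).elim
    · rfl
    · exact absurd hu hab
    · exact (hnone v' u' h4.symm hv.symm hu.symm).elim
    · exact absurd hu.symm hab
    · rfl
  · rcases hadj' u v h1 with h3 | ⟨rfl, rfl⟩ | ⟨rfl, rfl⟩ <;>
      rcases hadj' u w h2 with h4 | ⟨hu, rfl⟩ | ⟨hu, rfl⟩
    · exact h.flex_eq u v w h3 h4 hv hw
    · subst hu; exact (hflexa v h3 hv).elim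
    · subst hu; exact (hflexb v h3 hv).elim
    · exact (hflexa w h4 hw).elim
    · rfl
    · exact absurd hu hne
    · exact (hflexb w h4 hw).elim
    · exact absurd hu hne.symm
    · rfl

/-- Core edges avoid the ends of paths. Two distinct ends have degree at most `1` and leave `2 * (k
- 1) ≥ k` free edge ends; a single vertex leaves all `k`. -/
theorem le_supply (h : IsHub C Λ K M P F) {k : ℕ} (hk : 2 ≤ k) (v : V) :
    k ≤ ∑ u ∈ C.piece (C.label v), (k - (nbrs F u).card) := by
  obtain ⟨b, hb, hb0⟩ := C.exists_bottom v
  obtain ⟨t, ht, htop⟩ := C.exists_top v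
  have hfb : (C.flex F b).card = 0 := by
    rw [Finset.card_eq_zero, Finset.eq_empty_iff_forall_notMem]
    intro w hw
    rw [mem_flex] at hw
    have := (h.inner b w hw.1 hw.2.symm).2.1
    omega
  have hft : (C.flex F t).card = 0 := by
    rw [Finset.card_eq_zero, Finset.eq_empty_iff_forall_notMem]
    intro w hw
    rw [mem_flex] at hw
    exact (h.inner t w hw.1 hw.2.symm).2.2 htop
  have h1 := card_nbrs_le_of_bottom h.internal hb0
  have h2 := card_nbrs_le_of_top h.internal htop
  by_cases hbt : b = t
  · subst hbt
    have hup : (Finset.univ.filter fun w => C.label w = C.label b ∧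
        C.pos w = C.pos b + 1) = ∅ := by
      rw [Finset.filter_eq_empty_iff]
      rintro w - ⟨h, h'⟩
      exact htop w h h'
    rw [hup, Finset.card_empty] at h1
    refine le_trans ?_ (Finset.single_le_sum (f := fun u => k - (nbrs F u).card)
      (fun _ _ => Nat.zero_le _) (C.mem_piece.2 hb))
    omega
  · have h3 := C.card_up_le b
    refine le_trans ?_ (Finset.sum_le_sum_of_subset (s := {b, t}) ?_)
    · rw [Finset.sum_pair hbt]
      omega
    · intro w hw
      rw [Finset.mem_insert, Finset.mem_singleton] at hw
      rcases hw with rfl | rfl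
      · exact C.mem_piece.2 hb
      · exact C.mem_piece.2 ht

theorem le_card_moves (h : IsHub C Λ K M P F) {S : Finset (V × V)}
    (hS : ∀ x, x ∈ S ↔ (C.label x.1, C.label x.2) ∈ missing C Λ F ∧
      x.1 ∈ free C F (C.label x.1) ∧ x.2 ∈ free C F (C.label x.2)) :
    (missing C Λ F).card * ((M - 2 - K) * (M - 2 - K)) ≤ S.card := by
  rw [Finset.card_eq_sum_card_fiberwise (f := fun x => (C.label x.1, C.label x.2))
    (t := missing C Λ F) (fun x hx => ((hS x).1 hx).1), ← smul_eq_mul]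
  refine Finset.card_nsmul_le_sum _ _ _ ?_
  rintro ⟨p, r⟩ hx
  have hoff := Finset.mem_offDiag.1 (Finset.mem_filter.1 hx).1
  refine (Nat.mul_le_mul (h.le_card_free hoff.1) (h.le_card_free hoff.2.1)).trans ?_
  rw [← Finset.card_product]
  refine Finset.card_le_card ?_
  rintro ⟨a, b⟩ hab
  rw [Finset.mem_product] at hab
  classical
  have ha : C.label a = p := C.mem_piece.1 (Finset.mem_filter.1 hab.1).1
  have hb : C.label b = r := C.mem_piece.1 (Finset.mem_filter.1 hab.2).1
  rw [Finset.mem_filter, hS]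
  simp only [ha, hb]
  exact ⟨⟨hx, hab⟩, trivial⟩

end IsHub

-- Joining all pairs of core paths would be too slow at the end, so the stage stops when at most `K
-- / 2` ordered pairs are missing. Each missing pair of paths offers about `M ^ 2` pairs of free
-- inner vertices.
open IsHub in
theorem HubState.step {k K M P B m L : ℕ} {F : SimpleGraph V} (h : HubState K M P F)
    (hk : 2 ≤ k) (hB : K * K + 2 * (k * P) ≤ B) (hm : 2 * m ≤ K * M)
    (hL : 2 * L ≤ K * ((M - 2 - K) * (M - 2 - K))) :
    HasMoves F (HubState K M P) L ∨ AttachState k M B m F := by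
  classical
  obtain ⟨C, Λ, h⟩ := h
  by_cases hmiss : K < 2 * (missing C Λ F).card
  · left
    set S := Finset.univ.filter fun x : V × V => (C.label x.1, C.label x.2) ∈ missing C Λ F ∧
      x.1 ∈ free C F (C.label x.1) ∧ x.2 ∈ free C F (C.label x.2) with hS
    refine ⟨S, ?_, ?_⟩
    · have h1 := h.le_card_moves (S := S) (fun x => by simp [hS])
      have h2 := Nat.mul_le_mul_right ((M - 2 - K) * (M - 2 - K)) hmiss.le
      rw [mul_assoc] at h2
      omega
    · rintro ⟨a, b⟩ hx
      simp only [hS, missing, Finset.mem_filter, Finset.mem_univ, true_and,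
        Finset.mem_offDiag] at hx
      obtain ⟨⟨⟨ha, hb, hne⟩, hadj⟩, hfa, hfb⟩ := hx
      refine ⟨fun hab => hne (congrArg C.label hab), fun hF => hadj (C.mem_adjLabels.2
        ⟨hne.symm, a, b, rfl, rfl, hF⟩), C, Λ, h.addPair ha hb hne hadj hfa hfb⟩
  · right
    -- Dropping one path from every missing pair leaves at least half of them, pairwise adjacent.
    set A := Λ \ (missing C Λ F).image Prod.fst with hA
    have hAcard : K ≤ 2 * A.card := by
      have h1 := Finset.le_card_sdiff ((missing C Λ F).image Prod.fst) Λ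
      have h2 : ((missing C Λ F).image Prod.fst).card ≤ (missing C Λ F).card :=
        Finset.card_image_le
      rw [h.card_eq] at h1
      rw [← hA] at h1
      omega
    refine ⟨C, A, ⟨h.fits hk, robust_of_pairwise h.le fun a ha b hb hab => ?_,
      fun v _ => (h.le_supply hk v).trans (Nat.le_add_left _ _)⟩, ?_, ?_⟩
    · by_contra hadj
      rw [hA, Finset.mem_sdiff] at ha hb
      exact ha.2 (Finset.mem_image.2 ⟨(a, b), Finset.mem_filter.2
        ⟨Finset.mem_offDiag.2 ⟨ha.1, hb.1, hab⟩, hadj⟩, rfl⟩)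
    · have h1 := h.flexSum_le
      have h2 : C.need F k A ≤ P * k := by
        refine (Finset.sum_le_card_nsmul _ _ k fun p _ => Nat.sub_le _ _).trans ?_
        rw [smul_eq_mul]
        exact Nat.mul_le_mul_right _ ((Finset.card_le_card Finset.sdiff_subset).trans h.card_labels)
      rw [mul_comm P k] at h2
      omega
    · have h1 := mul_le_mass (C := C) (A := A) (m := M) fun p hp =>
        h.card_piece p (Finset.mem_sdiff.1 hp).1
      have h2 := Nat.mul_le_mul_right M hAcard
      rw [mul_assoc] at h2
      omega

end Hub

/-! ### Small `k`: combining the stages into one strategy. -/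

theorem HasMoves.mono {V : Type*} [Fintype V] [DecidableEq V] {F : SimpleGraph V}
    {P Q : SimpleGraph V → Prop} {L : ℕ} (h : HasMoves F P L) (hPQ : ∀ F, P F → Q F) :
    HasMoves F Q L := by
  obtain ⟨S, hL, hS⟩ := h
  exact ⟨S, hL, fun x hx => ⟨(hS x hx).1, (hS x hx).2.1, hPQ _ (hS x hx).2.2⟩⟩

theorem HasStar.mono {V : Type*} [Fintype V] [DecidableEq V] {F : SimpleGraph V}
    {P Q : SimpleGraph V → Prop} {k w : ℕ} (h : HasStar F k P w) (hPQ : ∀ F, P F → Q F) :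
    HasStar F k Q w := by
  obtain ⟨S, a, W, hW, haS, hS⟩ := h
  exact ⟨S, a, W, hW, haS, fun x hx => ⟨(hS x hx).1, (hS x hx).2.1, hPQ _ (hS x hx).2.2.1,
    (hS x hx).2.2.2⟩⟩

variable {n : ℕ}

/-- The potential method for two kinds of rounds: those with at least `L` useful pairs, which fail
with probability at most `η`, and at most `k * d` star rounds, which succeed with probability at
least `1 / 2`. -/
theorem exists_strategy_of_moves (hn : 2 ≤ n) (Valid P : Set (SimpleGraph (Fin n)))
    {k X L w d W : ℕ} {η δ : ℝ} (hW : 0 < W) (hbot : ⊥ ∈ Valid)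
    (hdeg : ∀ F ∈ Valid, ∀ v, (nbrs F v).card ≤ k + 1) (hexc : ∀ F ∈ Valid, excess F k ≤ X)
    (hη : n * Real.exp (-(L / n : ℝ)) ≤ η) (hη2 : η ≤ 1 / 2) (hw : 4 * w ≤ n)
    (hδ : (2 * w / n : ℝ) ≤ δ ∨ L + k * d ≤ n * k ∧ η ≤ δ)
    (hstep : ∀ F ∈ Valid, F ∉ P → HasMoves F (· ∈ Valid) L ∨
      deficit F k ≤ k * d ∧ HasStar F k (· ∈ Valid) w) :
    ∃ σ : Strategy n, ENNReal.ofReal (1 - (η * (n * k + X) + 2 * δ * (k * d) +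
        (η * (n * k + X) + k * d) / W)) ≤
      treesLaw n {T | ∃ t : ℕ, t + 1 ≤ (n * k + X) / 2 + W ∧ hittingTime σ P T = (t : ℕ∞) ∧
        graphAfter σ T t ∈ Valid ∩ P} := by
  have hn0 : (0 : ℝ) < n := by exact_mod_cast (by omega : 0 < n)
  have hη0 : 0 ≤ η := le_trans (by positivity) hη
  have hδ0 : 0 ≤ δ := by
    rcases hδ with h | h
    · exact le_trans (by positivity) h
    · exact hη0.trans h.2
  set N := (n * k + X) / 2 with hN
  have hNF : ∀ F ∈ Valid, F.edgeSet.ncard ≤ N := by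
    intro F hF
    have h1 := two_mul_ncard_edgeSet_le (hdeg F hF)
    have h2 := hexc F hF
    rw [Fintype.card_fin] at h1
    rw [hN, Nat.le_div_iff_mul_le (by norm_num)]
    omega
  -- Each possible further edge carries `2 * η ≥ η / (1 - η)`, the price of an ordinary round.
  -- Truncating the deficit at `k * d` charges `δ / (1 / 2)` for star rounds only.
  set Φ : SimpleGraph (Fin n) → ℝ := fun F =>
    2 * η * ((N - F.edgeSet.ncard : ℕ) : ℝ) + 2 * δ * ((min (deficit F k) (k * d) : ℕ) : ℝ) with hΦ
  set Ψ : SimpleGraph (Fin n) → ℝ := fun F =>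
    2 * η * ((N - F.edgeSet.ncard : ℕ) : ℝ) + ((min (deficit F k) (k * d) : ℕ) : ℝ) with hΨ
  obtain ⟨σ, hσ⟩ := exists_strategy_of_potential hn Valid P Φ Ψ N W hW
    (fun F => by positivity) (fun F => by positivity) hbot hNF (by
    intro F hF hFP
    have hedge : ∀ x : Fin n × Fin n, x.1 ≠ x.2 → ¬ F.Adj x.1 x.2 → addPair F x ∈ Valid →
        ((N - (addPair F x).edgeSet.ncard : ℕ) : ℝ) + 1 = ((N - F.edgeSet.ncard : ℕ) : ℝ) := by
      intro x h1 h2 h3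
      have h4 := hNF _ h3
      have h5 := ncard_edgeSet_addPair h1 h2
      rw [h5] at h4 ⊢
      norm_cast
      omega
    rcases hstep F hF hFP with ⟨S, hSL, hS⟩ | ⟨hdef, S, a, Z, hZ, haS, hS⟩
    · have hmiss : treeProb (fun T => ¬ Hits T S) ≤ η := by
        refine (treeProb_not_hits_le (by omega) S fun x hx => (hS x hx).1).trans
          (le_trans (mul_le_mul_of_nonneg_left (Real.exp_le_exp.2 (neg_le_neg ?_)) hn0.le) hη)
        exact div_le_div_of_nonneg_right (Nat.cast_le.2 hSL) hn0.le
      have hl : 0 < 1 - η := by linarith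
      have hb : η / (1 - η) ≤ 2 * η := by
        rw [div_le_iff₀ hl]
        nlinarith
      refine ⟨S, 1 - η, η, hl, ?_, (treeProb_mono fun T hT => hT.1).trans hmiss, fun x hx => ?_⟩
      · rw [treeProb_not (by omega)] at hmiss
        linarith
      obtain ⟨h1, h2, h3⟩ := hS x hx
      have h4 := hedge x h1 h2 h3
      have h5 : ((min (deficit (addPair F x) k) (k * d) : ℕ) : ℝ) ≤
          ((min (deficit F k) (k * d) : ℕ) : ℝ) :=
        Nat.cast_le.2 (min_le_min_right _ (deficit_anti (le_addPair F x) k))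
      have h6 : 1 / (1 - η) - 1 = η / (1 - η) := by field_simp; ring
      refine ⟨h1, h2, h3, ?_, ?_⟩
      · have := mul_le_mul_of_nonneg_left h5 (mul_nonneg zero_le_two hδ0)
        simp only [hΦ]
        rw [← h4]
        linarith
      · simp only [hΨ]
        rw [← h4, h6]
        linarith
    · have hstar : treeProb (fun T => ¬ Hits T S) ≤ 2 * w / n := by
        refine (treeProb_not_hits_star_le hn S a Z haS).trans ?_
        have : (Z.card : ℝ) ≤ w := Nat.cast_le.2 hZ
        gcongr
      have hw2 : (2 * w / n : ℝ) ≤ 1 / 2 := by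
        rw [div_le_iff₀ hn0]
        have : (4 * w : ℝ) ≤ n := by exact_mod_cast hw
        linarith
      refine ⟨S, 1 / 2, δ, by norm_num, ?_, ?_, fun x hx => ?_⟩
      · rw [treeProb_not (by omega)] at hstar
        linarith
      -- Either the star itself is rarely missed, or `F` is so close to having `n * k` ordered
      -- adjacent pairs that the tree almost surely contains an old edge.
      · rcases hδ with h | ⟨hL, h⟩
        · exact (treeProb_mono fun T hT => hT.1).trans (hstar.trans h)
        · refine (treeProb_not_hits_and_disjoint_le S F).trans (le_trans ?_ (hη.trans h))
          refine (treeProb_not_hits_le (by omega) _ fun x hx => (mem_adjPairs.1 hx).ne).trans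
            (mul_le_mul_of_nonneg_left (Real.exp_le_exp.2 (neg_le_neg
              (div_le_div_of_nonneg_right (Nat.cast_le.2 ?_) hn0.le))) hn0.le)
          have h1 := le_two_mul_ncard_edgeSet F k
          rw [Fintype.card_fin, ← sum_card_nbrs, ← card_adjPairs_eq_sum] at h1
          omega
      obtain ⟨h1, h2, h3, h4⟩ := hS x hx
      have h5 := hedge x h1 h2 h3
      have h6 : ((min (deficit (addPair F x) k) (k * d) : ℕ) : ℝ) + 1 ≤
          ((min (deficit F k) (k * d) : ℕ) : ℝ) := by
        norm_cast
        omega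
      refine ⟨h1, h2, h3, ?_, ?_⟩
      · have := mul_le_mul_of_nonneg_left h6 (mul_nonneg zero_le_two hδ0)
        simp only [hΦ]
        rw [← h5]
        linarith
      · simp only [hΨ]
        rw [← h5]
        linarith)
  refine ⟨σ, (ENNReal.ofReal_le_ofReal ?_).trans hσ⟩
  have hN2 : 2 * ((N - (⊥ : SimpleGraph (Fin n)).edgeSet.ncard : ℕ) : ℝ) ≤ n * k + X := by
    have : 2 * (N - (⊥ : SimpleGraph (Fin n)).edgeSet.ncard) ≤ n * k + X := by omega
    exact_mod_cast this
  have hd : ((min (deficit (⊥ : SimpleGraph (Fin n)) k) (k * d) : ℕ) : ℝ) ≤ k * d := by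
    exact_mod_cast min_le_right _ _
  have h1 := mul_le_mul_of_nonneg_left hN2 hη0
  have h2 := mul_le_mul_of_nonneg_left hd (mul_nonneg zero_le_two hδ0)
  have hΨb : Ψ ⊥ ≤ η * (n * k + X) + k * d := by simp only [hΨ]; linarith
  have h3 : Ψ ⊥ / W ≤ (η * (n * k + X) + k * d) / W :=
    div_le_div_of_nonneg_right hΨb (Nat.cast_nonneg _)
  have hΦb : Φ ⊥ ≤ η * (n * k + X) + 2 * δ * (k * d) := by simp only [hΦ]; linarith
  linarith

theorem excess_eq_zero {V : Type*} [Fintype V] [DecidableEq V] {F : SimpleGraph V} {k : ℕ}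
    (h : ∀ v, (nbrs F v).card ≤ k) : excess F k = 0 := by
  rw [excess_eq_sum]
  exact Finset.sum_eq_zero fun v _ => if_neg (not_lt.2 (h v))

/-- The outcome at time `t` aimed at: a `k`-connected graph appears for the first time, and it
has a spanning `k`-connected subgraph with all degrees `k` or `k + 1`. -/
def Outcome (σ : Strategy n) (k t : ℕ) (T : ℕ → SpanningTree n) : Prop :=
  hittingTime σ (kConnectedGraphs n k) T = (t : ℕ∞) ∧
    ∃ H : SimpleGraph (Fin n), H ≤ graphAfter σ T t ∧ IsKConnected k H ∧ DegreesKOrSucc k H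

/-- The valid graphs are those in any of the five kinds of state. A state without enough moves
belongs to the next kind as well, so the stages chain without adding an edge. -/
theorem exists_strategy_of_parameters (hn : 2 ≤ n)
    {k M J ι K P B m q X D X' w L d W : ℕ} {η δ : ℝ} (hk : 2 ≤ k) (hM : 2 ≤ M)
    (hW : 0 < W) (hη : n * Real.exp (-(L / n : ℝ)) ≤ η) (hη2 : η ≤ 1 / 2) (hw4 : 4 * w ≤ n)
    (hδ : (2 * w / n : ℝ) ≤ δ ∨ L + k * d ≤ n * k ∧ η ≤ δ)
    (hJ : L ≤ J * ι) (hι : L ≤ ι * (ι - 1)) (hK : K * M + J * M + ι ≤ n)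
    (hP : ι + J + n / M ≤ P) (hB : K * K + 2 * (k * P) ≤ B) (hm : 2 * m ≤ K * M)
    (hLK : 2 * L ≤ K * ((M - 2 - K) * (M - 2 - K))) (hBX : B ≤ (k - 1) * X)
    (hattach : ∀ u mass, q ≤ u → m ≤ mass → n ≤ mass + u * M →
      L ≤ u * (mass - X - (3 * k + 2) * M))
    (hX : X + k * (D + q * M) ≤ X') (hD : L ≤ D * (D - (3 * k + 2) * M))
    (hw : q * M + X' + (3 * k + 2) * M ≤ w) (hd : L ≤ d * (n - w)) :
    ∃ σ : Strategy n, ENNReal.ofReal (1 - (η * (n * k + X') + 2 * δ * (k * d) +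
        (η * (n * k + X') + k * d) / W)) ≤
      treesLaw n {T | ∃ t : ℕ, t + 1 ≤ (n * k + X') / 2 + W ∧ Outcome σ k t T} := by
  have : Nonempty (Fin n) := ⟨⟨0, by omega⟩⟩
  have hXX : X ≤ X' := by omega
  set Valid : Set (SimpleGraph (Fin n)) := {F | ForestState M J F ∨ HubState K M P F ∨
    AttachState k M B m F ∨ FillState k M q X F ∨ FinalState k M q X' F} with hValid
  have hmem : ∀ F, F ∈ Valid ↔ (ForestState M J F ∨ HubState K M P F ∨
    AttachState k M B m F ∨ FillState k M q X F ∨ FinalState k M q X' F) := fun F => Iff.rfl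
  have hfits : ∀ (F : SimpleGraph (Fin n)) (C : PathCover (Fin n)), C.Fits F k M →
      C.flexSum F ≤ B → excess F k ≤ X := by
    intro F C hF hflex
    have h1 := hF.mul_excess_le
    have h2 : (k - 1) * excess F k ≤ (k - 1) * X := by omega
    exact Nat.le_of_mul_le_mul_left h2 (by omega)
  have hdeg : ∀ F ∈ Valid, (∀ v, (nbrs F v).card ≤ k + 1) ∧ excess F k ≤ X' := by
    intro F hF
    rcases (hmem F).1 hF with h | ⟨C, Λ, h⟩ | ⟨C, A, h, hB', -⟩ | ⟨C, A, h, -, hX'⟩ | ⟨C, A, h, -, hX'⟩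
    · refine ⟨fun v => (h.card_nbrs_le v).trans (by omega), ?_⟩
      rw [excess_eq_zero fun v => (h.card_nbrs_le v).trans hk]
      exact Nat.zero_le _
    · have h1 := h.flexSum_le
      exact ⟨(h.fits hk).deg, (hfits F C (h.fits hk) (by omega)).trans hXX⟩
    · exact ⟨h.fits.deg, (hfits F C h.fits (by omega)).trans hXX⟩
    · exact ⟨h.fits.deg, hX'.trans hXX⟩
    · exact ⟨h.fits.deg, by omega⟩
  obtain ⟨σ, hσ⟩ := exists_strategy_of_moves hn Valid (kConnectedGraphs n k) (k := k) (X := X')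
    (L := L) (w := w) (d := d) (W := W) (η := η) (δ := δ) hW
    (Or.inl (forestState_bot (by omega))) (fun F hF => (hdeg F hF).1)
    (fun F hF => (hdeg F hF).2) hη hη2 hw4 hδ (by
    intro F hF hFP
    have hforest : ∀ F, ForestState M J F → F ∈ Valid := fun F h => Or.inl h
    have hhub : ∀ F, HubState K M P F → F ∈ Valid := fun F h => Or.inr (Or.inl h)
    have hatt : ∀ F, AttachState k M B m F → F ∈ Valid := fun F h => Or.inr (Or.inr (Or.inl h))
    have hfill : ∀ F, FillState k M q X F → F ∈ Valid :=
      fun F h => Or.inr (Or.inr (Or.inr (Or.inl h)))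
    have hfinal : ∀ F, FinalState k M q X' F → F ∈ Valid :=
      fun F h => Or.inr (Or.inr (Or.inr (Or.inr h)))
    have h5 : FinalState k M q X' F → HasMoves F (· ∈ Valid) L ∨
        deficit F k ≤ k * d ∧ HasStar F k (· ∈ Valid) w := by
      intro h
      rcases h.step (D := d) (L := L) hw (by rwa [Fintype.card_fin]) with h | h | h
      · exact absurd h hFP
      · exact Or.inl (h.mono hfinal)
      · exact Or.inr ⟨h.1, h.2.mono hfinal⟩
    have h4 : FillState k M q X F → HasMoves F (· ∈ Valid) L ∨
        deficit F k ≤ k * d ∧ HasStar F k (· ∈ Valid) w := fun h =>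
      (h.step hX hD).elim (fun h => Or.inl (h.mono hfill)) h5
    have h3 : AttachState k M B m F → HasMoves F (· ∈ Valid) L ∨
        deficit F k ≤ k * d ∧ HasStar F k (· ∈ Valid) w := fun h =>
      (h.step hk hBX (by rwa [Fintype.card_fin])).elim (fun h => Or.inl (h.mono hatt)) h4
    have h2 : HubState K M P F → HasMoves F (· ∈ Valid) L ∨
        deficit F k ≤ k * d ∧ HasStar F k (· ∈ Valid) w := fun h =>
      (h.step hk hB hm hLK).elim (fun h => Or.inl (h.mono hhub)) h3
    rcases (hmem F).1 hF with h | h | h | h | h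
    · exact (h.step hM hJ hι (by rwa [Fintype.card_fin]) (by rwa [Fintype.card_fin])).elim
        (fun h => Or.inl (h.mono hforest)) h2
    · exact h2 h
    · exact h3 h
    · exact h4 h
    · exact h5 h)
  refine ⟨σ, hσ.trans (measure_mono fun T hT => ?_)⟩
  obtain ⟨t, ht, hτ, hG⟩ := hT
  -- All valid graphs have degrees at most `k + 1`, so the graph reached serves as its own subgraph.
  exact ⟨t, ht, hτ, graphAfter σ T t, le_rfl, hG.2,
    degreesKOrSucc_of_card_nbrs hG.2 (hdeg _ hG.1).1⟩

/-! ### Choice of parameters as powers of an 80th root of `n`. -/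

theorem mul_pow_le_pow {r c i j : ℕ} (hr : 0 < r) (hc : c ≤ r) (hij : i < j) :
    c * r ^ i ≤ r ^ j :=
  (Nat.mul_le_mul_right _ hc).trans
    (by rw [← pow_succ']; exact Nat.pow_le_pow_right hr hij)

/-- A bound for the probability of failure, in terms of an `80`-th root of `n`. -/
noncomputable def failureBound (r : ℕ) : ℝ :=
  200 * ((r : ℝ) ^ 330 * Real.exp (-r)) + (100 + 972 * Real.log r) / r

theorem tendsto_failureBound : Tendsto failureBound atTop (𝓝 0) := by
  have h1 := (Real.tendsto_pow_mul_exp_neg_atTop_nhds_zero 330).const_mul 200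
  have h2 := (tendsto_const_nhds (x := (100 : ℝ)).div_atTop tendsto_id).add
    ((Real.isLittleO_log_id_atTop.tendsto_div_nhds_zero).const_mul 972)
  have h3 := (h1.add h2).comp (tendsto_natCast_atTop_atTop (R := ℝ))
  simp only [mul_zero, add_zero] at h3
  refine h3.congr fun r => ?_
  simp only [Function.comp_apply, failureBound, id]
  ring

theorem cube_mul_exp_le {n r : ℕ} (hr : 200 ≤ r) (hrn : n ≤ 2 * r ^ 80) (c : ℕ) (hc : c ≤ 4) :
    (n : ℝ) ^ c * Real.exp (-r) ≤ 16 * ((r : ℝ) ^ 320 * Real.exp (-r)) := by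
  have hr1 : (1 : ℝ) ≤ (r : ℝ) := by exact_mod_cast (by omega : 1 ≤ r)
  have h1 : (n : ℝ) ≤ 2 * (r : ℝ) ^ 80 := by exact_mod_cast hrn
  have h2 : (1 : ℝ) ≤ 2 * (r : ℝ) ^ 80 := by
    have := one_le_pow₀ hr1 (n := 80)
    linarith
  have h3 : (n : ℝ) ^ c ≤ 16 * (r : ℝ) ^ 320 := calc
    (n : ℝ) ^ c ≤ (2 * (r : ℝ) ^ 80) ^ c := pow_le_pow_left₀ (Nat.cast_nonneg _) h1 c
    _ ≤ (2 * (r : ℝ) ^ 80) ^ 4 := pow_le_pow_right₀ h2 hc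
    _ = 16 * (r : ℝ) ^ 320 := by ring
  rw [← mul_assoc]
  exact mul_le_mul_of_nonneg_right h3 (Real.exp_pos _).le

/-- The choice `L = n * r`, at most `2 * r ^ 81`, makes a miss as unlikely as `n * exp (-r)`. The
exponents are such that the stages offer of order `r ^ 84` pairs or more where paths and core are
built, that `k * M ≤ r ^ 52` is negligible against `m` and `D`, and that the overheads `k * r ^ 56`
and `W = k * r ^ 58` stay below `k * r ^ 60`. -/
theorem exists_strategy_of_le_pow {n k r : ℕ} (hr : 200 ≤ r) (hε : failureBound r ≤ 1 / 2)
    (hrn : r ^ 80 ≤ n) (hnr : n ≤ 2 * r ^ 80) (hk2 : 2 ≤ k) (hk : k ≤ r ^ 22) :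
    ∃ σ : Strategy n, ENNReal.ofReal (1 - failureBound r) ≤
      treesLaw n {T | ∃ t : ℕ, 2 * t ≤ n * k + 4 * k * r ^ 60 ∧ Outcome σ k t T} := by
  have hr0 : 0 < r := by omega
  have pw : ∀ c i j : ℕ, c ≤ 200 → i < j → c * r ^ i ≤ r ^ j := fun c i j hc hij =>
    mul_pow_le_pow hr0 (hc.trans hr) hij
  have pw0 : ∀ c j : ℕ, c ≤ 200 → 0 < j → c ≤ r ^ j := fun c j hc hj => by
    simpa using pw c 0 j hc hj
  have hp : ∀ i, 0 < r ^ i := fun i => Nat.pow_pos hr0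
  have hn2 : 2 ≤ n := by
    have := pw0 2 80 (by norm_num) (by norm_num)
    omega
  have hr1 : (1 : ℝ) ≤ (r : ℝ) := by exact_mod_cast hr0
  have hrpos : (0 : ℝ) < r := by linarith
  have hn0 : (0 : ℝ) < n := by exact_mod_cast (by omega : 0 < n)
  have hlog : 0 ≤ Real.log r := Real.log_nonneg hr1
  have hE : (r : ℝ) ^ 320 * Real.exp (-r) ≤ (r : ℝ) ^ 330 * Real.exp (-r) :=
    mul_le_mul_of_nonneg_right (pow_le_pow_right₀ hr1 (by norm_num)) (Real.exp_pos _).le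
  have hεE : 200 * ((r : ℝ) ^ 330 * Real.exp (-r)) + 100 / r ≤ failureBound r := by
    unfold failureBound
    have : 100 / (r : ℝ) ≤ (100 + 972 * Real.log r) / r :=
      div_le_div_of_nonneg_right (by linarith) hrpos.le
    linarith
  have hLn : n * r ≤ 2 * r ^ 81 := by
    rw [pow_succ, ← mul_assoc]
    exact Nat.mul_le_mul_right r hnr
  have h3k : (3 * k + 2) * r ^ 30 ≤ 4 * r ^ 52 := by
    have h1 : 3 * k + 2 ≤ 4 * r ^ 22 := by
      have := pw0 2 22 (by norm_num) (by norm_num)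
      omega
    have := Nat.mul_le_mul_right (r ^ 30) h1
    rwa [mul_assoc, ← pow_add] at this
  have hkn : k ≤ n := by
    have := Nat.pow_le_pow_right hr0 (show 22 ≤ 80 by norm_num)
    omega
  have hw4 : 4 * (3 * (k * r ^ 56)) ≤ n := by
    have h1 := Nat.mul_le_mul_right (r ^ 56) hk
    rw [← pow_add] at h1
    have h2 := pw 12 78 80 (by norm_num) (by norm_num)
    norm_num at h1
    omega
  set η : ℝ := n * Real.exp (-r) with hη
  have hη0 : 0 ≤ η := by positivity
  have hη1 : η ≤ 16 * ((r : ℝ) ^ 320 * Real.exp (-r)) := by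
    simpa using cube_mul_exp_le hr hnr 1 (by norm_num)
  -- For `k < 2 * r` there are at most `4 * r ^ 2` star rounds, and `2 * w / n` is small enough. For
  -- larger `k` the tree is bound to contain an old edge.
  set δ : ℝ := if k < 2 * r then 2 * ((3 * (k * r ^ 56) : ℕ) : ℝ) / n else η with hδ
  have hexp0 := Real.exp_pos (-(r : ℝ))
  have hrinv : 0 < 100 / (r : ℝ) := by positivity
  have hE0 : 0 ≤ (r : ℝ) ^ 330 * Real.exp (-r) := by positivity
  obtain ⟨σ, hσ⟩ := exists_strategy_of_parameters hn2 (k := k) (M := r ^ 30) (J := r ^ 32)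
    (ι := r ^ 52) (K := 2 * r ^ 26) (P := 2 * r ^ 52)
    (B := 2 * r ^ 26 * (2 * r ^ 26) + 2 * (k * (2 * r ^ 52))) (m := r ^ 56) (q := r ^ 2)
    (X := 12 * r ^ 52) (D := r ^ 56) (X' := 2 * (k * r ^ 56)) (w := 3 * (k * r ^ 56))
    (L := n * r) (d := 2 * r) (W := k * r ^ 58) (η := η) (δ := δ) hk2
    (by have := pw0 2 30 (by norm_num) (by norm_num); omega)
    (Nat.mul_pos (by omega) (hp 58))
    (by rw [hη, Nat.cast_mul, mul_div_cancel_left₀ _ hn0.ne'])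
    (by linarith) hw4
    (by
      by_cases hkr : k < 2 * r
      · left; rw [hδ, if_pos hkr]
      · right
        refine ⟨?_, by rw [hδ, if_neg hkr]⟩
        have h1 : n * (2 * r) ≤ n * k := Nat.mul_le_mul_left n (not_lt.1 hkr)
        have h2 : k * (4 * r) ≤ k * n := by
          have := mul_pow_le_pow (i := 1) (j := 80) hr0 (show 4 ≤ r by omega) (by norm_num)
          rw [pow_one] at this
          exact Nat.mul_le_mul_left k (by omega)
        have e1 : n * (2 * r) = 2 * (n * r) := by ring
        have e2 : k * (4 * r) = 2 * (k * (2 * r)) := by ring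
        rw [mul_comm k n] at h2
        omega)
    (by
      rw [← pow_add]
      have := pw 2 81 84 (by norm_num) (by norm_num)
      norm_num
      omega)
    (by
      have h1 : r ^ 51 ≤ r ^ 52 - 1 := by
        have := pw 2 51 52 (by norm_num) (by norm_num)
        have := hp 51
        omega
      have h2 := Nat.mul_le_mul_left (r ^ 52) h1
      rw [← pow_add] at h2
      have := pw 2 81 103 (by norm_num) (by norm_num)
      norm_num at h2
      omega)
    (by
      rw [mul_assoc, ← pow_add, ← pow_add]
      have := pw 4 56 80 (by norm_num) (by norm_num)
      have := pw 4 62 80 (by norm_num) (by norm_num)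
      have := pw 4 52 80 (by norm_num) (by norm_num)
      norm_num
      omega)
    (by
      have h1 : n / r ^ 30 ≤ 2 * r ^ 50 := by
        refine Nat.div_le_of_le_mul (hnr.trans_eq ?_)
        ring
      have := pw 4 50 52 (by norm_num) (by norm_num)
      have := pw 2 32 52 (by norm_num) (by norm_num)
      omega)
    le_rfl
    (by rw [mul_assoc, ← pow_add])
    (by
      have h1 : r ^ 29 ≤ r ^ 30 - 2 - 2 * r ^ 26 := by
        have := pw 4 29 30 (by norm_num) (by norm_num)
        have := pw 2 26 29 (by norm_num) (by norm_num)
        have := pw0 2 29 (by norm_num) (by norm_num)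
        omega
      have h2 := Nat.mul_le_mul_left (2 * r ^ 26) (Nat.mul_le_mul h1 h1)
      have h3 : 2 * r ^ 26 * (r ^ 29 * r ^ 29) = 2 * r ^ 84 := by ring
      have := pw 2 81 84 (by norm_num) (by norm_num)
      omega)
    (by
      -- The condition reads `4 * (k + 1) ≤ 12 * (k - 1)`, an equality for `k = 2`; this is the
      -- origin of the factor `12` in `X`.
      obtain ⟨j, rfl⟩ : ∃ j, k = j + 2 := ⟨k - 2, by omega⟩
      have h : 2 * r ^ 26 * (2 * r ^ 26) + 2 * ((j + 2) * (2 * r ^ 52)) =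
        (4 * j + 12) * r ^ 52 := by ring
      rw [h, ← mul_assoc]
      exact Nat.mul_le_mul_right _ (by omega))
    (by
      intro u mass hu hmass hcover
      set s := mass - 12 * r ^ 52 - (3 * k + 2) * r ^ 30 with hs
      have h1 := pw 32 52 56 (by norm_num) (by norm_num)
      have h2 : mass ≤ 2 * s := by omega
      -- Either half of the vertices are attached, and `q = r ^ 2` unattached paths suffice, or at
      -- least `n / (2 * r ^ 30)` paths are unattached, and the mass `r ^ 56` suffices.
      by_cases hlarge : n ≤ 2 * mass
      · calc n * r ≤ (4 * s) * r := Nat.mul_le_mul_right r (by omega)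
          _ = (4 * r) * s := by ring
          _ ≤ u * s := Nat.mul_le_mul_right s (le_trans (by nlinarith) hu)
      · have h3 : 2 * r ^ 31 ≤ s := by
          have := pw 4 31 56 (by norm_num) (by norm_num)
          omega
        calc n * r ≤ (2 * (u * r ^ 30)) * r := Nat.mul_le_mul_right r (by omega)
          _ = u * (2 * r ^ 31) := by ring
          _ ≤ u * s := Nat.mul_le_mul_left u h3)
    (by
      rw [← pow_add, mul_add]
      have h1 := Nat.mul_le_mul_left k (pw 2 32 56 (by norm_num) (by norm_num))
      have h2 := pw 24 52 56 (by norm_num) (by norm_num)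
      have h3 : 1 * r ^ 56 ≤ k * r ^ 56 := Nat.mul_le_mul_right _ (by omega)
      have e : k * (2 * r ^ 32) = 2 * (k * r ^ 32) := by ring
      norm_num
      omega)
    (by
      have h1 : r ^ 55 ≤ r ^ 56 - (3 * k + 2) * r ^ 30 := by
        have := pw 2 55 56 (by norm_num) (by norm_num)
        have := pw 4 52 55 (by norm_num) (by norm_num)
        omega
      have h2 := Nat.mul_le_mul_left (r ^ 56) h1
      rw [← pow_add] at h2
      have := pw 2 81 111 (by norm_num) (by norm_num)
      norm_num at h2
      omega)
    (by
      rw [← pow_add]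
      have h2 := pw 2 32 56 (by norm_num) (by norm_num)
      have h4 := pw 8 52 56 (by norm_num) (by norm_num)
      have h3 : 1 * r ^ 56 ≤ k * r ^ 56 := Nat.mul_le_mul_right _ (by omega)
      norm_num
      omega)
    (by
      have h1 := Nat.mul_le_mul_left r (show n ≤ 2 * (n - 3 * (k * r ^ 56)) by omega)
      calc n * r = r * n := mul_comm _ _
        _ ≤ r * (2 * (n - 3 * (k * r ^ 56))) := h1
        _ = _ := by ring)
  refine ⟨σ, (ENNReal.ofReal_le_ofReal ?_).trans (hσ.trans (measure_mono fun T hT => ?_))⟩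
  · have hk0 : (0 : ℝ) < k := by exact_mod_cast (by omega : 0 < k)
    have hkn' : (k : ℝ) ≤ n := by exact_mod_cast hkn
    have hX' : ((2 * (k * r ^ 56) : ℕ) : ℝ) ≤ n * n := by
      have h1 : 2 * (k * r ^ 56) ≤ n * 1 := by omega
      exact_mod_cast h1.trans (Nat.mul_le_mul_left n (by omega))
    have h1 : η * (n * k + ((2 * (k * r ^ 56) : ℕ) : ℝ)) ≤
        32 * ((r : ℝ) ^ 320 * Real.exp (-r)) := by
      have h2 : n * k + ((2 * (k * r ^ 56) : ℕ) : ℝ) ≤ 2 * (n : ℝ) ^ 2 := by nlinarith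
      have h3 := cube_mul_exp_le hr hnr 3 (by norm_num)
      calc _ ≤ η * (2 * (n : ℝ) ^ 2) := mul_le_mul_of_nonneg_left h2 hη0
        _ = 2 * ((n : ℝ) ^ 3 * Real.exp (-r)) := by rw [hη]; ring
        _ ≤ _ := by linarith
    have hWr : (1 : ℝ) ≤ (k : ℝ) * (r : ℝ) ^ 58 := by
      have : 1 ≤ k * r ^ 58 := Nat.mul_pos (by omega) (hp 58)
      exact_mod_cast this
    have h2 : 2 * δ * (k * ((2 * r : ℕ) : ℝ)) ≤
        64 * ((r : ℝ) ^ 330 * Real.exp (-r)) + 96 / r := by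
      by_cases hkr : k < 2 * r
      · rw [hδ, if_pos hkr]
        have h3 : (k : ℝ) ≤ 2 * r := by exact_mod_cast hkr.le
        have h4 : (r : ℝ) ^ 80 ≤ n := by exact_mod_cast hrn
        have h5 : 2 * (2 * ((3 * (k * r ^ 56) : ℕ) : ℝ) / n) * (k * ((2 * r : ℕ) : ℝ)) ≤
            96 / r := by
          have e : 2 * (2 * ((3 * (k * r ^ 56) : ℕ) : ℝ) / n) * (k * ((2 * r : ℕ) : ℝ)) =
              24 * (k : ℝ) ^ 2 * (r : ℝ) ^ 57 / n := by push_cast; ring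
          rw [e, div_le_div_iff₀ hn0 hrpos]
          have h6 : (k : ℝ) ^ 2 ≤ (2 * r) ^ 2 := pow_le_pow_left₀ hk0.le h3 2
          calc 24 * (k : ℝ) ^ 2 * (r : ℝ) ^ 57 * r ≤ 24 * (2 * (r : ℝ)) ^ 2 * (r : ℝ) ^ 57 * r := by
                gcongr
            _ = 96 * (r : ℝ) ^ 60 := by ring
            _ ≤ 96 * n := by
                have := pow_le_pow_right₀ hr1 (show 60 ≤ 80 by norm_num)
                linarith
        linarith
      · rw [hδ, if_neg hkr]
        have h3 := cube_mul_exp_le hr hnr 2 (by norm_num)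
        have h4 : (r : ℝ) * ((r : ℝ) ^ 320 * Real.exp (-r)) ≤ (r : ℝ) ^ 330 * Real.exp (-r) := by
          rw [← mul_assoc, ← pow_succ']
          exact mul_le_mul_of_nonneg_right (pow_le_pow_right₀ hr1 (by norm_num)) hexp0.le
        have h5 : 2 * η * (k * ((2 * r : ℕ) : ℝ)) ≤
            4 * (r * ((n : ℝ) ^ 2 * Real.exp (-r))) := by
          have := mul_le_mul_of_nonneg_left hkn' (mul_nonneg hη0 hrpos.le)
          rw [hη] at this ⊢
          push_cast
          calc _ = 4 * (n * Real.exp (-r) * r * k) := by ring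
            _ ≤ 4 * (n * Real.exp (-r) * r * n) := by linarith
            _ = _ := by ring
        have h6 := mul_le_mul_of_nonneg_left h3 hrpos.le
        have h7 : 0 < 96 / (r : ℝ) := by positivity
        rw [mul_left_comm (r : ℝ) 16] at h6
        generalize (r : ℝ) * ((r : ℝ) ^ 320 * Real.exp (-r)) = E₁ at h4 h6
        generalize (r : ℝ) ^ 330 * Real.exp (-r) = E₂ at h4 ⊢
        linarith
    have h3 : (η * (n * k + ((2 * (k * r ^ 56) : ℕ) : ℝ)) + k * ((2 * r : ℕ) : ℝ)) /
        ((k * r ^ 58 : ℕ) : ℝ) ≤ 32 * ((r : ℝ) ^ 320 * Real.exp (-r)) + 2 / r := by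
      rw [add_div]
      push_cast
      refine add_le_add ((div_le_self (by positivity) hWr).trans ?_) ?_
      · exact_mod_cast h1
      · rw [div_le_div_iff₀ (by positivity) hrpos]
        have h4 := pow_le_pow_right₀ hr1 (show 2 ≤ 58 by norm_num)
        have h5 := mul_le_mul_of_nonneg_left h4 hk0.le
        linarith
    refine sub_le_sub_left ((add_le_add (add_le_add h1 h2) h3).trans (le_trans ?_ hεE)) 1
    have e : (96 : ℝ) / r + 2 / r ≤ 100 / r := by
      rw [← add_div]
      exact div_le_div_of_nonneg_right (by norm_num) hrpos.le
    generalize (r : ℝ) ^ 320 * Real.exp (-r) = E₁ at hE ⊢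
    generalize (r : ℝ) ^ 330 * Real.exp (-r) = E₂ at hE hE0 ⊢
    linarith
  · obtain ⟨t, ht, hO⟩ := hT
    refine ⟨t, ?_, hO⟩
    have h1 := Nat.mul_le_mul_left k (pw 2 56 60 (by norm_num) (by norm_num))
    have h2 := Nat.mul_le_mul_left k (pw 2 58 60 (by norm_num) (by norm_num))
    have e1 : k * (2 * r ^ 56) = 2 * (k * r ^ 56) := by ring
    have e2 : k * (2 * r ^ 58) = 2 * (k * r ^ 58) := by ring
    have e3 : 4 * k * r ^ 60 = 4 * (k * r ^ 60) := by ring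
    omega

/-- The coupon collector's overhead, of order `r ^ 81 * log r`, is small against `k * r ^ 60 > r ^
82`. -/
theorem exists_strategy_of_pow_lt {n k r : ℕ} (hr : 200 ≤ r) (hε : failureBound r ≤ 1 / 2)
    (hrn : r ^ 80 ≤ n) (hnr : n ≤ 2 * r ^ 80) (hk : r ^ 22 < k) (hkn : k < n) :
    ∃ σ : Strategy n, ENNReal.ofReal (1 - failureBound r) ≤
      treesLaw n {T | ∃ t : ℕ, 2 * t ≤ n * k + 4 * k * r ^ 60 ∧ Outcome σ k t T} := by
  have hr0 : 0 < r := by omega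
  have pw : ∀ c i j : ℕ, c ≤ 200 → i < j → c * r ^ i ≤ r ^ j := fun c i j hc hij =>
    mul_pow_le_pow hr0 (hc.trans hr) hij
  have hn2 : 2 ≤ n := by omega
  have hr1 : (1 : ℝ) ≤ (r : ℝ) := by exact_mod_cast hr0
  have hrpos : (0 : ℝ) < r := by linarith
  have hn0 : (0 : ℝ) < n := by exact_mod_cast (by omega : 0 < n)
  have hlog : 0 ≤ Real.log r := Real.log_nonneg hr1
  have hexp0 := Real.exp_pos (-(r : ℝ))
  have hk0 : (0 : ℝ) < k := by exact_mod_cast (by omega : 0 < k)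
  set η : ℝ := n * Real.exp (-r) with hη
  have hη0 : 0 ≤ η := by positivity
  have hE : (r : ℝ) ^ 320 * Real.exp (-r) ≤ (r : ℝ) ^ 330 * Real.exp (-r) :=
    mul_le_mul_of_nonneg_right (pow_le_pow_right₀ hr1 (by norm_num)) hexp0.le
  have hE0 : 0 ≤ (r : ℝ) ^ 330 * Real.exp (-r) := by positivity
  have hη1 : η ≤ 1 / 2 := by
    have h1 := cube_mul_exp_le hr hnr 1 (by norm_num)
    rw [pow_one, ← hη] at h1
    have h2 : 0 ≤ (100 + 972 * Real.log r) / r := by positivity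
    unfold failureBound at hε
    generalize (r : ℝ) ^ 320 * Real.exp (-r) = E₁ at hE h1
    generalize (r : ℝ) ^ 330 * Real.exp (-r) = E₂ at hE hE0 hε
    linarith
  -- Rounded up, so that `2 * s` is `k` or `k + 1`.
  set s := (k + 1) / 2 with hs
  set m := (cyclePower n s).edgeSet.ncard with hm
  have hdeg : ∀ v, (nbrs (cyclePower n s) v).card ≤ 2 * s :=
    card_nbrs_cyclePower_le (by omega)
  have hm2 : 2 * m ≤ n * (k + 1) := by
    rw [hm, ← sum_card_nbrs]
    refine (Finset.sum_le_card_nsmul _ _ (k + 1) fun v _ => (hdeg v).trans (by omega)).trans_eq ?_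
    rw [Finset.card_univ, Fintype.card_fin, smul_eq_mul]
  have hmn : m ≤ n * n := by
    have := Nat.mul_le_mul_left n (show k + 1 ≤ n by omega)
    omega
  have hr80 : 4 * r ≤ n := by
    have := pw 4 1 80 (by norm_num) (by norm_num)
    rw [pow_one] at this
    omega
  have hrk : 2 * r ≤ k := by
    have := pw 2 1 22 (by norm_num) (by norm_num)
    rw [pow_one] at this
    omega
  have hconn : IsKConnected k (cyclePower n s) :=
    isKConnected_cyclePower (by omega) (by omega) hkn
  obtain ⟨σ, hσ⟩ := exists_strategy_fixed_target hn2 (L := n * r) (W := k * r ^ 60) (η := η) hconn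
    (Nat.mul_pos (by omega) hr0)
    (by
      have := Nat.mul_le_mul_left n (show 2 * r ≤ n - 1 by omega)
      calc 2 * (n * r) = n * (2 * r) := by ring
        _ ≤ _ := this)
    (by
      calc 2 * (n * r) = n * (2 * r) := by ring
        _ ≤ _ := Nat.mul_le_mul_left n hrk)
    (by rw [hη, Nat.cast_mul, mul_div_cancel_left₀ _ hn0.ne']) hη1
    (Nat.mul_pos (by omega) (Nat.pow_pos hr0))
  rw [← hm] at hσ
  refine ⟨σ, (ENNReal.ofReal_le_ofReal ?_).trans (hσ.trans (measure_mono fun T hT => ?_))⟩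
  · have hm' : (m : ℝ) ≤ (n : ℝ) ^ 2 := by
      rw [pow_two]
      exact_mod_cast hmn
    have hn1 : (1 : ℝ) ≤ n := by exact_mod_cast (by omega : 1 ≤ n)
    have hWr : (1 : ℝ) ≤ (k : ℝ) * (r : ℝ) ^ 60 := by
      have : 1 ≤ k * r ^ 60 := Nat.mul_pos (by omega) (Nat.pow_pos hr0)
      exact_mod_cast this
    have h1 : 6 * ((n * r : ℕ) : ℝ) * η * m ≤ 96 * ((r : ℝ) ^ 330 * Real.exp (-r)) := by
      have h2 := cube_mul_exp_le hr hnr 4 (by norm_num)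
      have h3 := mul_le_mul_of_nonneg_left h2 hrpos.le
      have h4 : (r : ℝ) * ((r : ℝ) ^ 320 * Real.exp (-r)) ≤ (r : ℝ) ^ 330 * Real.exp (-r) := by
        rw [← mul_assoc, ← pow_succ']
        exact mul_le_mul_of_nonneg_right (pow_le_pow_right₀ hr1 (by norm_num)) hexp0.le
      have h5 : 6 * ((n * r : ℕ) : ℝ) * η * m ≤ 6 * (r * ((n : ℝ) ^ 4 * Real.exp (-r))) := by
        rw [hη]
        push_cast
        calc _ ≤ 6 * ((n : ℝ) * r) * (n * Real.exp (-r)) * (n : ℝ) ^ 2 := by gcongr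
          _ = _ := by ring
      rw [mul_left_comm (r : ℝ) 16] at h3
      generalize (r : ℝ) * ((r : ℝ) ^ 320 * Real.exp (-r)) = E₁ at h4 h3
      generalize (r : ℝ) ^ 330 * Real.exp (-r) = E₂ at h4 ⊢
      linarith
    have h2 : 2 * η * m ≤ 32 * ((r : ℝ) ^ 330 * Real.exp (-r)) := by
      have h3 := cube_mul_exp_le hr hnr 3 (by norm_num)
      have h4 : 2 * η * m ≤ 2 * ((n : ℝ) ^ 3 * Real.exp (-r)) := by
        rw [hη]
        calc _ ≤ 2 * (n * Real.exp (-r)) * (n : ℝ) ^ 2 := by gcongr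
          _ = _ := by ring
      generalize (r : ℝ) ^ 320 * Real.exp (-r) = E₁ at hE h3
      generalize (r : ℝ) ^ 330 * Real.exp (-r) = E₂ at hE ⊢
      linarith
    have hlogm : Real.log m ≤ 162 * Real.log r := by
      rcases Nat.eq_zero_or_pos m with h0 | h0
      · rw [h0, Nat.cast_zero, Real.log_zero]
        positivity
      · have h3 : n ≤ r ^ 81 := hnr.trans (pw 2 80 81 (by norm_num) (by norm_num))
        have h4 : m ≤ r ^ 162 := by
          calc m ≤ n * n := hmn
            _ ≤ r ^ 81 * r ^ 81 := Nat.mul_le_mul h3 h3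
            _ = r ^ 162 := by rw [← pow_add]
        have h5 : (m : ℝ) ≤ (r : ℝ) ^ 162 := by exact_mod_cast h4
        have h6 := Real.log_le_log (by exact_mod_cast h0) h5
        rw [Real.log_pow] at h6
        exact_mod_cast h6
    have h3 : 3 * ((n * r : ℕ) : ℝ) * (1 + Real.log m) / (k * (r : ℝ) ^ 60) ≤
        (6 + 972 * Real.log r) / r := by
      rw [div_le_div_iff₀ (by positivity) hrpos]
      have h4 : (n : ℝ) ≤ 2 * (r : ℝ) ^ 80 := by exact_mod_cast hnr
      have h5 : (r : ℝ) ^ 22 ≤ k := by exact_mod_cast hk.le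
      push_cast
      calc 3 * ((n : ℝ) * r) * (1 + Real.log m) * r
          ≤ 3 * ((n : ℝ) * r) * (1 + 162 * Real.log r) * r := by gcongr
        _ ≤ 3 * ((2 * (r : ℝ) ^ 80) * r) * (1 + 162 * Real.log r) * r := by gcongr
        _ = (6 + 972 * Real.log r) * ((r : ℝ) ^ 22 * (r : ℝ) ^ 60) := by ring
        _ ≤ _ := by gcongr
    have h4 : (2 * η * m + 3 * ((n * r : ℕ) : ℝ) * (1 + Real.log m)) / ((k * r ^ 60 : ℕ) : ℝ) ≤
        32 * ((r : ℝ) ^ 330 * Real.exp (-r)) + (6 + 972 * Real.log r) / r := by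
      rw [add_div]
      rw [Nat.cast_mul k, Nat.cast_pow]
      exact add_le_add ((div_le_self (by positivity) hWr).trans h2) h3
    refine sub_le_sub_left ((add_le_add h1 h4).trans ?_) 1
    have h5 : (6 + 972 * Real.log r) / r ≤ (100 + 972 * Real.log r) / r :=
      div_le_div_of_nonneg_right (by linarith) hrpos.le
    unfold failureBound
    generalize (r : ℝ) ^ 330 * Real.exp (-r) = E₂ at hE0 ⊢
    linarith
  · obtain ⟨t, ht, hτ, hG⟩ := hT
    refine ⟨t, ?_, hτ, graphAfter σ T t, le_rfl, hG.2, degreesKOrSucc_of_card_nbrs hG.2 fun v =>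
      (Finset.card_le_card (nbrs_mono hG.1 v)).trans ((hdeg v).trans (by omega))⟩
    -- Twice the number of target edges may exceed `n * k` by `n ≤ 2 * r ^ 80`, which is at most `2
    -- * k * r ^ 60`.
    have h1 : r ^ 20 * r ^ 60 ≤ k * r ^ 60 := Nat.mul_le_mul_right _
      ((Nat.pow_le_pow_right hr0 (by norm_num)).trans hk.le)
    rw [← pow_add] at h1
    norm_num at h1
    have e3 : 4 * k * r ^ 60 = 4 * (k * r ^ 60) := by ring
    rw [mul_add, mul_one] at hm2
    omega

/-! ### Passing to the limit in `n`. -/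

theorem add_one_pow_le {r : ℕ} (hr : 200 ≤ r) : (r + 1) ^ 80 ≤ 2 * r ^ 80 := by
  have hr0 : (200 : ℝ) ≤ r := by exact_mod_cast hr
  -- Bernoulli's inequality for `(r / (r + 1)) ^ 80`, which is at least `1 - 80 / (r + 1) ≥ 1 / 2`.
  have h1 := one_add_mul_le_pow (a := -1 / ((r : ℝ) + 1)) (by
    rw [le_div_iff₀ (by linarith)]; linarith) 80
  have h2 : 1 + -1 / ((r : ℝ) + 1) = r / (r + 1) := by field_simp; ring
  have h3 : (1 : ℝ) / 2 ≤ 1 + (80 : ℕ) * (-1 / ((r : ℝ) + 1)) := by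
    have h4 : (80 : ℝ) / (r + 1) ≤ 1 / 2 := by
      rw [div_le_div_iff₀ (by linarith) (by norm_num)]; linarith
    have e : ((80 : ℕ) : ℝ) * (-1 / ((r : ℝ) + 1)) = -(80 / (r + 1)) := by
      rw [Nat.cast_ofNat, mul_div_assoc', mul_neg_one, neg_div]
    rw [e]
    linarith
  rw [h2, div_pow] at h1
  have h4 := h3.trans h1
  rw [le_div_iff₀ (by positivity)] at h4
  have h5 : ((r : ℝ) + 1) ^ 80 ≤ 2 * (r : ℝ) ^ 80 := by
    generalize ((r : ℝ) + 1) ^ 80 = x at h4 ⊢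
    linarith
  exact_mod_cast h5

theorem exists_pow_le_le (n : ℕ) (hn : 200 ^ 80 ≤ n) :
    ∃ r, 200 ≤ r ∧ r ^ 80 ≤ n ∧ n ≤ 2 * r ^ 80 ∧ n < (r + 1) ^ 80 := by
  obtain ⟨r, h1, h2⟩ : ∃ r, r ^ 80 ≤ n ∧ n < (r + 1) ^ 80 :=
    ⟨_, Nat.pow_nthRoot_le (Or.inl (by norm_num)), Nat.lt_pow_nthRoot_add_one (by norm_num) n⟩
  have h3 : 200 ≤ r := by
    have : 200 < r + 1 := lt_of_pow_lt_pow_left₀ 80 (by omega) (hn.trans_lt h2)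
    omega
  exact ⟨r, h3, h1, h2.le.trans (add_one_pow_le h3), h2⟩

theorem nonempty_strategy {n : ℕ} (hn : 2 ≤ n) : Nonempty (Strategy n) := by
  classical
  obtain ⟨σ, -⟩ := exists_strategy hn fun _ => ∅
  exact ⟨σ⟩

/-- The strategies are chosen once, independently of `ω`, and one event yields both the time bound
and the subgraph. Which construction is used is decided for each `n` by comparing `k n` with `r n ^
22`. -/
theorem exists_failure_sequence (k : ℕ → ℕ) (hk2 : ∀ᶠ n in atTop, 2 ≤ k n)
    (hkn : ∀ᶠ n in atTop, k n < n) :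
    ∃ (ε : ℕ → ℝ) (σ : (n : ℕ) → 2 ≤ n → Strategy n), Tendsto ε atTop (𝓝 0) ∧
      ∀ᶠ n in atTop, ∃ hn : 2 ≤ n, ENNReal.ofReal (1 - ε n) ≤ treesLaw n {T | ∃ t : ℕ,
        (t : ℝ) ≤ n * k n / 2 + 2 * k n * (n : ℝ) ^ (3 / 4 : ℝ) ∧ Outcome (σ n hn) (k n) t T} := by
  choose! r hr hrn hnr hnr' using exists_pow_le_le
  have hrtop : Tendsto r atTop atTop := by
    rw [tendsto_atTop_atTop]
    intro b
    refine ⟨max (200 ^ 80) (b ^ 80), fun n hn => ?_⟩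
    have h1 := hnr' n ((le_max_left _ _).trans hn)
    have h2 : b < r n + 1 := lt_of_pow_lt_pow_left₀ 80 (by omega)
      (((le_max_right _ _).trans hn).trans_lt h1)
    omega
  have htend := tendsto_failureBound.comp hrtop
  have hex : ∀ n (hn : 2 ≤ n), ∃ σ : Strategy n, 200 ^ 80 ≤ n → failureBound (r n) ≤ 1 / 2 →
      2 ≤ k n → k n < n → ENNReal.ofReal (1 - failureBound (r n)) ≤
      treesLaw n {T | ∃ t : ℕ, 2 * t ≤ n * k n + 4 * k n * r n ^ 60 ∧ Outcome σ (k n) t T} := by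
    intro n hn
    by_cases h : 200 ^ 80 ≤ n ∧ failureBound (r n) ≤ 1 / 2 ∧ 2 ≤ k n ∧ k n < n
    · obtain ⟨h0, h1, h2, h3⟩ := h
      rcases le_or_gt (k n) (r n ^ 22) with h4 | h4
      · obtain ⟨σ, hσ⟩ := exists_strategy_of_le_pow (hr n h0) h1 (hrn n h0) (hnr n h0) h2 h4
        exact ⟨σ, fun _ _ _ _ => hσ⟩
      · obtain ⟨σ, hσ⟩ := exists_strategy_of_pow_lt (hr n h0) h1 (hrn n h0) (hnr n h0) h4 h3
        exact ⟨σ, fun _ _ _ _ => hσ⟩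
    · obtain ⟨σ⟩ := nonempty_strategy hn
      exact ⟨σ, fun h0 h1 h2 h3 => absurd ⟨h0, h1, h2, h3⟩ h⟩
  choose σ hσ using hex
  refine ⟨fun n => failureBound (r n), σ, htend, ?_⟩
  filter_upwards [hk2, hkn, eventually_ge_atTop (200 ^ 80),
    htend.eventually_le_const (show (0 : ℝ) < 1 / 2 by norm_num)] with n h2 h3 h0 h1
  have hn : 2 ≤ n := h2.trans h3.le
  refine ⟨hn, (hσ n hn h0 h1 h2 h3).trans (measure_mono fun T hT => ?_)⟩
  obtain ⟨t, ht, hO⟩ := hT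
  refine ⟨t, ?_, hO⟩
  -- The exponent `60 / 80` is where `3 / 4` comes from.
  have h4 : (r n : ℝ) ^ 60 ≤ (n : ℝ) ^ (3 / 4 : ℝ) := by
    have h5 : ((r n : ℝ) ^ 80) ≤ n := by exact_mod_cast hrn n h0
    have h6 := Real.rpow_le_rpow (by positivity) h5 (show (0 : ℝ) ≤ 3 / 4 by norm_num)
    rw [← Real.rpow_natCast, ← Real.rpow_mul (by positivity)] at h6
    rw [← Real.rpow_natCast]
    refine le_trans (le_of_eq ?_) h6
    norm_num
  have h5 : (2 : ℝ) * t ≤ n * k n + 4 * k n * (r n : ℝ) ^ 60 := by exact_mod_cast ht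
  have h6 := mul_le_mul_of_nonneg_left h4 (Nat.cast_nonneg (α := ℝ) (k n))
  linarith

theorem whp_of_le {A : (n : ℕ) → Set (ℕ → SpanningTree n)} {ε : ℕ → ℝ}
    (hε : Tendsto ε atTop (𝓝 0))
    (h : ∀ᶠ n in atTop, ENNReal.ofReal (1 - ε n) ≤ treesLaw n (A n)) : Whp A := by
  have h1 : Tendsto (fun n => ENNReal.ofReal (1 - ε n)) atTop (𝓝 1) := by
    simpa using ENNReal.tendsto_ofReal (hε.const_sub 1)
  refine tendsto_of_tendsto_of_tendsto_of_le_of_le' h1 tendsto_const_nhds h ?_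
  filter_upwards [eventually_gt_atTop 0] with n hn
  have := isProbabilityMeasure_treesLaw hn
  exact prob_le_one

end USTSR

theorem mainTheorem4 (k : ℕ → ℕ) (ω : ℕ → ℝ)
    (hk2 : ∀ᶠ n in atTop, 2 ≤ k n)
    (hk : (fun n : ℕ => (k n : ℝ)) =o[atTop] (fun n : ℕ => (n : ℝ)))
    (hω : Tendsto ω atTop atTop) :
    ∃ σ : (n : ℕ) → 2 ≤ n → USTSR.Strategy n,
      USTSR.Whp (fun n => {T | ∃ hn : 2 ≤ n, ∃ t : ℕ,
        USTSR.hittingTime (σ n hn) (USTSR.kConnectedGraphs n (k n)) T = (t : ℕ∞) ∧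
        (t : ℝ) ≤ (n : ℝ) * (k n : ℝ) / 2 +
          ω n * (k n : ℝ) * max (k n : ℝ) ((n : ℝ) ^ (3 / 4 : ℝ))}) ∧
      ((fun n : ℕ => (k n : ℝ)) =o[atTop]
          (fun n : ℕ => (n : ℝ) ^ (1 / 2 : ℝ) / (Real.log (n : ℝ)) ^ 2) →
        USTSR.Whp (fun n => {T | ∃ hn : 2 ≤ n, ∃ t : ℕ,
          USTSR.hittingTime (σ n hn) (USTSR.kConnectedGraphs n (k n)) T = (t : ℕ∞) ∧
          ∃ H : SimpleGraph (Fin n), H ≤ USTSR.graphAfter (σ n hn) T t ∧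
            USTSR.IsKConnected (k n) H ∧ USTSR.DegreesKOrSucc (k n) H})) := by
  have hkn : ∀ᶠ n in atTop, k n < n := by
    filter_upwards [hk.bound (show (0 : ℝ) < 1 / 2 by norm_num), eventually_gt_atTop 0]
      with n h1 h2
    have h3 : (0 : ℝ) < n := by exact_mod_cast h2
    rw [Real.norm_of_nonneg (Nat.cast_nonneg _), Real.norm_of_nonneg (Nat.cast_nonneg _)] at h1
    have : (k n : ℝ) < n := by linarith
    exact_mod_cast this
  obtain ⟨ε, σ, hε, hσ⟩ := USTSR.exists_failure_sequence k hk2 hkn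
  refine ⟨σ, USTSR.whp_of_le hε ?_, fun _ => USTSR.whp_of_le hε ?_⟩
  · filter_upwards [hσ, hω.eventually_ge_atTop 2] with n ⟨hn, h⟩ hω2
    refine h.trans (measure_mono fun T hT => ?_)
    obtain ⟨t, ht, hτ, -⟩ := hT
    -- Once `ω n ≥ 2` it absorbs the constant, and `n ^ (3/4)` is bounded by the maximum.
    refine ⟨hn, t, hτ, ht.trans (add_le_add_right ?_ _)⟩
    gcongr
    exact le_max_right _ _
  · filter_upwards [hσ] with n ⟨hn, h⟩
    refine h.trans (measure_mono fun T hT => ?_)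
    obtain ⟨t, -, hτ, hH⟩ := hT
    exact ⟨hn, t, hτ, hH⟩
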